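/- **Setting.** Let $e\ge 1$, let $\mathbf m=(m_0,\dots,m_{e-1})$ be positive integers, $n\ge 0$, $F=\mathbb C(q,t)$, and let $x=(x^{(k)}_j)$ ($0\le k\le e-1$, $1\le j\le m_k$) be variables, the upper index being read modulo $e$. Put $\mathfrak S_{\mathbf m}=\prod_k\mathfrak S_{m_k}$ (permuting the variables in each row), $\Xi_{\mathbf m,F}=F[x]^{\mathfrak S_{\mathbf m}}$. Let $\mathcal P_{\mathbf m}$ be the set of $e$-tuples of partitions $\alpha=(\alpha^{(k)}_j)$ with $\alpha^{(k)}_1\ge\dots\ge\alpha^{(k)}_{m_k}\ge 0$, and $Z_n$ the set of those of size $n$. For $\beta=(\beta^{(k)}_j)$ with entries in $\mathbb Z_{\ge 0}$ put $x^\beta=\prod (x_j^{(k)})^{\beta_j^{(k)}}$ and $a_\beta=\sum_{w\in\mathfrak S_{\mathbf m}}\varepsilon(w)\,w(x^\beta)$. Let $\delta^{(k)}=(m_k-1,\dots,1,0)$, $m_\alpha=\prod_k m_{\alpha^{(k)}}(x^{(k)})$ (monomial symmetric polynomials) and $s_\alpha=\prod_k s_{\alpha^{(k)}}(x^{(k)})=a_{\alpha+\delta}/a_\delta$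 (Schur polynomials). **Symbols.** The symbol of type $(1,0)$ of $\alpha$ is $\Lambda(\alpha)=\alpha+\delta$. Write $\alpha\sim\beta$ if $\Lambda(\alpha)$ and $\Lambda(\beta)$ have the same entries with multiplicities; the classes are called families. Let $a(\alpha)=\sum\min\{\lambda,\lambda'\}-\sum\min\{\mu,\mu'\}$, the sums being over unordered pairs of entries (at distinct positions) of $\Lambda(\alpha)$ and of $\delta$ respectively. Fix a total order $\prec$ on $Z_n$ such that $a(\alpha)\ge a(\beta)$ whenever $\alpha\prec\beta$ and each family is an interval. **Scalar product.** Let $g^{(k)}_{d,\pm}\in\Xi_{\mathbf m,F}$ be the coefficient of $y^d$ in $$\prod_{r\ge 0}\frac{\prod_i\bigl(1-t\,x_i^{(k\mp r\mp 1)}y\,q^r\bigr)}{\prod_i\bigl(1-x_i^{(k\mp r)}y\,q^r\bigr)}$$ (the infinite product converges $q$-adically, coefficient by coefficient), and put $g_{\alpha,\pm}=\prod_{k,j}g^{(k)}_{\alpha^{(k)}_j,\pm}$. There is a unique form $\langle\ ,\ \rangle$ on $\Xi_{\mathbf m,F}$, linear in the first argument and conjugate-linear in the second (conjugation acting on complex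 coefficients and fixing $q,t$), such that $\langle g_{\alpha,+},m_\beta\rangle=\langle m_\alpha,g_{\beta,-}\rangle=\delta_{\alpha,\beta}$ for all $\alpha,\beta\in\mathcal P_{\mathbf m}$. **Macdonald functions.** There are unique $P^{\pm}_{\Lambda(\alpha)}\in\Xi_{\mathbf m,F}$ ($\alpha\in Z_n$) such that (i) $P^\pm_{\Lambda(\alpha)}=s_\alpha+\sum_{\beta\in Z_n} u^\pm_{\alpha,\beta}s_\beta$ with $u^\pm_{\alpha,\beta}\in F$ and $u^{\pm}_{\alpha,\beta}=0$ unless $\beta\prec\alpha$ and $\beta\not\sim\alpha$; (ii) $\langle P^+_{\Lambda(\alpha)},P^-_{\Lambda(\beta)}\rangle=0$ unless $\alpha\sim\beta$. **Macdonald operators.** For $1\le r\le\min_k m_k$ let $\mathcal I_r$ be the set of sets $J$ of $r$ vectors $\mathbf i=(i_0,\dots,i_{e-1})$, $1\le i_k\le m_k$, any two of which differ in every entry. Write $(k,j)\in J$ if $j=i_k$ for some $\mathbf i\in J$, and $\langle\beta,J\rangle=\sum_{(k,j)\in J}\beta^{(k)}_j$. For $u\in F$ let $T^\pm_{u,J}$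 be the substitution replacing $x^{(k)}_{i_k}$ by $u\,x^{(k\mp1)}_{i_{k\mp1}}$ for all $\mathbf i\in J$ and all $k$; define $\beta_{J\pm}$ by $T^{\pm}_{u,J}x^\beta=u^{\langle\beta,J\rangle}x^{\beta_{J\pm}}$. Put $$D^r_\pm=a_\delta^{-1}\sum_{w\in\mathfrak S_{\mathbf m}}\varepsilon(w)\sum_{J\in\mathcal I_r}x^{w(\delta)_{J\pm}}\,t^{\langle w(\delta),J\rangle}\,T^\pm_{q,J}.$$ **Proposition 2.7.** With these notations, the form $\langle\ ,\ \rangle$ and the functions $P^\pm_{\Lambda(\alpha)}$ exist and are unique; for each sign and each $r$ with $1\le r\le\min_k m_k$ there is a unique matrix $(b^{r,\pm}_{\alpha,\beta})_{\alpha,\beta\in Z_n}$ over $F$ with $$D^r_\pm m_\alpha=\sum_{\beta\in Z_n}b^{r,\pm}_{\alpha,\beta}\,m_\beta\qquad(\alpha\in Z_n),$$ and for every $\alpha\in Z_n$ $$D^r_\pm P^\pm_{\Lambda(\alpha)}=\sum_{\beta\sim\alpha}b^{r,\pm}_{\alpha,\beta}\,P^\pm_{\Lambda(\beta)}.$$ 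-/

import Mathlib

noncomputable section

namespace WMac

open Filter Topology

/-! ### The ground field `F = ℂ(q,t)`, realised as `ℂ(t)(q)` -/

abbrev F : Type := RatFunc (RatFunc ℂ)

def q : F := RatFunc.X

def t : F := RatFunc.C RatFunc.X

/-- The map on rational functions in one variable induced by an injective map of coefficients. -/
def ratMap {K L : Type} [Field K] [Field L] (φ : K →+* L) : RatFunc K →+* RatFunc L :=
  RatFunc.mapRingHom (Polynomial.mapRingHom φ) (by
    intro p hp
    rw [Submonoid.mem_comap, mem_nonZeroDivisors_iff_ne_zero]
    rw [mem_nonZeroDivisors_iff_ne_zero] at hp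
    simpa [Polynomial.map_eq_zero] using hp)

/-- Complex conjugation of the coefficients of a rational function in `q` and `t`
(the indeterminates `q` and `t` are fixed). -/
def conjF : F →+* F := ratMap (ratMap (starRingEnd ℂ))

/-! ### Variables, symmetric polynomials, `e`-partitions

Rows are indexed by `ZMod e`, so that upper indices are read modulo `e`.  The columns of row `k`
are indexed by `Fin (m k)`, that is, by `0, …, m_k - 1` instead of `1, …, m_k`. -/

set_option linter.unusedSectionVars false

variable {e : ℕ} [NeZero e]

/-- The index set of the variables `x_j^{(k)}`. -/
abbrev Var (m : ZMod e → ℕ) : Type := Σ k : ZMod e, Fin (m k)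

abbrev Poly (m : ZMod e → ℕ) : Type := MvPolynomial (Var m) F

/-- The field of rational functions in the variables `x_j^{(k)}` over `F`. -/
abbrev RatFn (m : ZMod e → ℕ) : Type := FractionRing (Poly m)

/-- The group `S_m`, the product of the symmetric groups on the rows. -/
abbrev RowPerm (m : ZMod e → ℕ) : Type := ∀ k : ZMod e, Equiv.Perm (Fin (m k))

/-- The permutation of the variables given by an element of `S_m`. -/
def toPerm {m : ZMod e → ℕ} (w : RowPerm m) : Equiv.Perm (Var m) := Equiv.sigmaCongrRight w

/-- The sign of an element of `S_m`. -/
def sgn {m : ZMod e → ℕ} (w : RowPerm m) : ℤˣ := ∏ k, Equiv.Perm.sign (w k)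

/-- The action of `S_m` on sequences `β = (β_j^{(k)})` by permuting the entries of each row. -/
def actSeq {m : ZMod e → ℕ} (w : RowPerm m) (β : Var m → ℕ) : Var m → ℕ :=
  fun v => β ((toPerm w).symm v)

/-- The action of `S_m` on polynomials. -/
def actPoly {m : ZMod e → ℕ} (w : RowPerm m) : Poly m →ₐ[F] Poly m :=
  MvPolynomial.rename (toPerm w)

/-- The algebra of `S_m`-symmetric polynomials with coefficients in `F`. -/
def Xi (m : ZMod e → ℕ) : Subalgebra F (Poly m) where
  carrier := {f | ∀ w : RowPerm m, actPoly w f = f}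
  mul_mem' := by
    intro a b ha hb w
    rw [map_mul, ha w, hb w]
  add_mem' := by
    intro a b ha hb w
    rw [map_add, ha w, hb w]
  algebraMap_mem' := by
    intro c w
    exact (actPoly w).commutes c

/-- The inclusion of symmetric polynomials into the field of rational functions. -/
def toRat {m : ZMod e → ℕ} (f : Xi m) : RatFn m := algebraMap (Poly m) (RatFn m) (f : Poly m)

/-- The monomial `x^β`. -/
def xpow {m : ZMod e → ℕ} (β : Var m → ℕ) : Poly m :=
  MvPolynomial.monomial (Finsupp.equivFunOnFinite.symm β) 1

/-- `e`-partitions `α = (α_j^{(k)})` whose `k`-th row has at most `m_k` non-zero parts. -/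
abbrev EPart (m : ZMod e → ℕ) : Type :=
  {α : Var m → ℕ // ∀ k : ZMod e, Antitone fun j : Fin (m k) => α ⟨k, j⟩}

/-- The `e`-partitions of size `n` whose `k`-th row has at most `m_k` non-zero parts. -/
abbrev Zn (m : ZMod e → ℕ) (n : ℕ) : Type := {α : EPart m // ∑ v, α.1 v = n}

instance {m : ZMod e → ℕ} {n : ℕ} : Fintype (Zn m n) :=
  Fintype.ofInjective
    (fun (α : Zn m n) (v : Var m) => (⟨α.1.1 v, by
      have h : α.1.1 v ≤ ∑ v, α.1.1 v :=
        Finset.single_le_sum (f := α.1.1) (fun _ _ => Nat.zero_le _) (Finset.mem_univ v)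
      have h2 := α.2
      omega⟩ : Fin (n + 1)))
    (by
      intro α β h
      apply Subtype.ext
      apply Subtype.ext
      funext v
      exact congrArg Fin.val (congrFun h v))

/-- The set of all row permutations of `α`. -/
def orbit {m : ZMod e → ℕ} (α : Var m → ℕ) : Finset (Var m → ℕ) :=
  Finset.univ.image fun w : RowPerm m => actSeq w α

theorem actPoly_xpow {m : ZMod e → ℕ} (w : RowPerm m) (β : Var m → ℕ) :
    actPoly w (xpow β) = xpow (actSeq w β) := by
  unfold actPoly xpow
  rw [MvPolynomial.rename_monomial]
  refine congrArg (fun c : Var m →₀ ℕ => MvPolynomial.monomial c (1 : F)) ?_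
  refine Finsupp.ext fun v => ?_
  have h := Finsupp.mapDomain_apply (toPerm w).injective
    (Finsupp.equivFunOnFinite.symm β : Var m →₀ ℕ) ((toPerm w).symm v)
  rw [Equiv.apply_symm_apply] at h
  rw [h]
  rfl

theorem actSeq_mul {m : ZMod e → ℕ} (w w' : RowPerm m) (β : Var m → ℕ) :
    actSeq w (actSeq w' β) = actSeq (w * w') β := by
  funext v
  rfl

/-- The monomial symmetric polynomial `m_α(x) = ∏ₖ m_{α^{(k)}}(x^{(k)})`: the sum of `x^β` over
all the distinct row permutations `β` of `α`. -/
def monSym {m : ZMod e → ℕ} (α : EPart m) : Xi m :=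
  ⟨∑ β ∈ orbit α.1, xpow β, by
    intro w
    rw [map_sum]
    simp only [actPoly_xpow]
    refine Finset.sum_bij (fun β _ => actSeq w β) ?_ ?_ ?_ ?_
    · intro β hβ
      obtain ⟨w', _, rfl⟩ := Finset.mem_image.1 hβ
      rw [actSeq_mul]
      exact Finset.mem_image_of_mem _ (Finset.mem_univ _)
    · intro a _ b _ h
      have h' := congrArg (actSeq w⁻¹) h
      simp only [actSeq_mul, inv_mul_cancel] at h'
      exact h'
    · intro β hβ
      obtain ⟨w', _, rfl⟩ := Finset.mem_image.1 hβ
      refine ⟨actSeq (w⁻¹ * w') α.1, Finset.mem_image_of_mem _ (Finset.mem_univ _), ?_⟩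
      rw [actSeq_mul, mul_inv_cancel_left]
    · intro _ _
      rfl⟩

/-! ### Symbols of type `(1,0)`, families, the `a`-function -/

/-- `δ^{(k)} = (m_k - 1, …, 1, 0)`. -/
def delta (m : ZMod e → ℕ) : Var m → ℕ := fun v => m v.1 - 1 - v.2

/-- The symbol `Λ(α) = α + δ` of type `(1,0)`. -/
def symbol {m : ZMod e → ℕ} (α : EPart m) : Var m → ℕ := fun v => α.1 v + delta m v

/-- `α ∼ β`: the symbols of `α` and `β` have the same entries, with multiplicities. -/
def Similar {m : ZMod e → ℕ} {n : ℕ} (α β : Zn m n) : Prop :=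
  (Finset.univ : Finset (Var m)).val.map (symbol α.1) =
    (Finset.univ : Finset (Var m)).val.map (symbol β.1)

/-- The sum of `min{λ, λ'}` over all unordered pairs of (distinct positions of) entries. -/
def minSum {m : ZMod e → ℕ} (L : Var m → ℕ) : ℕ :=
  ∑ z : Sym2 (Var m) with ¬ z.IsDiag,
    Sym2.lift ⟨fun v w => min (L v) (L w), fun _ _ => min_comm _ _⟩ z

/-- The `a`-function. -/
def aFun {m : ZMod e → ℕ} {n : ℕ} (α : Zn m n) : ℤ :=
  (minSum (symbol α.1) : ℤ) - (minSum (delta m) : ℤ)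

/-- The total orders `≺` used to define Macdonald functions: `a(α) ≥ a(β)` whenever `α ≺ β`, and
each family is an interval. -/
structure IsAdmissible {m : ZMod e → ℕ} {n : ℕ} (prec : Zn m n → Zn m n → Prop) : Prop where
  total : IsStrictTotalOrder (Zn m n) prec
  aFun_le : ∀ α β, prec α β → aFun β ≤ aFun α
  interval : ∀ α β γ, Similar α β → prec α γ → prec γ β → Similar α γ

/-! ### The functions `g` and the scalar product

The sign `±` is an element `s` of `ℤˣ = {1, -1}`; the row `k ∓ a` is `shift s k a`. -/

/-- The row `k ∓ a`, where `∓` is opposite to the sign `s`. -/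
def shift (s : ℤˣ) (k : ZMod e) (a : ℕ) : ZMod e := k - ((s : ℤ) : ZMod e) * (a : ZMod e)

/-- The power series `1 - c x_v Y` in one variable `Y`. -/
def linFactor {m : ZMod e → ℕ} (c : F) (v : Var m) : PowerSeries (Poly m) :=
  1 - PowerSeries.C (MvPolynomial.C c * MvPolynomial.X v) * PowerSeries.X

/-- The product over `i` and over `0 ≤ r < N` of
`(1 - t x_i^{(k∓r∓1)} Y q^r) / (1 - x_i^{(k∓r)} Y q^r)`, as a power series in `Y`. -/
def gPartial {m : ZMod e → ℕ} (s : ℤˣ) (k : ZMod e) (N : ℕ) : PowerSeries (Poly m) :=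
  ∏ r ∈ Finset.range N,
    (∏ i : Fin (m (shift s k (r + 1))), linFactor (t * q ^ r) ⟨shift s k (r + 1), i⟩) *
      ∏ i : Fin (m (shift s k r)),
        PowerSeries.invOfUnit (linFactor (q ^ r) ⟨shift s k r, i⟩) 1

/-- `g` is the coefficient of `Y^d` in the infinite product over all `i` and all `r ≥ 0` of
`(1 - t x_i^{(k∓r∓1)} Y q^r) / (1 - x_i^{(k∓r)} Y q^r)`.  Coefficients of the infinite product are
limits of those of the partial products, for the `q`-adic topology of `F = ℂ(t)(q)`
(which is the topology that Mathlib puts on a field of rational functions). -/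
def IsGCoeff {m : ZMod e → ℕ} (s : ℤˣ) (k : ZMod e) (d : ℕ) (g : Xi m) : Prop :=
  ∀ μ : Var m →₀ ℕ,
    Tendsto
      (fun N => MvPolynomial.coeff μ (PowerSeries.coeff d (gPartial (m := m) s k N)))
      atTop (𝓝 (MvPolynomial.coeff μ (g : Poly m)))

/-- The symmetric polynomial `g_{d,±}^{(k)}(x;q,t)`. -/
def gOne {m : ZMod e → ℕ} (s : ℤˣ) (k : ZMod e) (d : ℕ) : Xi m :=
  Classical.epsilon (IsGCoeff s k d)

/-- `g_{α,±}(x;q,t)`, the product of the `g_{d,±}^{(k)}` for `d = α_j^{(k)}`. -/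
def gFun {m : ZMod e → ℕ} (s : ℤˣ) (α : EPart m) : Xi m := ∏ v : Var m, gOne s v.1 (α.1 v)

open Classical in
/-- `B` (linear in the first and conjugate-linear in the second argument) is the scalar product
on symmetric polynomials: the bases `g_{α,+}` and `m_β` are dual to each other, and so are
`m_α` and `g_{β,-}`. -/
def IsScalarProduct {m : ZMod e → ℕ} (B : Xi m →ₗ[F] Xi m →ₛₗ[conjF] F) : Prop :=
  ∀ α β : EPart m,
    B (gFun 1 α) (monSym β) = (if α = β then 1 else 0) ∧
    B (monSym α) (gFun (-1) β) = (if α = β then 1 else 0)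

/-! ### Schur functions and Macdonald functions -/

/-- `a_β(x) = ∑_{w ∈ S_m} ε(w) w(x^β)`. -/
def alternant {m : ZMod e → ℕ} (β : Var m → ℕ) : Poly m :=
  ∑ w : RowPerm m, ((sgn w : ℤˣ) : ℤ) • actPoly w (xpow β)

/-- The Schur function `s_α(x) = ∏ₖ s_{α^{(k)}}(x^{(k)})`, as the quotient `a_{α+δ} / a_δ` of
alternants (both alternants are the products of the usual alternants of the rows). -/
def schur {m : ZMod e → ℕ} (α : EPart m) : RatFn m :=
  algebraMap (Poly m) (RatFn m) (alternant fun v => α.1 v + delta m v) /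
    algebraMap (Poly m) (RatFn m) (alternant (delta m))

/-- `P s α`, for `s = ±`, are the Macdonald functions `P^±_{Λ(α)}(x;q,t)` with respect to the
total order `prec` and the scalar product `B`. -/
structure IsMacdonald {m : ZMod e → ℕ} {n : ℕ} (prec : Zn m n → Zn m n → Prop)
    (B : Xi m →ₗ[F] Xi m →ₛₗ[conjF] F) (P : ℤˣ → Zn m n → Xi m) : Prop where
  expansion : ∀ (s : ℤˣ) (α : Zn m n), ∃ u : Zn m n → F,
    (∀ β, ¬ (prec β α ∧ ¬ Similar β α) → u β = 0) ∧
      toRat (P s α) = schur α.1 + ∑ β, u β • schur β.1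
  orthogonal : ∀ α β : Zn m n, ¬ Similar α β → B (P 1 α) (P (-1) β) = 0

/-! ### Macdonald operators -/

/-- The set `I_r` of all sets `J` of `r` vectors `i = (i_k)`, any two of which have no
common entries. -/
def IndexSets (m : ZMod e → ℕ) (r : ℕ) : Finset (Finset (∀ k : ZMod e, Fin (m k))) :=
  Finset.univ.filter fun J => J.card = r ∧ ∀ i ∈ J, ∀ j ∈ J, i ≠ j → ∀ k, i k ≠ j k

/-- The position `v = (k, j)` belongs to (the set of positions occupied by) `J`. -/
abbrev Occ {m : ZMod e → ℕ} (J : Finset (∀ k : ZMod e, Fin (m k))) (v : Var m) : Prop :=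
  ∃ i ∈ J, i v.1 = v.2

open Classical in
/-- For `i ∈ J`, the position `(k, i_k)` is moved to `(k ∓ 1, i_{k∓1})`; the positions outside `J`
are fixed. -/
def move {m : ZMod e → ℕ} (s : ℤˣ) (J : Finset (∀ k : ZMod e, Fin (m k))) (v : Var m) : Var m :=
  if h : Occ J v then ⟨shift s v.1 1, h.choose (shift s v.1 1)⟩ else v

open Classical in
/-- The operator `T^±_{u,J}`: for each `i ∈ J`, the variable `x_{i_k}^{(k)}` is replaced by
`u x_{i_{k∓1}}^{(k∓1)}`, for all `k`. -/
def opT {m : ZMod e → ℕ} (s : ℤˣ) (u : F) (J : Finset (∀ k : ZMod e, Fin (m k))) :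
    Poly m →ₐ[F] Poly m :=
  MvPolynomial.aeval fun v =>
    if Occ J v then MvPolynomial.C u * MvPolynomial.X (move s J v) else MvPolynomial.X v

open Classical in
/-- `⟨β, J⟩`, the sum of the entries of `β` at the positions in `J`. -/
def pairing {m : ZMod e → ℕ} (β : Var m → ℕ) (J : Finset (∀ k : ZMod e, Fin (m k))) : ℕ :=
  ∑ v : Var m with Occ J v, β v

/-- `β_{J±}`, characterised by `T^±_{u,J} x^β = u^{⟨β,J⟩} x^{β_{J±}}`: the entry of `β` at a
position `v` is moved to the position `move s J v`.  For `J` in `I_r`, the maps `move s J` and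
`move (-s) J` are inverse to each other. -/
def seqMove {m : ZMod e → ℕ} (s : ℤˣ) (J : Finset (∀ k : ZMod e, Fin (m k)))
    (β : Var m → ℕ) : Var m → ℕ :=
  fun v => β (move (-s) J v)

/-- The Macdonald operator `D^r_±(q,t)`, with values in rational functions because of the
factor `a_δ(x)⁻¹`. -/
def opD {m : ZMod e → ℕ} (s : ℤˣ) (r : ℕ) (f : Poly m) : RatFn m :=
  (algebraMap (Poly m) (RatFn m) (alternant (delta m)))⁻¹ *
    ∑ w : RowPerm m, ((sgn w : ℤˣ) : ℤ) • ∑ J ∈ IndexSets m r,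
      algebraMap (Poly m) (RatFn m)
        (xpow (seqMove s J (actSeq w (delta m))) *
          MvPolynomial.C (t ^ pairing (actSeq w (delta m)) J) * opT s q J f)

/-- `b` is the matrix of `D^r_±` on the monomial basis of the symmetric polynomials of
degree `n`. -/
def IsMonomialMatrix {m : ZMod e → ℕ} {n : ℕ} (s : ℤˣ) (r : ℕ) (b : Zn m n → Zn m n → F) : Prop :=
  ∀ α : Zn m n, opD s r (monSym α.1 : Poly m) = ∑ β, b α β • toRat (monSym β.1)

end WMac

end

/-! ### Alternants, symbols and the `a`-function -/

noncomputable section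

namespace WMac

open Finset

set_option linter.unusedSectionVars false

variable {e : ℕ} [NeZero e] {m : ZMod e → ℕ}

/-! ### Row permutations and alternants -/

/-! Two properties of D^r_± suffice: it is triangular with respect to families, and it is adjoint to
D^r_∓. Let V be the span of the Schur functions in families strictly below that of α. Then P_α ≡ m_α
modulo V, the operator preserves V, and D m_α ≡ ∑_{β∼α} b_{αβ} m_β modulo V, so X = D P_α − ∑_{β∼α}
b_{αβ} P_β lies in V. The functions P_β with β ∼ α are orthogonal to V, and by adjointness so is D
P_α. The form is nondegenerate on V, hence X = 0 (`opXi_eq_sum`).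

Triangularity: a_δ D m_α is a combination of alternants with exponents (δ+β)_J, where β runs over
the row permutations of α (`opE_monSym`). Moving along J only permutes the entries of δ+β, and an
alternant is zero or, up to sign, the alternant of a symbol with the same entries. For β = α this
symbol is in the family of α. For β ≠ α the sum of pairwise minima of δ+β is strictly larger than
that of Λ(α) (`minSum_lt_of_mem_orbit`), so the symbol is in a lower family.

Adjointness: the kernel K = ∑ g_{α,±}(x) m_α(y) is a product over pairs of variables of series c_a(x
y Z), where a is the cyclic distance of the rows and Z records the degree. The functional equations
`IsSol` of the c_a say that K/C does not change when T_{q,J} is applied to K and T_{t,J} to the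
Cauchy kernel C (`kernel_transform`). By the Cauchy determinant, 1/C times an antisymmetrised
product of the series 1/(1 − x_v y_v Z) is a_δ(x) a_δ(y) times a power of Z. In that product, moving
x along J amounts to moving y backwards along J. Hence D_± in x and D_∓ in y have the same effect on
K (`kernel_selfadjoint`).

Nondegeneracy: at q = t = 0 the kernel K becomes C and the Schur functions are orthonormal. The Gram
matrix of the Schur functions is defined over the local ring of ℂ[q,t] at the origin and reduces to
the identity there, so all its principal minors are nonzero (`exists_schurGram`). This yields the
form, the orthogonalisation defining the P_α, and their uniqueness. -/

/-- The exponent vector attached to a sequence. -/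
abbrev expo (β : Var m → ℕ) : Var m →₀ ℕ := Finsupp.equivFunOnFinite.symm β

theorem expo_injective : Function.Injective (expo : (Var m → ℕ) → _) :=
  Finsupp.equivFunOnFinite.symm.injective

theorem coeff_xpow (β γ : Var m → ℕ) :
    MvPolynomial.coeff (expo γ) (xpow β) = if β = γ then (1 : F) else 0 := by
  unfold xpow
  rw [MvPolynomial.coeff_monomial]
  simp [expo]

theorem xpow_add (β γ : Var m → ℕ) : xpow (β + γ) = xpow β * xpow γ := by
  unfold xpow
  rw [MvPolynomial.monomial_mul, one_mul]
  congr 2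
  ext v
  rfl

theorem actSeq_apply (w : RowPerm m) (β : Var m → ℕ) (k : ZMod e) (j : Fin (m k)) :
    actSeq w β ⟨k, j⟩ = β ⟨k, (w k)⁻¹ j⟩ := rfl

theorem actSeq_one (β : Var m → ℕ) : actSeq 1 β = β := rfl

theorem actSeq_add (w : RowPerm m) (β γ : Var m → ℕ) :
    actSeq w (β + γ) = actSeq w β + actSeq w γ := rfl

theorem actSeq_inv_actSeq (w : RowPerm m) (β : Var m → ℕ) : actSeq w⁻¹ (actSeq w β) = β := by
  rw [actSeq_mul, inv_mul_cancel, actSeq_one]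

theorem actSeq_actSeq_inv (w : RowPerm m) (β : Var m → ℕ) : actSeq w (actSeq w⁻¹ β) = β := by
  rw [actSeq_mul, mul_inv_cancel, actSeq_one]

theorem actSeq_injective (w : RowPerm m) : Function.Injective (actSeq w) :=
  Function.LeftInverse.injective (actSeq_inv_actSeq w)

theorem sum_actSeq (w : RowPerm m) (β : Var m → ℕ) : ∑ v, actSeq w β v = ∑ v, β v :=
  Equiv.sum_comp (toPerm w).symm β

theorem map_actSeq (w : RowPerm m) (β : Var m → ℕ) :
    (univ : Finset (Var m)).val.map (actSeq w β) = (univ : Finset (Var m)).val.map β := by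
  have := Multiset.map_univ_val_equiv (toPerm w).symm
  conv_rhs => rw [← this]
  rw [Multiset.map_map]
  rfl

theorem sgn_mul (w w' : RowPerm m) : sgn (w * w') = sgn w * sgn w' := by
  simp [sgn, Finset.prod_mul_distrib]

theorem sgn_mul_self (w : RowPerm m) : sgn w * sgn w = 1 := Int.units_mul_self _

theorem alternant_eq_sum (β : Var m → ℕ) :
    alternant β = ∑ w : RowPerm m, ((sgn w : ℤˣ) : ℤ) • xpow (actSeq w β) := by
  simp only [alternant, actPoly_xpow]

theorem alternant_actSeq (w : RowPerm m) (β : Var m → ℕ) :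
    alternant (actSeq w β) = ((sgn w : ℤˣ) : ℤ) • alternant β := by
  rw [alternant_eq_sum, alternant_eq_sum, Finset.smul_sum]
  rw [← Equiv.sum_comp (Equiv.mulRight w)
    (fun w' : RowPerm m => ((sgn w : ℤˣ) : ℤ) • ((sgn w' : ℤˣ) : ℤ) • xpow (actSeq w' β))]
  refine Finset.sum_congr rfl fun w' _ => ?_
  rw [actSeq_mul, smul_smul, Equiv.coe_mulRight, sgn_mul,
    ← Units.val_mul, mul_comm (sgn w), mul_assoc, sgn_mul_self, mul_one]

/-- The coefficient of `x^κ` in the alternant `a_γ`. -/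
def altCoeff (γ κ : Var m → ℕ) : ℤ :=
  ∑ w : RowPerm m, (sgn w : ℤ) * if actSeq w γ = κ then 1 else 0

theorem coeff_alternant (γ κ : Var m → ℕ) :
    MvPolynomial.coeff (expo κ) (alternant γ) = (altCoeff γ κ : F) := by
  rw [alternant_eq_sum, MvPolynomial.coeff_sum, altCoeff, Int.cast_sum]
  refine Finset.sum_congr rfl fun w _ => ?_
  rw [MvPolynomial.coeff_smul, coeff_xpow]
  push_cast
  rw [zsmul_eq_mul]

theorem row_injective_of_alternant_ne_zero {γ : Var m → ℕ} (h : alternant γ ≠ 0) (k : ZMod e) :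
    Function.Injective fun j : Fin (m k) => γ ⟨k, j⟩ := by
  intro i j hij
  by_contra hne
  apply h
  -- A transposition of two equal entries fixes γ but has sign −1, which forces the alternant to
  -- equal its own negative.
  let w : RowPerm m := Pi.mulSingle k (Equiv.swap i j)
  have hw : actSeq w γ = γ := by
    funext ⟨k', l⟩
    rw [actSeq_apply]
    by_cases hk : k' = k
    · subst hk
      simp only [w, Pi.mulSingle_eq_same, Equiv.swap_inv]
      by_cases h1 : l = i
      · subst h1; rw [Equiv.swap_apply_left]; exact hij.symm
      · by_cases h2 : l = j
        · subst h2; rw [Equiv.swap_apply_right]; exact hij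
        · rw [Equiv.swap_apply_of_ne_of_ne h1 h2]
    · simp only [w, Pi.mulSingle_eq_of_ne hk, inv_one, Equiv.Perm.one_apply]
  have hs : sgn w = -1 := by
    unfold sgn
    rw [Finset.prod_eq_single k]
    · simp only [w, Pi.mulSingle_eq_same]; exact Equiv.Perm.sign_swap hne
    · intro b _ hb
      simp only [w, Pi.mulSingle_eq_of_ne hb, map_one]
    · simp
  have h2 := alternant_actSeq w γ
  rw [hw, hs] at h2
  simpa [self_eq_neg] using h2

/-- A sequence whose rows are weakly decreasing. -/
def RowAntitone (β : Var m → ℕ) : Prop := ∀ k : ZMod e, Antitone fun j : Fin (m k) => β ⟨k, j⟩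

theorem exists_actSeq_rowAntitone (β : Var m → ℕ) : ∃ w : RowPerm m, RowAntitone (actSeq w β) := by
  -- The order dual turns the increasing sort into a decreasing one; the inverse compensates for the
  -- inverse in `actSeq`.
  refine ⟨fun k => (Tuple.sort fun j : Fin (m k) => OrderDual.toDual (β ⟨k, j⟩))⁻¹, fun k => ?_⟩
  have := Tuple.monotone_sort fun j : Fin (m k) => OrderDual.toDual (β ⟨k, j⟩)
  intro i j hij
  simp only [actSeq_apply, inv_inv]
  exact this hij

theorem actSeq_eq_of_rowAntitone {β : Var m → ℕ} {w : RowPerm m} (h : RowAntitone β)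
    (h' : RowAntitone (actSeq w β)) : actSeq w β = β := by
  funext ⟨k, j⟩
  have := Tuple.unique_antitone (f := fun j : Fin (m k) => β ⟨k, j⟩) (σ := (w k)⁻¹) (τ := 1)
    (h' k) (h k)
  exact congrFun this j

theorem mem_orbit {α β : Var m → ℕ} : β ∈ orbit α ↔ ∃ w : RowPerm m, actSeq w α = β := by
  simp [orbit]

theorem self_mem_orbit (α : Var m → ℕ) : α ∈ orbit α := mem_orbit.2 ⟨1, rfl⟩

theorem actSeq_mem_orbit {α β : Var m → ℕ} (w : RowPerm m) (h : β ∈ orbit α) :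
    actSeq w β ∈ orbit α := by
  obtain ⟨w', rfl⟩ := mem_orbit.1 h
  exact mem_orbit.2 ⟨w * w', (actSeq_mul _ _ _).symm⟩

theorem eq_of_mem_orbit {α β : EPart m} (h : β.1 ∈ orbit α.1) : β = α := by
  obtain ⟨w, hw⟩ := mem_orbit.1 h
  apply Subtype.ext
  rw [← hw]
  exact actSeq_eq_of_rowAntitone α.2 (by rw [hw]; exact β.2)

theorem sum_of_mem_orbit {α β : Var m → ℕ} (h : β ∈ orbit α) : ∑ v, β v = ∑ v, α v := by
  obtain ⟨w, rfl⟩ := mem_orbit.1 h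
  exact sum_actSeq w α

theorem delta_strictAnti (k : ZMod e) : StrictAnti fun j : Fin (m k) => delta m ⟨k, j⟩ := by
  intro i j hij
  have h1 := i.2
  have h2 := j.2
  have h3 : (i : ℕ) < j := hij
  simp only [delta]
  omega

theorem symbol_strictAnti (α : EPart m) (k : ZMod e) :
    StrictAnti fun j : Fin (m k) => symbol α ⟨k, j⟩ :=
  fun _ _ hij => add_lt_add_of_le_of_lt (α.2 k hij.le) (delta_strictAnti k hij)

theorem symbol_injective : Function.Injective (symbol : EPart m → _) := by
  intro α β h
  apply Subtype.ext
  funext v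
  have := congrFun h v
  simp only [symbol] at this
  omega

theorem strictAnti_add_le {n : ℕ} {f : Fin n → ℕ} (hf : StrictAnti f) (i j : Fin n) (hij : i ≤ j) :
    f j + (j - i : ℕ) ≤ f i := by
  obtain ⟨d, hd⟩ : ∃ d : ℕ, (j : ℕ) = i + d := ⟨j - i, by have : (i : ℕ) ≤ j := hij; omega⟩
  induction d generalizing j with
  | zero =>
    have : j = i := Fin.ext (by omega)
    subst this
    simp
  | succ d ih =>
    have hj := j.2
    let j' : Fin n := ⟨i + d, by omega⟩
    have h1 := ih j' (by simp [Fin.le_def, j']) rfl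
    have h2 : f j < f j' := hf (by simp [Fin.lt_def, j']; omega)
    simp only [j'] at h1 h2
    omega

theorem exists_symbol_eq {κ : Var m → ℕ} (h : ∀ k, StrictAnti fun j : Fin (m k) => κ ⟨k, j⟩) :
    ∃ β : EPart m, symbol β = κ := by
  have key : ∀ (k : ZMod e) (i j : Fin (m k)), i ≤ j → κ ⟨k, j⟩ + (j - i : ℕ) ≤ κ ⟨k, i⟩ :=
    fun k => strictAnti_add_le (h k)
  have hle : ∀ v, delta m v ≤ κ v := by
    rintro ⟨k, j⟩
    have hj := j.2
    -- Comparison with the last entry of the row, which is at least 0, gives the lower bound m_k − 1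
    -- − j.
    have := key k j ⟨m k - 1, by omega⟩ (by simp [Fin.le_def]; omega)
    simp only [delta]
    simp only at this
    omega
  refine ⟨⟨fun v => κ v - delta m v, fun k i j hij => ?_⟩, ?_⟩
  · have h1 := key k i j hij
    have h2 := hle ⟨k, i⟩
    have h3 := hle ⟨k, j⟩
    have h4 : (i : ℕ) ≤ j := hij
    have h5 := j.2
    simp only [delta] at *
    omega
  · funext v
    have := hle v
    simp only [symbol]
    omega

theorem exists_symbol_of_row_injective {γ : Var m → ℕ}
    (h : ∀ k, Function.Injective fun j : Fin (m k) => γ ⟨k, j⟩) :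
    ∃ (w : RowPerm m) (β : EPart m), actSeq w γ = symbol β := by
  obtain ⟨w, hw⟩ := exists_actSeq_rowAntitone γ
  obtain ⟨β, hβ⟩ := exists_symbol_eq (κ := actSeq w γ) fun k =>
    (hw k).strictAnti_of_injective fun i j hij => (w k)⁻¹.injective (h k hij)
  exact ⟨w, β, hβ.symm⟩

/-- A strictly decreasing row has trivial stabiliser and is its own only decreasing rearrangement,
so at most the identity contributes. -/
theorem altCoeff_symbol (β β' : EPart m) :
    altCoeff (symbol β) (symbol β') = if β = β' then 1 else 0 := by
  have key : ∀ w : RowPerm m, actSeq w (symbol β) = symbol β' ↔ w = 1 ∧ β = β' := by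
    intro w
    constructor
    · intro h
      have h1 : actSeq w (symbol β) = symbol β :=
        actSeq_eq_of_rowAntitone (fun k => (symbol_strictAnti β k).antitone)
          (by rw [h]; exact fun k => (symbol_strictAnti β' k).antitone)
      refine ⟨?_, symbol_injective (h1.symm.trans h)⟩
      funext k
      rw [← inv_inj]
      ext j
      have := (symbol_strictAnti β k).injective (congrFun h1 ⟨k, j⟩)
      exact congrArg _ this
    · rintro ⟨rfl, rfl⟩
      rfl
  simp only [altCoeff, key]
  by_cases h : β = β'
  · simp [h, sgn]
  · simp [h]

theorem sum_symbol (β : EPart m) : ∑ v, symbol β v = ∑ v, β.1 v + ∑ v, delta m v := by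
  simp [symbol, Finset.sum_add_distrib]

theorem exists_of_altCoeff_ne_zero {γ κ : Var m → ℕ} (h : altCoeff γ κ ≠ 0) :
    ∃ w : RowPerm m, actSeq w γ = κ := by
  obtain ⟨w, -, hw⟩ := Finset.exists_ne_zero_of_sum_ne_zero h
  by_contra hcon
  push Not at hcon
  simp [hcon w] at hw

/-- Straightening: the alternant vanishes if a row has a repeated entry, and otherwise sorting the
rows produces a symbol up to sign. At most one term of the sum survives; the sum form makes later
expansions uniform. -/
theorem alternant_expand {n : ℕ} {γ : Var m → ℕ} (hγ : ∑ v, γ v = n + ∑ v, delta m v) :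
    alternant γ =
      ∑ β : Zn m n, (altCoeff γ (symbol β.1) : F) • alternant (symbol β.1) := by
  by_cases h0 : alternant γ = 0
  · rw [h0]
    symm
    refine Finset.sum_eq_zero fun β _ => ?_
    rw [← coeff_alternant, h0, MvPolynomial.coeff_zero, zero_smul]
  · obtain ⟨w, β, hw⟩ := exists_symbol_of_row_injective (row_injective_of_alternant_ne_zero h0)
    have hγ' : alternant γ = ((sgn w : ℤˣ) : ℤ) • alternant (symbol β) := by
      rw [← hw, alternant_actSeq, smul_smul, ← Units.val_mul, sgn_mul_self, Units.val_one, one_smul]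
    have hβ : ∑ v, β.1 v = n := by
      have h1 := sum_actSeq w γ
      rw [hw, sum_symbol, hγ] at h1
      omega
    rw [Finset.sum_eq_single (⟨β, hβ⟩ : Zn m n)]
    · rw [← coeff_alternant, hγ', MvPolynomial.coeff_smul, coeff_alternant, altCoeff_symbol]
      simp [Int.cast_smul_eq_zsmul]
    · intro β' _ hne
      rw [← coeff_alternant, hγ', MvPolynomial.coeff_smul, coeff_alternant, altCoeff_symbol, if_neg]
      · simp
      · rintro rfl
        exact hne rfl
    · simp

theorem zeroPart_symbol : symbol (⟨0, fun _ _ _ _ => le_rfl⟩ : EPart m) = delta m := by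
  funext v
  simp [symbol]

theorem alternant_symbol_ne_zero (β : EPart m) : alternant (symbol β) ≠ 0 := by
  intro h
  have := coeff_alternant (symbol β) (symbol β)
  rw [h, altCoeff_symbol] at this
  simp at this

theorem alternant_delta_ne_zero : alternant (delta m) ≠ 0 := by
  rw [← zeroPart_symbol]
  exact alternant_symbol_ne_zero _

/-! ### Monomial symmetric polynomials -/

theorem coe_monSym (α : EPart m) : (monSym α : Poly m) = ∑ β ∈ orbit α.1, xpow β := rfl

theorem coeff_monSym (α β : EPart m) :
    MvPolynomial.coeff (expo β.1) (monSym α : Poly m) = if α = β then 1 else 0 := by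
  rw [coe_monSym, MvPolynomial.coeff_sum]
  simp only [coeff_xpow, Finset.sum_ite_eq']
  congr 1
  apply propext
  constructor
  · intro h; exact (eq_of_mem_orbit h).symm
  · rintro rfl; exact self_mem_orbit _

/-- Each w permutes the orbit of α, so the symmetric factor can be carried inside the
antisymmetrisation. -/
theorem alternant_mul_eq_sum_orbit (κ : Var m → ℕ) (α : EPart m) :
    alternant κ * (monSym α : Poly m) = ∑ β ∈ orbit α.1, alternant (κ + β) := by
  rw [alternant_eq_sum, Finset.sum_mul]
  simp only [alternant_eq_sum]
  rw [Finset.sum_comm]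
  refine Finset.sum_congr rfl fun w _ => ?_
  rw [coe_monSym, smul_mul_assoc, Finset.mul_sum, Finset.smul_sum]
  symm
  refine Finset.sum_bij (fun β _ => actSeq w β) (fun β hβ => actSeq_mem_orbit w hβ)
    (fun _ _ _ _ h => actSeq_injective w h)
    (fun β hβ => ⟨actSeq w⁻¹ β, actSeq_mem_orbit _ hβ, actSeq_actSeq_inv w β⟩) ?_
  intro β _
  rw [actSeq_add, xpow_add]

/-- The matrix expressing the monomial symmetric polynomials in terms of the Schur functions. -/
def monToSchur {n : ℕ} (α β : Zn m n) : ℤ :=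
  ∑ γ ∈ orbit α.1.1, altCoeff (delta m + γ) (symbol β.1)

theorem alternant_delta_mul_monSym {n : ℕ} (α : Zn m n) :
    alternant (delta m) * (monSym α.1 : Poly m) =
      ∑ β : Zn m n, (monToSchur α β : F) • alternant (symbol β.1) := by
  rw [alternant_mul_eq_sum_orbit]
  simp only [monToSchur, Int.cast_sum, Finset.sum_smul]
  rw [Finset.sum_comm]
  refine Finset.sum_congr rfl fun γ hγ => ?_
  refine alternant_expand ?_
  simp only [Pi.add_apply, Finset.sum_add_distrib]
  rw [sum_of_mem_orbit hγ, α.2, add_comm]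

/-! ### The `a`-function -/

/-- The sum over ordered pairs counts every unordered pair twice, plus the diagonal. In this form
dependence on the multiset of entries alone is visible and estimates are easy. -/
theorem two_mul_minSum (L : Var m → ℕ) :
    2 * minSum L + ∑ v, L v = ∑ v, ∑ w, min (L v) (L w) := by
  classical
  let g : Sym2 (Var m) → ℕ :=
    Sym2.lift ⟨fun v w => min (L v) (L w), fun _ _ => min_comm _ _⟩
  have h1 : ∑ v, ∑ w, min (L v) (L w) = ∑ p : Var m × Var m, g s(p.1, p.2) := by
    rw [Fintype.sum_prod_type]; rfl
  have h2 : ∑ p : Var m × Var m, g s(p.1, p.2)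
      = ∑ p ∈ univ.filter (fun p : Var m × Var m => p.1 ≠ p.2), g s(p.1, p.2)
        + ∑ p ∈ univ.filter (fun p : Var m × Var m => ¬ p.1 ≠ p.2), g s(p.1, p.2) :=
    (Finset.sum_filter_add_sum_filter_not _ _ _).symm
  have h3 : ∑ p ∈ univ.filter (fun p : Var m × Var m => ¬ p.1 ≠ p.2), g s(p.1, p.2)
      = ∑ v, L v := by
    symm
    refine Finset.sum_bij (fun v _ => (v, v)) (by simp) (by simp) ?_ ?_
    · rintro ⟨a, b⟩ h
      simp only [ne_eq, not_not, mem_filter, mem_univ, true_and] at h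
      exact ⟨a, mem_univ _, by simp [h]⟩
    · intro v _
      simp [g]
  have h4 : ∑ p ∈ univ.filter (fun p : Var m × Var m => p.1 ≠ p.2), g s(p.1, p.2)
      = 2 * minSum L := by
    unfold minSum
    rw [Finset.mul_sum, ← Finset.sum_fiberwise_of_maps_to
      (g := fun p : Var m × Var m => s(p.1, p.2)) (t := univ.filter fun z : Sym2 (Var m) => ¬ z.IsDiag)]
    · refine Finset.sum_congr rfl fun z hz => ?_
      induction z with
      | _ a b =>
        simp only [mem_filter, mem_univ, true_and, Sym2.mk_isDiag_iff] at hz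
        have : ((univ.filter (fun p : Var m × Var m => p.1 ≠ p.2)).filter
            fun p => s(p.1, p.2) = s(a, b)) = {(a, b), (b, a)} := by
          ext ⟨c, d⟩
          simp only [ne_eq, mem_filter, mem_univ, true_and, Sym2.eq_iff, mem_insert, mem_singleton,
            Prod.mk.injEq]
          constructor
          · rintro ⟨_, h⟩; exact h
          · rintro (⟨rfl, rfl⟩ | ⟨rfl, rfl⟩)
            · exact ⟨hz, Or.inl ⟨rfl, rfl⟩⟩
            · exact ⟨fun h => hz h.symm, Or.inr ⟨rfl, rfl⟩⟩
        rw [this, Finset.sum_pair (by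
          simp only [ne_eq, Prod.mk.injEq, not_and]
          exact fun h _ => hz h)]
        simp only [g, Sym2.lift_mk]
        rw [min_comm (L b)]
        ring
    · rintro ⟨a, b⟩ h
      simpa using h
  omega

theorem minSum_congr {L L' : Var m → ℕ}
    (h : (univ : Finset (Var m)).val.map L = (univ : Finset (Var m)).val.map L') :
    minSum L = minSum L' := by
  have key : ∀ L : Var m → ℕ, 2 * minSum L + ((univ : Finset (Var m)).val.map L).sum =
      (((univ : Finset (Var m)).val.map L).map fun x =>
        (((univ : Finset (Var m)).val.map L).map fun y => min x y).sum).sum := by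
    intro L
    simp only [Multiset.map_map]
    exact two_mul_minSum L
  have h1 := key L
  have h2 := key L'
  rw [h] at h1
  omega

/-- Spreading two entries apart with fixed sum lowers the sum of minima: by concavity of x ↦ min(x,
b) no pairing with a third entry b gains, and the minimum of the two entries themselves drops
strictly. -/
theorem sum_sum_min_lt {ι : Type*} [Fintype ι] [DecidableEq ι] {L L' : ι → ℕ} {v w : ι}
    (hvw : v ≠ w) (hoff : ∀ u, u ≠ v → u ≠ w → L' u = L u) (hsum : L' v + L' w = L v + L w)
    (h1 : L v < L' v) (h2 : L w < L' v) :
    ∑ a, ∑ b, min (L' a) (L' b) < ∑ a, ∑ b, min (L a) (L b) := by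
  have split : ∀ f : ι → ℕ, ∑ a, f a = f v + (f w + ∑ a ∈ (univ.erase v).erase w, f a) := by
    intro f
    rw [Finset.add_sum_erase _ _ (by simp [hvw.symm]), Finset.add_sum_erase _ _ (mem_univ _)]
  have hU : ∀ u ∈ (univ.erase v).erase w, L' u = L u := by
    intro u hu
    simp only [mem_erase, mem_univ, and_true] at hu
    exact hoff u hu.2 hu.1
  have hrow : ∑ b ∈ (univ.erase v).erase w, min (L' v) (L' b)
      + ∑ b ∈ (univ.erase v).erase w, min (L' w) (L' b)
      ≤ ∑ b ∈ (univ.erase v).erase w, min (L v) (L b)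
      + ∑ b ∈ (univ.erase v).erase w, min (L w) (L b) := by
    rw [← Finset.sum_add_distrib, ← Finset.sum_add_distrib]
    refine Finset.sum_le_sum fun b hb => ?_
    rw [hU b hb]
    omega
  have hUU : ∑ a ∈ (univ.erase v).erase w, ∑ b ∈ (univ.erase v).erase w, min (L' a) (L' b)
      = ∑ a ∈ (univ.erase v).erase w, ∑ b ∈ (univ.erase v).erase w, min (L a) (L b) :=
    Finset.sum_congr rfl fun a ha => Finset.sum_congr rfl fun b hb => by rw [hU a ha, hU b hb]
  have hc : ∀ (L : ι → ℕ) (x : ι), ∑ a ∈ (univ.erase v).erase w, min (L a) (L x)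
      = ∑ a ∈ (univ.erase v).erase w, min (L x) (L a) :=
    fun L x => Finset.sum_congr rfl fun a _ => min_comm _ _
  have full : ∀ L : ι → ℕ, ∑ a, ∑ b, min (L a) (L b) = L v + L w + 2 * min (L v) (L w)
      + 2 * (∑ b ∈ (univ.erase v).erase w, min (L v) (L b)
        + ∑ b ∈ (univ.erase v).erase w, min (L w) (L b))
      + ∑ a ∈ (univ.erase v).erase w, ∑ b ∈ (univ.erase v).erase w, min (L a) (L b) := by
    intro L
    rw [split]
    simp only [split (fun b => min (L _) (L b)), Finset.sum_add_distrib, hc L v, hc L w, min_self,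
      min_comm (L w) (L v)]
    ring
  rw [full L, full L', hUU]
  omega

/-- Swapping an ascent of β puts the larger part on the larger entry of δ, which spreads the two
sums apart. -/
theorem exists_minSum_lt {β : Var m → ℕ} (h : ¬ RowAntitone β) :
    ∃ w : RowPerm m, minSum (delta m + actSeq w β) < minSum (delta m + β) := by
  simp only [RowAntitone, Antitone, not_forall, not_le] at h
  obtain ⟨k, i, j, hij, hlt⟩ := h
  have hij : i < j := lt_of_le_of_ne hij (by rintro rfl; exact lt_irrefl _ hlt)
  let w : RowPerm m := Pi.mulSingle k (Equiv.swap i j)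
  have hi : actSeq w β ⟨k, i⟩ = β ⟨k, j⟩ := by
    rw [actSeq_apply]; simp [w]
  have hj : actSeq w β ⟨k, j⟩ = β ⟨k, i⟩ := by
    rw [actSeq_apply]; simp [w]
  have ho : ∀ u : Var m, u ≠ ⟨k, i⟩ → u ≠ ⟨k, j⟩ → actSeq w β u = β u := by
    rintro ⟨k', l⟩ h1 h2
    rw [actSeq_apply]
    by_cases hk : k' = k
    · subst hk
      simp only [w, Pi.mulSingle_eq_same, Equiv.swap_inv]
      rw [Equiv.swap_apply_of_ne_of_ne (by rintro rfl; exact h1 rfl) (by rintro rfl; exact h2 rfl)]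
    · simp only [w, Pi.mulSingle_eq_of_ne hk, inv_one, Equiv.Perm.one_apply]
  have hd : delta m ⟨k, j⟩ < delta m ⟨k, i⟩ := delta_strictAnti k hij
  refine ⟨w, ?_⟩
  have hlt2 := sum_sum_min_lt (L := delta m + β) (L' := delta m + actSeq w β) (v := ⟨k, i⟩)
    (w := ⟨k, j⟩) (by simp [hij.ne])
    (fun u h1 h2 => by simp only [Pi.add_apply, ho u h1 h2])
    (by simp only [Pi.add_apply, hi, hj]; omega)
    (by simp only [Pi.add_apply, hi]; omega) (by simp only [Pi.add_apply, hi]; omega)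
  rw [← two_mul_minSum, ← two_mul_minSum] at hlt2
  have hs : ∑ v, (delta m + actSeq w β) v = ∑ v, (delta m + β) v := by
    simp only [Pi.add_apply, Finset.sum_add_distrib, sum_actSeq]
  omega

theorem minSum_lt_of_mem_orbit {α : EPart m} {β : Var m → ℕ} (hβ : β ∈ orbit α.1) (hne : β ≠ α.1) :
    minSum (symbol α) < minSum (delta m + β) := by
  have hsym : symbol α = delta m + α.1 := by
    funext v; simp [symbol, add_comm]
  rw [hsym]
  -- A minimiser over the finite orbit has no ascent, so it is row-sorted and must be α.
  have hmin : ∀ γ ∈ orbit α.1, minSum (delta m + α.1) ≤ minSum (delta m + γ) := by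
    obtain ⟨β₀, h0, hle⟩ := Finset.exists_min_image (orbit α.1) (fun γ => minSum (delta m + γ))
      ⟨_, self_mem_orbit _⟩
    have hanti : RowAntitone β₀ := by
      by_contra hcon
      obtain ⟨w, hw⟩ := exists_minSum_lt hcon
      exact absurd (hle _ (actSeq_mem_orbit w h0)) (not_le.2 hw)
    have : β₀ = α.1 := congrArg Subtype.val (eq_of_mem_orbit (α := α) (β := ⟨β₀, hanti⟩) h0)
    rwa [this] at hle
  have hanti : ¬ RowAntitone β := fun h =>
    hne (congrArg Subtype.val (eq_of_mem_orbit (α := α) (β := ⟨β, h⟩) hβ))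
  obtain ⟨w, hw⟩ := exists_minSum_lt hanti
  exact (hmin _ (actSeq_mem_orbit w hβ)).trans_lt hw

/-! ### Families -/

section Families

variable {n : ℕ}

theorem Similar.refl (α : Zn m n) : Similar α α := rfl

theorem Similar.symm {α β : Zn m n} (h : Similar α β) : Similar β α := Eq.symm h

theorem Similar.trans {α β γ : Zn m n} (h : Similar α β) (h' : Similar β γ) : Similar α γ :=
  Eq.trans h h'

theorem Similar.aFun_eq {α β : Zn m n} (h : Similar α β) : aFun α = aFun β := by
  unfold aFun
  rw [minSum_congr h]

/-- `β` lies in a family strictly below the family of `α`. -/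
def Low (prec : Zn m n → Zn m n → Prop) (β α : Zn m n) : Prop := prec β α ∧ ¬ Similar β α

variable {prec : Zn m n → Zn m n → Prop}

theorem IsAdmissible.irrefl (h : IsAdmissible prec) (α : Zn m n) : ¬ prec α α :=
  h.total.toIsStrictOrder.toIrrefl.irrefl α

theorem IsAdmissible.trans (h : IsAdmissible prec) {α β γ : Zn m n} (h1 : prec α β)
    (h2 : prec β γ) : prec α γ :=
  h.total.toIsStrictOrder.toIsTrans.trans _ _ _ h1 h2

theorem IsAdmissible.trichotomy (h : IsAdmissible prec) (α β : Zn m n) :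
    prec α β ∨ α = β ∨ prec β α := by
  have := h.total.toTrichotomous.trichotomous α β
  tauto

theorem IsAdmissible.low_of_aFun_lt (h : IsAdmissible prec) {α β : Zn m n}
    (hlt : aFun α < aFun β) : Low prec β α := by
  refine ⟨?_, fun hs => hlt.ne' hs.aFun_eq⟩
  rcases h.trichotomy β α with h1 | rfl | h1
  · exact h1
  · exact absurd hlt (lt_irrefl _)
  · exact absurd (h.aFun_le _ _ h1) (not_le.2 hlt)

theorem IsAdmissible.low_trans (h : IsAdmissible prec) {α β γ : Zn m n} (h1 : Low prec α β)
    (h2 : Low prec β γ) : Low prec α γ := by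
  refine ⟨h.trans h1.1 h2.1, fun hs => h1.2 ?_⟩
  exact h.interval _ _ _ hs h1.1 h2.1

/-- With transitivity, which rests on the interval condition, this makes `Low` a total order on the
set of families. -/
theorem IsAdmissible.low_or_similar_or_low (h : IsAdmissible prec) (α β : Zn m n) :
    Low prec α β ∨ Similar α β ∨ Low prec β α := by
  by_cases hs : Similar α β
  · exact Or.inr (Or.inl hs)
  · rcases h.trichotomy α β with h1 | rfl | h1
    · exact Or.inl ⟨h1, hs⟩
    · exact absurd (Similar.refl _) hs
    · exact Or.inr (Or.inr ⟨h1, fun h' => hs h'.symm⟩)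

theorem IsAdmissible.low_congr_left (h : IsAdmissible prec) {α β γ : Zn m n} (hs : Similar α β)
    (hl : Low prec β γ) : Low prec α γ := by
  have hns : ¬ Similar α γ := fun h' => hl.2 (hs.symm.trans h')
  rcases h.low_or_similar_or_low α γ with h1 | h1 | h1
  · exact h1
  · exact absurd h1 hns
  · exact absurd hs.symm (h.low_trans hl h1).2

theorem IsAdmissible.low_congr_right (h : IsAdmissible prec) {α β γ : Zn m n} (hs : Similar β γ)
    (hl : Low prec α β) : Low prec α γ := by
  have hns : ¬ Similar α γ := fun h' => hl.2 (h'.trans hs.symm)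
  rcases h.low_or_similar_or_low α γ with h1 | h1 | h1
  · exact h1
  · exact absurd h1 hns
  · exact absurd hs.symm (h.low_trans h1 hl).2

theorem IsAdmissible.wf_low (h : IsAdmissible prec) : WellFounded (Low prec) := by
  have : IsTrans (Zn m n) (Low prec) := ⟨fun _ _ _ => h.low_trans⟩
  have : Std.Irrefl (Low prec) := ⟨fun a ha => h.irrefl a ha.1⟩
  exact Finite.wellFounded_of_trans_of_irrefl _

/-- Straightening preserves entries, so the symbol of β has the same sum of minima as δ + γ,
strictly larger than that of α. The sequence κ is any rearrangement of δ + γ, so that moves between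
rows are covered too. -/
theorem IsAdmissible.low_of_altCoeff_ne_zero (h : IsAdmissible prec) {α β : Zn m n}
    {γ : Var m → ℕ} (hγ : γ ∈ orbit α.1.1) (hne : γ ≠ α.1.1) {κ : Var m → ℕ}
    (hκ : (univ : Finset (Var m)).val.map κ = (univ : Finset (Var m)).val.map (delta m + γ))
    (hc : altCoeff κ (symbol β.1) ≠ 0) : Low prec β α := by
  obtain ⟨w, hw⟩ := exists_of_altCoeff_ne_zero hc
  apply h.low_of_aFun_lt
  have h1 := minSum_lt_of_mem_orbit hγ hne
  have h2 : minSum (symbol β.1) = minSum (delta m + γ) := by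
    rw [← hw]
    exact minSum_congr ((map_actSeq _ _).trans hκ)
  unfold aFun
  omega

theorem similar_of_altCoeff_ne_zero {α β : Zn m n} {κ : Var m → ℕ}
    (hκ : (univ : Finset (Var m)).val.map κ = (univ : Finset (Var m)).val.map (delta m + α.1.1))
    (hc : altCoeff κ (symbol β.1) ≠ 0) : Similar β α := by
  obtain ⟨w, hw⟩ := exists_of_altCoeff_ne_zero hc
  unfold Similar
  rw [← hw, map_actSeq, hκ]
  congr 1
  funext v
  simp [symbol, add_comm]

theorem monToSchur_eq (h : IsAdmissible prec) (α β : Zn m n) (hl : ¬ Low prec β α) :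
    monToSchur α β = if α = β then 1 else 0 := by
  unfold monToSchur
  rw [Finset.sum_eq_single α.1.1]
  · have : delta m + α.1.1 = symbol α.1 := by
      funext v; simp [symbol, add_comm]
    rw [this, altCoeff_symbol]
    simp [Subtype.ext_iff]
  · intro γ hγ hne
    by_contra hcon
    exact hl (h.low_of_altCoeff_ne_zero hγ hne rfl hcon)
  · intro hn
    exact absurd (self_mem_orbit _) hn

end Families

end WMac

end

/-! ### Triangularity of the Macdonald operators -/

noncomputable section

namespace WMac

open Finset

set_option linter.unusedSectionVars false

variable {e : ℕ} [NeZero e] {m : ZMod e → ℕ}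

/-! ### The index sets and the substitutions -/

theorem shift_neg_shift (s : ℤˣ) (k : ZMod e) : shift (-s) (shift s k 1) 1 = k := by
  simp [shift]

/-- Any two elements of `J` differ in every entry. -/
def Disj (J : Finset (∀ k : ZMod e, Fin (m k))) : Prop :=
  ∀ i ∈ J, ∀ j ∈ J, i ≠ j → ∀ k, i k ≠ j k

theorem disj_of_mem {r : ℕ} {J : Finset (∀ k : ZMod e, Fin (m k))} (hJ : J ∈ IndexSets m r) :
    Disj J := (Finset.mem_filter.1 hJ).2.2

variable {J : Finset (∀ k : ZMod e, Fin (m k))}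

/-- The arbitrary choice in `move` is harmless: disjointness leaves exactly one vector of J through
an occupied position. -/
theorem move_of_mem (hJ : Disj J) (s : ℤˣ) {i : ∀ k, Fin (m k)} (hi : i ∈ J) (k : ZMod e) :
    move s J ⟨k, i k⟩ = ⟨shift s k 1, i (shift s k 1)⟩ := by
  have hocc : Occ J ⟨k, i k⟩ := ⟨i, hi, rfl⟩
  have : hocc.choose = i := by
    by_contra hne
    exact hJ _ hocc.choose_spec.1 i hi hne k hocc.choose_spec.2
  rw [move, dif_pos hocc, this]

theorem move_of_not_occ (s : ℤˣ) {v : Var m} (hv : ¬ Occ J v) : move s J v = v := by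
  rw [move, dif_neg hv]

theorem move_fst {v : Var m} (s : ℤˣ) (hv : Occ J v) : (move s J v).1 = shift s v.1 1 := by
  rw [move, dif_pos hv]

theorem occ_move (hJ : Disj J) (s : ℤˣ) (v : Var m) : Occ J (move s J v) ↔ Occ J v := by
  by_cases h : Occ J v
  · obtain ⟨i, hi, hv⟩ := id h
    obtain ⟨k, j⟩ := v
    obtain rfl : i k = j := hv
    rw [move_of_mem hJ s hi]
    exact ⟨fun _ => h, fun _ => ⟨i, hi, rfl⟩⟩
  · rw [move_of_not_occ s h]

theorem move_neg_move (hJ : Disj J) (s : ℤˣ) (v : Var m) : move (-s) J (move s J v) = v := by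
  by_cases h : Occ J v
  · obtain ⟨i, hi, hv⟩ := id h
    obtain ⟨k, j⟩ := v
    obtain rfl : i k = j := hv
    rw [move_of_mem hJ s hi, move_of_mem hJ (-s) hi, shift_neg_shift]
  · rw [move_of_not_occ s h, move_of_not_occ _ h]

/-- The permutation of the positions given by an element of `I_r`. -/
def moveEquiv (hJ : Disj J) (s : ℤˣ) : Equiv.Perm (Var m) where
  toFun := move s J
  invFun := move (-s) J
  left_inv := move_neg_move hJ s
  right_inv v := by simpa using move_neg_move hJ (-s) v

open Classical in
/-- The scalar attached to a position by the substitutions `T_{u,J}`. -/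
def occVal (u : F) (J : Finset (∀ k : ZMod e, Fin (m k))) (v : Var m) : F :=
  if Occ J v then u else 1

theorem occVal_move (hJ : Disj J) (u : F) (s : ℤˣ) (v : Var m) :
    occVal u J (move s J v) = occVal u J v := by
  unfold occVal
  simp only [occ_move hJ s v]

theorem opT_X (s : ℤˣ) (u : F) (J : Finset (∀ k : ZMod e, Fin (m k))) (v : Var m) :
    opT s u J (MvPolynomial.X v) =
      MvPolynomial.C (occVal u J v) * MvPolynomial.X (move s J v) := by
  rw [opT, MvPolynomial.aeval_X, occVal]
  split_ifs with h
  · rfl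
  · rw [move_of_not_occ s h, map_one, one_mul]

theorem xpow_eq_prod (β : Var m → ℕ) : xpow β = ∏ v, (MvPolynomial.X v : Poly m) ^ β v := by
  unfold xpow
  rw [MvPolynomial.monomial_eq, map_one, one_mul, Finsupp.prod_fintype]
  · rfl
  · intro v; exact pow_zero _

theorem prod_occVal_pow (u : F) (J : Finset (∀ k : ZMod e, Fin (m k))) (β : Var m → ℕ) :
    ∏ v, occVal u J v ^ β v = u ^ pairing β J := by
  classical
  unfold pairing
  rw [← Finset.prod_pow_eq_pow_sum, Finset.prod_filter]
  refine Finset.prod_congr rfl fun v _ => ?_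
  unfold occVal
  split_ifs <;> simp

theorem opT_xpow (hJ : Disj J) (s : ℤˣ) (u : F) (β : Var m → ℕ) :
    opT s u J (xpow β) = MvPolynomial.C (u ^ pairing β J) * xpow (seqMove s J β) := by
  rw [xpow_eq_prod, map_prod]
  simp only [map_pow, opT_X, mul_pow, Finset.prod_mul_distrib]
  congr 1
  · rw [← map_pow (MvPolynomial.C : F →+* Poly m) u, ← prod_occVal_pow, map_prod]
    simp only [map_pow]
  · rw [xpow_eq_prod]
    conv_rhs => rw [← Equiv.prod_comp (moveEquiv hJ s)]
    refine Finset.prod_congr rfl fun v _ => ?_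
    simp only [moveEquiv, Equiv.coe_fn_mk, seqMove, move_neg_move hJ s v]

theorem seqMove_add (s : ℤˣ) (J : Finset (∀ k : ZMod e, Fin (m k))) (β γ : Var m → ℕ) :
    seqMove s J (β + γ) = seqMove s J β + seqMove s J γ := rfl

theorem map_seqMove (hJ : Disj J) (s : ℤˣ) (β : Var m → ℕ) :
    (univ : Finset (Var m)).val.map (seqMove s J β) = (univ : Finset (Var m)).val.map β := by
  have := Multiset.map_univ_val_equiv (moveEquiv hJ (-s))
  conv_rhs => rw [← this]
  rw [Multiset.map_map]
  rfl

/-! ### The action of the row permutations on the index sets -/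

/-- The action of the row permutations on sets of vectors. -/
def actSet (w : RowPerm m) (J : Finset (∀ k : ZMod e, Fin (m k))) :
    Finset (∀ k : ZMod e, Fin (m k)) := J.map (Equiv.piCongrRight w).toEmbedding

theorem mem_actSet (w : RowPerm m) {i : ∀ k : ZMod e, Fin (m k)} :
    i ∈ actSet w J ↔ ∃ j ∈ J, (fun k => w k (j k)) = i := by
  simp only [actSet, Finset.mem_map, Equiv.coe_toEmbedding]
  rfl

theorem actSet_actSet (w w' : RowPerm m) (J : Finset (∀ k : ZMod e, Fin (m k))) :
    actSet w (actSet w' J) = actSet (w * w') J := by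
  ext i
  simp only [mem_actSet]
  constructor
  · rintro ⟨_, ⟨j, hj, rfl⟩, rfl⟩; exact ⟨j, hj, rfl⟩
  · rintro ⟨j, hj, rfl⟩; exact ⟨_, ⟨j, hj, rfl⟩, rfl⟩

theorem actSet_one (J : Finset (∀ k : ZMod e, Fin (m k))) : actSet 1 J = J := by
  ext i
  simp [mem_actSet]

theorem actSet_mem {r : ℕ} (w : RowPerm m) (hJ : J ∈ IndexSets m r) :
    actSet w J ∈ IndexSets m r := by
  rw [IndexSets, Finset.mem_filter] at hJ ⊢
  refine ⟨mem_univ _, by rw [actSet, Finset.card_map]; exact hJ.2.1, ?_⟩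
  intro i hi j hj hne k
  obtain ⟨i', hi', rfl⟩ := (mem_actSet w).1 hi
  obtain ⟨j', hj', rfl⟩ := (mem_actSet w).1 hj
  intro h
  refine hJ.2.2 i' hi' j' hj' ?_ k ((w k).injective h)
  rintro rfl
  exact hne rfl

theorem sum_actSet {A : Type*} [AddCommMonoid A] (r : ℕ) (w : RowPerm m)
    (f : Finset (∀ k : ZMod e, Fin (m k)) → A) :
    ∑ J ∈ IndexSets m r, f (actSet w J) = ∑ J ∈ IndexSets m r, f J := by
  refine Finset.sum_bij (fun J _ => actSet w J) (fun J hJ => actSet_mem w hJ) ?_ ?_ ?_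
  · intro J _ J' _ h
    have := congrArg (actSet w⁻¹) h
    simpa only [actSet_actSet, inv_mul_cancel, actSet_one] using this
  · intro J hJ
    exact ⟨actSet w⁻¹ J, actSet_mem _ hJ, by rw [actSet_actSet, mul_inv_cancel, actSet_one]⟩
  · intros; rfl

theorem occ_actSet (w : RowPerm m) (v : Var m) : Occ (actSet w J) (toPerm w v) ↔ Occ J v := by
  constructor
  · rintro ⟨i, hi, h⟩
    obtain ⟨j, hj, rfl⟩ := (mem_actSet w).1 hi
    exact ⟨j, hj, (w v.1).injective h⟩
  · rintro ⟨i, hi, h⟩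
    exact ⟨_, (mem_actSet w).2 ⟨i, hi, rfl⟩, congrArg (w v.1) h⟩

theorem disj_actSet (w : RowPerm m) (hJ : Disj J) : Disj (actSet w J) := by
  intro i hi j hj hne k
  obtain ⟨i', hi', rfl⟩ := (mem_actSet w).1 hi
  obtain ⟨j', hj', rfl⟩ := (mem_actSet w).1 hj
  intro h
  refine hJ i' hi' j' hj' ?_ k ((w k).injective h)
  rintro rfl
  exact hne rfl

theorem move_actSet (hJ : Disj J) (s : ℤˣ) (w : RowPerm m) (v : Var m) :
    move s (actSet w J) (toPerm w v) = toPerm w (move s J v) := by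
  by_cases h : Occ J v
  · obtain ⟨i, hi, hv⟩ := id h
    obtain ⟨k, j⟩ := v
    obtain rfl : i k = j := hv
    rw [move_of_mem hJ s hi]
    exact move_of_mem (disj_actSet w hJ) s ((mem_actSet w).2 ⟨i, hi, rfl⟩) k
  · rw [move_of_not_occ s h, move_of_not_occ s (by rwa [occ_actSet])]

theorem occVal_actSet (u : F) (w : RowPerm m) (v : Var m) :
    occVal u (actSet w J) (toPerm w v) = occVal u J v := by
  unfold occVal
  simp only [occ_actSet]

theorem actSeq_toPerm (w : RowPerm m) (β : Var m → ℕ) (v : Var m) :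
    actSeq w β (toPerm w v) = β v := by
  simp [actSeq]

theorem pairing_actSet (w : RowPerm m) (β : Var m → ℕ) :
    pairing (actSeq w β) (actSet w J) = pairing β J := by
  classical
  unfold pairing
  rw [Finset.sum_filter, Finset.sum_filter, ← Equiv.sum_comp (toPerm w)]
  simp only [occ_actSet, actSeq_toPerm]

theorem seqMove_actSet (hJ : Disj J) (s : ℤˣ) (w : RowPerm m) (β : Var m → ℕ) :
    seqMove s (actSet w J) (actSeq w β) = actSeq w (seqMove s J β) := by
  funext v
  obtain ⟨v, rfl⟩ := (toPerm w).surjective v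
  rw [actSeq_toPerm, seqMove, move_actSet hJ, actSeq_toPerm]
  rfl

/-! ### The numerators of the Macdonald operators -/

/-- The product of `a_δ` and the Macdonald operator `D^r_±`. -/
def opE (s : ℤˣ) (r : ℕ) (f : Poly m) : Poly m :=
  ∑ J ∈ IndexSets m r, opT s t J (alternant (delta m)) * opT s q J f

theorem opD_eq (s : ℤˣ) (r : ℕ) (f : Poly m) :
    opD s r f = (algebraMap (Poly m) (RatFn m) (alternant (delta m)))⁻¹ *
      algebraMap (Poly m) (RatFn m) (opE s r f) := by
  unfold opD
  congr 1
  have : opE s r f = ∑ w : RowPerm m, ((sgn w : ℤˣ) : ℤ) • ∑ J ∈ IndexSets m r,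
        (xpow (seqMove s J (actSeq w (delta m))) *
          MvPolynomial.C (t ^ pairing (actSeq w (delta m)) J) * opT s q J f) := by
    simp only [Finset.smul_sum]
    rw [Finset.sum_comm, opE]
    refine Finset.sum_congr rfl fun J hJ => ?_
    rw [alternant_eq_sum, map_sum, Finset.sum_mul]
    refine Finset.sum_congr rfl fun w _ => ?_
    rw [map_zsmul, opT_xpow (disj_of_mem hJ), smul_mul_assoc, mul_comm (xpow _)]
  rw [this]
  simp only [map_sum, map_zsmul]

theorem opE_sum {ι : Type*} (S : Finset ι) (s : ℤˣ) (r : ℕ) (c : ι → F) (f : ι → Poly m) :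
    opE s r (∑ i ∈ S, c i • f i) = ∑ i ∈ S, c i • opE s r (f i) := by
  simp only [opE, map_sum, map_smul, Finset.mul_sum, Finset.smul_sum, mul_smul_comm]
  rw [Finset.sum_comm]

/-- Replacing J by wJ and β by wβ frees the powers of t and q from w and turns the exponent into w
applied to (δ+β)_J; the sum over w is then an alternant. -/
theorem opE_monSym (s : ℤˣ) (r : ℕ) (α : EPart m) :
    opE s r (monSym α : Poly m) = ∑ β ∈ orbit α.1, ∑ J ∈ IndexSets m r,
      (t ^ pairing (delta m) J * q ^ pairing β J) •
        alternant (seqMove s J (delta m + β)) := by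
  have h1 : opE s r (monSym α : Poly m) = ∑ w : RowPerm m, ∑ J ∈ IndexSets m r,
      ∑ β ∈ orbit α.1, ((sgn w : ℤˣ) : ℤ) •
        (t ^ pairing (actSeq w (delta m)) J * q ^ pairing β J) •
          xpow (seqMove s J (actSeq w (delta m) + β)) := by
    rw [opE, Finset.sum_comm]
    refine Finset.sum_congr rfl fun J hJ => ?_
    rw [alternant_eq_sum, map_sum, Finset.sum_mul]
    refine Finset.sum_congr rfl fun w _ => ?_
    rw [map_zsmul, opT_xpow (disj_of_mem hJ), coe_monSym, map_sum, Finset.mul_sum]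
    refine Finset.sum_congr rfl fun β _ => ?_
    rw [opT_xpow (disj_of_mem hJ), smul_mul_assoc, seqMove_add, xpow_add,
      MvPolynomial.smul_eq_C_mul, map_mul]
    congr 1
    ring
  rw [h1]
  have h2 : ∀ w : RowPerm m, ∑ J ∈ IndexSets m r,
      ∑ β ∈ orbit α.1, ((sgn w : ℤˣ) : ℤ) •
        (t ^ pairing (actSeq w (delta m)) J * q ^ pairing β J) •
          xpow (seqMove s J (actSeq w (delta m) + β)) =
      ∑ J ∈ IndexSets m r, ∑ β ∈ orbit α.1, ((sgn w : ℤˣ) : ℤ) •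
        (t ^ pairing (delta m) J * q ^ pairing β J) •
          xpow (actSeq w (seqMove s J (delta m + β))) := by
    intro w
    rw [← sum_actSet r w]
    refine Finset.sum_congr rfl fun J hJ => ?_
    symm
    refine Finset.sum_bij (fun β _ => actSeq w β) (fun β hβ => actSeq_mem_orbit w hβ)
      (fun _ _ _ _ h => actSeq_injective w h)
      (fun β hβ => ⟨actSeq w⁻¹ β, actSeq_mem_orbit _ hβ, actSeq_actSeq_inv w β⟩) ?_
    intro β _
    rw [← actSeq_add, pairing_actSet, pairing_actSet, seqMove_actSet (disj_of_mem hJ)]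
  simp only [h2]
  rw [Finset.sum_comm]
  conv_rhs => rw [Finset.sum_comm]
  refine Finset.sum_congr rfl fun J _ => ?_
  rw [Finset.sum_comm]
  refine Finset.sum_congr rfl fun β _ => ?_
  rw [alternant_eq_sum, Finset.smul_sum]
  refine Finset.sum_congr rfl fun w _ => ?_
  rw [smul_comm]

theorem pairing_delta_add_sum (hJ : Disj J) (s : ℤˣ) {n : ℕ} {α : Zn m n} {β : Var m → ℕ}
    (hβ : β ∈ orbit α.1.1) :
    ∑ v, seqMove s J (delta m + β) v = n + ∑ v, delta m v := by
  have : ∑ v, seqMove s J (delta m + β) v = ∑ v, (delta m + β) v :=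
    Equiv.sum_comp (moveEquiv hJ (-s)) (delta m + β)
  rw [this]
  simp only [Pi.add_apply, Finset.sum_add_distrib]
  rw [sum_of_mem_orbit hβ, α.2, add_comm]

/-- The matrix of `D^r_±` from the monomial basis to the Schur basis. -/
def opSchurMatrix (s : ℤˣ) (r : ℕ) {n : ℕ} (α β : Zn m n) : F :=
  ∑ γ ∈ orbit α.1.1, ∑ J ∈ IndexSets m r,
    (t ^ pairing (delta m) J * q ^ pairing γ J) *
      (altCoeff (seqMove s J (delta m + γ)) (symbol β.1) : F)

theorem opE_monSym_expand (s : ℤˣ) (r : ℕ) {n : ℕ} (α : Zn m n) :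
    opE s r (monSym α.1 : Poly m) =
      ∑ β : Zn m n, opSchurMatrix s r α β • alternant (symbol β.1) := by
  rw [opE_monSym]
  simp only [opSchurMatrix, Finset.sum_smul]
  conv_rhs => rw [Finset.sum_comm]
  refine Finset.sum_congr rfl fun γ hγ => ?_
  rw [Finset.sum_comm]
  refine Finset.sum_congr rfl fun J hJ => ?_
  rw [alternant_expand (pairing_delta_add_sum (disj_of_mem hJ) s hγ), Finset.smul_sum]
  refine Finset.sum_congr rfl fun β _ => ?_
  rw [smul_smul]

/-- Since a move along J preserves the multiset of entries of δ + γ, the term γ = α only reaches the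
family of α, and the other γ only reach lower families. -/
theorem opSchurMatrix_eq_zero (s : ℤˣ) (r : ℕ) {n : ℕ} {prec : Zn m n → Zn m n → Prop}
    (h : IsAdmissible prec) (α β : Zn m n) (h1 : ¬ Low prec β α) (h2 : ¬ Similar β α) :
    opSchurMatrix s r α β = 0 := by
  unfold opSchurMatrix
  refine Finset.sum_eq_zero fun γ hγ => ?_
  refine Finset.sum_eq_zero fun J hJ => ?_
  have : altCoeff (seqMove s J (delta m + γ)) (symbol β.1) = 0 := by
    by_contra hcon
    have hm := map_seqMove (disj_of_mem hJ) s (delta m + γ)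
    by_cases hne : γ = α.1.1
    · subst hne
      exact h2 (similar_of_altCoeff_ne_zero hm hcon)
    · exact h1 (h.low_of_altCoeff_ne_zero hγ hne hm hcon)
  rw [this, Int.cast_zero, mul_zero]

end WMac

end

/-! ### Generating series of the functions g and their q-adic limits -/

noncomputable section

namespace WMac

open Finset Filter Topology

set_option linter.unusedSectionVars false

variable {e : ℕ} [NeZero e] {m : ZMod e → ℕ}

/-! ### Power series in one variable evaluated at multiples of the variable -/

section Ser

variable {R A A' : Type*} [CommRing R] [CommRing A] [CommRing A'] [Algebra R A] [Algebra R A']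

/-- The power series `∑ f(d) z^d Y^d`. -/
def ser (f : ℕ → R) (z : A) : PowerSeries A := PowerSeries.mk fun d => algebraMap R A (f d) * z ^ d

/-- The power series `1 - z Y`. -/
def lin (z : A) : PowerSeries A := 1 - PowerSeries.C z * PowerSeries.X

theorem map_ser (T : A →ₐ[R] A') (f : ℕ → R) (z : A) :
    PowerSeries.map (T : A →+* A') (ser f z) = ser f (T z) := by
  ext d
  simp [ser]

theorem map_lin (T : A →+* A') (z : A) : PowerSeries.map T (lin z) = lin (T z) := by
  simp [lin]

theorem ser_one_mul_lin (z : A) : ser (fun _ => (1 : R)) z * lin z = 1 := by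
  ext d
  rw [lin, mul_sub, mul_one, map_sub, mul_comm (PowerSeries.C z), ← mul_assoc]
  cases d with
  | zero => simp [ser]
  | succ d =>
    rw [PowerSeries.coeff_mul_C, PowerSeries.coeff_succ_mul_X]
    simp [ser, pow_succ, PowerSeries.coeff_one]

theorem coeff_ser (f : ℕ → R) (z : A) (d : ℕ) :
    PowerSeries.coeff d (ser f z) = algebraMap R A (f d) * z ^ d := by
  simp [ser]

theorem rescale_ser (f : ℕ → R) (u z : A) : PowerSeries.rescale u (ser f z) = ser f (u * z) := by
  ext d
  simp [ser, mul_pow]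
  ring

end Ser

section Sol

variable {R : Type*} [CommRing R] {R' : Type*} [CommRing R']

/-- The families of power series `c_a(Z)`, indexed by `ZMod e`, with constant terms `1` and
`(1 - Z)^{[a = 0]} c_a(Z) = (1 - t Z)^{[a = 1]} c_{a-1}(q Z)`. -/
structure IsSol (q t : R) (c : ZMod e → ℕ → R) : Prop where
  zero : ∀ a, c a 0 = 1
  succ : ∀ a d, c a (d + 1) - (if a = 0 then c a d else 0) =
    q ^ (d + 1) * c (a - 1) (d + 1) - (if a = 1 then t * q ^ d * c (a - 1) d else 0)

theorem IsSol.map {q t : R} {c : ZMod e → ℕ → R} (h : IsSol q t c) (φ : R →+* R') :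
    IsSol (φ q) (φ t) fun a d => φ (c a d) where
  zero a := by rw [h.zero, map_one]
  succ a d := by
    have := congrArg φ (h.succ a d)
    simpa only [map_sub, apply_ite φ, map_mul, map_pow, map_zero] using this

/-- In each degree the difference of two solutions picks up a factor q^(d+1) per row, hence
q^((d+1)e) after one full turn, and 1 − q^((d+1)e) is invertible. -/
theorem IsSol.unique {q t : R} (hq : ∀ d : ℕ, IsUnit (1 - q ^ ((d + 1) * e)))
    {c c' : ZMod e → ℕ → R} (h : IsSol q t c) (h' : IsSol q t c') : c = c' := by
  have key : ∀ d a, c a d = c' a d := by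
    intro d
    induction d with
    | zero => intro a; rw [h.zero, h'.zero]
    | succ d ih =>
      have h1 : ∀ a, c a (d + 1) - c' a (d + 1) =
          q ^ (d + 1) * (c (a - 1) (d + 1) - c' (a - 1) (d + 1)) := by
        intro a
        have e1 := h.succ a d
        have e2 := h'.succ a d
        rw [ih, ih] at e1
        linear_combination e1 - e2
      have h2 : ∀ (i : ℕ) a, c a (d + 1) - c' a (d + 1) =
          q ^ ((d + 1) * i) * (c (a - i) (d + 1) - c' (a - i) (d + 1)) := by
        intro i
        induction i with
        | zero => intro a; simp
        | succ i ihi =>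
          intro a
          rw [ihi a, h1 (a - i), show a - ((i + 1 : ℕ) : ZMod e) = a - i - 1 by push_cast; ring]
          ring
      intro a
      have h3 := h2 e a
      rw [ZMod.natCast_self, sub_zero] at h3
      have h4 : (1 - q ^ ((d + 1) * e)) * (c a (d + 1) - c' a (d + 1)) = 0 := by
        linear_combination h3
      exact sub_eq_zero.1 ((hq d).mul_right_eq_zero.1 h4)
  funext a d
  exact key d a

/-- Unrolling the recursion once around the cycle gives g_a = (1 − Q^e)⁻¹ ∑_{i<e} Q^i f_{a−i}. -/
theorem exists_cyclic_solution {Q : R} (hQ : IsUnit (1 - Q ^ e)) (f : ZMod e → R) :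
    ∃ g : ZMod e → R, ∀ a, g a = Q * g (a - 1) + f a := by
  obtain ⟨u, hu⟩ := hQ
  refine ⟨fun a => (↑u⁻¹ : R) * ∑ i ∈ range e, Q ^ i * f (a - i), fun a => ?_⟩
  have h1 : Q * ∑ i ∈ range e, Q ^ i * f (a - 1 - i) =
      ∑ i ∈ range e, Q ^ i * f (a - i) + Q ^ e * f a - f a := by
    have h2 := Finset.sum_range_succ (fun i : ℕ => Q ^ i * f (a - i)) e
    rw [Finset.sum_range_succ'] at h2
    simp only [Nat.cast_zero, sub_zero, pow_zero, one_mul, ZMod.natCast_self] at h2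
    rw [← h2, Finset.mul_sum, add_sub_cancel_right]
    refine Finset.sum_congr rfl fun i _ => ?_
    rw [pow_succ', mul_assoc]
    push_cast
    rw [sub_sub, add_comm (1 : ZMod e)]
  have h3 : (↑u⁻¹ : R) * (1 - Q ^ e) = 1 := by rw [← hu, Units.inv_mul]
  linear_combination (-(↑u⁻¹ : R)) * h1 + f a * h3

/-- Formally c_a(Z) is the product of 1/(1 − q^r Z) over r ≡ a and of 1 − t q^r Z over r + 1 ≡ a
modulo e. Solving the functional equation degree by degree needs no infinite product, so it also
works over a ring in which q and t can be specialised to 0. -/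
theorem exists_isSol {q : R} (t : R) (hq : ∀ d : ℕ, IsUnit (1 - q ^ ((d + 1) * e))) :
    ∃ c : ZMod e → ℕ → R, IsSol q t c := by
  choose S hS using fun (d : ℕ) (f : ZMod e → R) =>
    exists_cyclic_solution (Q := q ^ (d + 1)) (by rw [← pow_mul]; exact hq d) f
  let b : ℕ → ZMod e → R := fun d => Nat.rec (fun _ => 1)
    (fun d g => S d fun a =>
      (if a = 0 then g a else 0) - if a = 1 then t * q ^ d * g (a - 1) else 0) d
  refine ⟨fun a d => b d a, fun a => rfl, fun a d => ?_⟩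
  have h := hS d (fun a => (if a = 0 then b d a else 0) -
    if a = 1 then t * q ^ d * b d (a - 1) else 0) a
  have hb : b (d + 1) = S d (fun a => (if a = 0 then b d a else 0) -
    if a = 1 then t * q ^ d * b d (a - 1) else 0) := rfl
  rw [hb]
  linear_combination h

theorem isSol_zero : IsSol (0 : R) (0 : R)
    (fun (a : ZMod e) d => if a = 0 ∨ d = 0 then 1 else 0) where
  zero a := by simp
  succ a d := by
    by_cases h : a = 0 <;> simp [h]

theorem IsSol.ser_mul {q t : R} {c : ZMod e → ℕ → R} (h : IsSol q t c) {A : Type*} [CommRing A]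
    [Algebra R A] (a : ZMod e) (z : A) :
    ser (c a) z * (if a = 0 then lin z else 1) =
      ser (c (a - 1)) (algebraMap R A q * z) *
        (if a = 1 then lin (algebraMap R A t * z) else 1) := by
  have gen : ∀ (f : ℕ → R) (x y : A) (p : Prop) [Decidable p] (d : ℕ),
      PowerSeries.coeff (d + 1) (ser f x * (if p then lin y else 1)) =
      algebraMap R A (f (d + 1)) * x ^ (d + 1)
        - if p then algebraMap R A (f d) * x ^ d * y else 0 := by
    intro f x y p _ d
    split_ifs
    · rw [lin, mul_sub, mul_one, map_sub, mul_comm (PowerSeries.C y), ← mul_assoc,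
        PowerSeries.coeff_mul_C, PowerSeries.coeff_succ_mul_X, coeff_ser, coeff_ser]
    · rw [mul_one, coeff_ser, sub_zero]
  have gen0 : ∀ (f : ℕ → R) (x y : A) (p : Prop) [Decidable p],
      PowerSeries.coeff 0 (ser f x * (if p then lin y else 1)) = algebraMap R A (f 0) := by
    intro f x y p _
    rw [PowerSeries.coeff_zero_eq_constantCoeff_apply, map_mul]
    split_ifs <;> simp [lin, ser]
  ext d
  cases d with
  | zero => rw [gen0, gen0, h.zero, h.zero]
  | succ d =>
    rw [gen, gen]
    have := congrArg (fun r => algebraMap R A r * z ^ (d + 1)) (h.succ a d)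
    simp only [map_sub, sub_mul, apply_ite (algebraMap R A), ite_mul, map_mul, map_pow, map_zero,
      zero_mul] at this
    simp only [mul_pow]
    rw [show (if a = 0 then algebraMap R A (c a d) * z ^ d * z else 0) =
      (if a = 0 then algebraMap R A (c a d) * z ^ (d + 1) else 0) by
        split_ifs <;> ring, this]
    split_ifs <;> ring

end Sol

/-! ### The generating functions of the functions `g` -/

section GSer

variable {R : Type*} [CommRing R] {R' : Type*} [CommRing R']

/-- The cyclic distance from the row `k'` to the row `k`, in the direction given by `s`. -/
def rowDist (s : ℤˣ) (k k' : ZMod e) : ZMod e := ((s : ℤ) : ZMod e) * (k - k')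

theorem units_cast_mul_self (s : ℤˣ) : ((s : ℤ) : ZMod e) * ((s : ℤ) : ZMod e) = 1 := by
  rw [← Int.cast_mul, ← Units.val_mul, Int.units_mul_self, Units.val_one, Int.cast_one]

theorem rowDist_shift (s : ℤˣ) (k k' : ZMod e) :
    rowDist s (shift s k 1) k' = rowDist s k k' - 1 := by
  have := units_cast_mul_self (e := e) s
  unfold rowDist shift
  push_cast
  linear_combination (-1 : ZMod e) * this

theorem rowDist_shift_right (s : ℤˣ) (k k' : ZMod e) :
    rowDist s k (shift s k' 1) = rowDist s k k' + 1 := by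
  have := units_cast_mul_self (e := e) s
  unfold rowDist shift
  push_cast
  linear_combination (1 : ZMod e) * this

theorem rowDist_eq_iff (s : ℤˣ) (k k' : ZMod e) (a : ℕ) :
    rowDist s k k' = a ↔ k' = shift s k a := by
  have h := units_cast_mul_self (e := e) s
  unfold rowDist shift
  constructor
  · intro h1
    linear_combination (-((s : ℤ) : ZMod e)) * h1 + (k - k') * h
  · rintro rfl
    linear_combination (a : ZMod e) * h

theorem rowDist_neg_comm (s : ℤˣ) (k k' : ZMod e) : rowDist (-s) k k' = rowDist s k' k := by
  unfold rowDist
  push_cast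
  ring

theorem shift_zero (s : ℤˣ) (k : ZMod e) : shift s k 0 = k := by simp [shift]

theorem shift_shift_one (s : ℤˣ) (k : ZMod e) (a : ℕ) :
    shift s (shift s k a) 1 = shift s k (a + 1) := by
  unfold shift
  push_cast
  ring

theorem prod_ite_rowDist {A : Type*} [CommMonoid A] (s : ℤˣ) (k : ZMod e) (a : ℕ) (h : Var m → A) :
    (∏ v : Var m, if rowDist s k v.1 = a then h v else 1) =
      ∏ i : Fin (m (shift s k a)), h ⟨shift s k a, i⟩ := by
  rw [Fintype.prod_sigma, Fintype.prod_eq_single (shift s k a)]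
  · exact Finset.prod_congr rfl fun i _ => if_pos ((rowDist_eq_iff s k _ a).2 rfl)
  · intro k' hk'
    exact Finset.prod_eq_one fun i _ => if_neg fun h' => hk' ((rowDist_eq_iff s k _ a).1 h')

/-- The generating function `∑ g_{d,±}^{(k)} Y^d` attached to a family of power series. -/
def gSer (m : ZMod e → ℕ) (c : ZMod e → ℕ → R) (s : ℤˣ) (k : ZMod e) :
    PowerSeries (MvPolynomial (Var m) R) :=
  ∏ v : Var m, ser (c (rowDist s k v.1)) (MvPolynomial.X v : MvPolynomial (Var m) R)

theorem map_gSer (φ : R →+* R') (c : ZMod e → ℕ → R) (s : ℤˣ) (k : ZMod e) :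
    PowerSeries.map (MvPolynomial.map φ) (gSer m c s k) = gSer m (fun a d => φ (c a d)) s k := by
  unfold gSer
  rw [map_prod]
  refine Finset.prod_congr rfl fun v _ => ?_
  ext d
  simp [ser]

theorem rename_gSer (c : ZMod e → ℕ → R) (s : ℤˣ) (k : ZMod e) (w : RowPerm m) :
    PowerSeries.map ((MvPolynomial.rename (toPerm w) :
      MvPolynomial (Var m) R →ₐ[R] MvPolynomial (Var m) R) : _ →+* _) (gSer m c s k) =
        gSer m c s k := by
  unfold gSer
  rw [map_prod]
  conv_rhs => rw [← Equiv.prod_comp (toPerm w)]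
  refine Finset.prod_congr rfl fun v _ => ?_
  rw [map_ser, MvPolynomial.rename_X]
  rfl

theorem constantCoeff_gSer {q t : R} {c : ZMod e → ℕ → R} (hc : IsSol q t c) (s : ℤˣ)
    (k : ZMod e) : PowerSeries.coeff 0 (gSer m c s k) = 1 := by
  rw [PowerSeries.coeff_zero_eq_constantCoeff_apply, gSer, map_prod]
  refine Finset.prod_eq_one fun v _ => ?_
  rw [← PowerSeries.coeff_zero_eq_constantCoeff_apply, coeff_ser, hc.zero]
  simp

/-- The functional equations are multiplied over all variables: distance 0 selects the denominators
of row k, distance 1 the numerators of the next row. -/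
theorem gSer_step {q t : R} {c : ZMod e → ℕ → R} (hc : IsSol q t c) (s : ℤˣ) (k : ZMod e) (u : R) :
    PowerSeries.rescale (MvPolynomial.C u) (gSer m c s k) *
        ∏ i : Fin (m k), lin (MvPolynomial.C u * MvPolynomial.X ⟨k, i⟩ : MvPolynomial (Var m) R) =
      PowerSeries.rescale (MvPolynomial.C (q * u)) (gSer m c s (shift s k 1)) *
        ∏ i : Fin (m (shift s k 1)),
          lin (MvPolynomial.C (t * u) * MvPolynomial.X ⟨shift s k 1, i⟩ :
            MvPolynomial (Var m) R) := by
  have h0 := prod_ite_rowDist s k 0 fun v : Var m =>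
    lin (MvPolynomial.C u * MvPolynomial.X v : MvPolynomial (Var m) R)
  have h1 := prod_ite_rowDist s k 1 fun v : Var m =>
    lin (MvPolynomial.C (t * u) * MvPolynomial.X v : MvPolynomial (Var m) R)
  rw [shift_zero] at h0
  rw [← h0, ← h1, gSer, gSer, map_prod, map_prod, ← Finset.prod_mul_distrib,
    ← Finset.prod_mul_distrib]
  refine Finset.prod_congr rfl fun v _ => ?_
  rw [rescale_ser, rescale_ser, rowDist_shift]
  have := hc.ser_mul (rowDist s k v.1)
    (MvPolynomial.C u * MvPolynomial.X v : MvPolynomial (Var m) R)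
  rw [Nat.cast_zero, Nat.cast_one, this]
  simp only [MvPolynomial.algebraMap_eq, map_mul, mul_assoc]

end GSer

/-! ### The `q`-adic limit -/

theorem tendsto_q_pow : Tendsto (fun N : ℕ => q ^ N) atTop (𝓝 0) := by
  apply Valued.tendsto_zero_pow_of_v_lt_one
  rw [q, RatFunc.v_def]
  have := (Polynomial.valuation_X_eq_neg_one (RatFunc ℂ))
  rw [this]
  rw [← WithZero.exp_zero, WithZero.exp_lt_exp]
  norm_num

theorem mul_telescope {A : Type*} [CommRing A] {g P G L L' B M : A} (h1 : g = P * G)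
    (h2 : G * L = B * M) (h3 : L * L' = 1) : g = P * (M * L') * B := by
  linear_combination h1 - P * G * h3 + P * L' * h2

/-- Iterating the step peels off the first N factors of the infinite product and leaves the series
of the N-th row with Y replaced by q^N Y. -/
theorem gSer_eq_gPartial_mul {c : ZMod e → ℕ → F} (hc : IsSol q t c) (s : ℤˣ) (k : ZMod e)
    (N : ℕ) :
    gSer m c s k = gPartial s k N *
      PowerSeries.rescale (MvPolynomial.C (q ^ N)) (gSer m c s (shift s k N)) := by
  induction N with
  | zero => simp [gPartial, shift_zero]
  | succ N ih =>
    have hstep := gSer_step (m := m) hc s (shift s k N) (q ^ N)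
    rw [shift_shift_one, ← pow_succ'] at hstep
    have hinv : (∏ i : Fin (m (shift s k N)), lin (MvPolynomial.C (q ^ N) *
          MvPolynomial.X ⟨shift s k N, i⟩ : Poly m)) *
        ∏ i : Fin (m (shift s k N)), PowerSeries.invOfUnit (lin (MvPolynomial.C (q ^ N) *
          MvPolynomial.X ⟨shift s k N, i⟩ : Poly m)) 1 = 1 := by
      rw [← Finset.prod_mul_distrib]
      refine Finset.prod_eq_one fun i _ => PowerSeries.mul_invOfUnit _ _ ?_
      simp [lin]
    have hp : gPartial (m := m) s k (N + 1) = gPartial s k N *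
      ((∏ i : Fin (m (shift s k (N + 1))), lin (MvPolynomial.C (t * q ^ N) *
          MvPolynomial.X ⟨shift s k (N + 1), i⟩ : Poly m)) *
        ∏ i : Fin (m (shift s k N)), PowerSeries.invOfUnit (lin (MvPolynomial.C (q ^ N) *
          MvPolynomial.X ⟨shift s k N, i⟩ : Poly m)) 1) :=
      Finset.prod_range_succ _ _
    rw [hp]
    exact mul_telescope ih hstep hinv

/-- In the peeled-off identity the remainder has constant term 1 and its higher coefficients carry
powers of q^N, so induction on d gives the limit. -/
theorem tendsto_coeff_gPartial {c : ZMod e → ℕ → F} (hc : IsSol q t c) (s : ℤˣ) (k : ZMod e)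
    (d : ℕ) (μ : Var m →₀ ℕ) :
    Tendsto (fun N => MvPolynomial.coeff μ (PowerSeries.coeff d (gPartial (m := m) s k N)))
      atTop (𝓝 (MvPolynomial.coeff μ (PowerSeries.coeff d (gSer m c s k)))) := by
  induction d using Nat.strong_induction_on generalizing μ with
  | _ d ih =>
    have hrec : ∀ N, PowerSeries.coeff d (gPartial (m := m) s k N) =
        PowerSeries.coeff d (gSer m c s k) - ∑ i ∈ range d,
          PowerSeries.coeff i (gPartial (m := m) s k N) *
            (MvPolynomial.C (q ^ N) ^ (d - i) *
              PowerSeries.coeff (d - i) (gSer m c s (shift s k N))) := by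
      intro N
      conv_rhs => rw [gSer_eq_gPartial_mul hc s k N]
      rw [PowerSeries.coeff_mul, Finset.Nat.sum_antidiagonal_eq_sum_range_succ
        (fun i j => PowerSeries.coeff i (gPartial (m := m) s k N) * PowerSeries.coeff j
          (PowerSeries.rescale (MvPolynomial.C (q ^ N)) (gSer m c s (shift s k N)))),
        Finset.sum_range_succ, Nat.sub_self]
      simp only [PowerSeries.coeff_rescale]
      rw [constantCoeff_gSer hc]
      ring
    have hlim0 : ∀ i ∈ range d, ∀ ν : Var m →₀ ℕ, Tendsto (fun N => MvPolynomial.coeff ν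
        ((MvPolynomial.C (q ^ N) : Poly m) ^ (d - i) *
              PowerSeries.coeff (d - i) (gSer m c s (shift s k N)))) atTop (𝓝 0) := by
      intro i hi ν
      rw [Finset.mem_range] at hi
      have h1 : ∀ k', Tendsto (fun N => (q ^ N) ^ (d - i) *
          MvPolynomial.coeff ν (PowerSeries.coeff (d - i) (gSer m c s k'))) atTop (𝓝 0) := by
        intro k'
        have := (tendsto_q_pow.pow (d - i)).mul_const
          (MvPolynomial.coeff ν (PowerSeries.coeff (d - i) (gSer m c s k')))
        rwa [zero_pow (by omega), zero_mul] at this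
      intro U hU
      rw [Filter.mem_map]
      have h2 : ∀ᶠ N in atTop, ∀ k', (q ^ N) ^ (d - i) *
          MvPolynomial.coeff ν (PowerSeries.coeff (d - i) (gSer m c s k')) ∈ U :=
        -- The row of the remainder varies with N, but there are finitely many rows, so the
        -- convergence is uniform in the row.
        Filter.eventually_all.2 fun k' => h1 k' hU
      filter_upwards [h2] with N hN
      rw [Set.mem_preimage, ← map_pow, MvPolynomial.coeff_C_mul]
      exact hN _
    simp only [hrec, MvPolynomial.coeff_sub, MvPolynomial.coeff_sum]
    have : Tendsto (fun N => ∑ i ∈ range d, MvPolynomial.coeff μ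
        (PowerSeries.coeff i (gPartial (m := m) s k N) *
            (MvPolynomial.C (q ^ N) ^ (d - i) *
              PowerSeries.coeff (d - i) (gSer m c s (shift s k N))))) atTop
        (𝓝 (∑ i ∈ range d, 0)) := by
      refine tendsto_finsetSum _ fun i hi => ?_
      refine Tendsto.congr (fun N => (MvPolynomial.coeff_mul _ _ _).symm) ?_
      have h3 : Tendsto (fun N => ∑ x ∈ antidiagonal μ,
        MvPolynomial.coeff x.1 (PowerSeries.coeff i (gPartial (m := m) s k N)) *
          MvPolynomial.coeff x.2 ((MvPolynomial.C (q ^ N) : Poly m) ^ (d - i) *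
              PowerSeries.coeff (d - i) (gSer m c s (shift s k N)))) atTop
          (𝓝 (∑ x ∈ antidiagonal μ,
            MvPolynomial.coeff x.1 (PowerSeries.coeff i (gSer m c s k)) * 0)) :=
        tendsto_finsetSum _ fun x _ =>
          (ih i (Finset.mem_range.1 hi) x.1).mul (hlim0 i hi x.2)
      simpa only [mul_zero, Finset.sum_const_zero] using h3
    have h4 := (tendsto_const_nhds (x := MvPolynomial.coeff μ
      (PowerSeries.coeff d (gSer m c s k)))).sub this
    rwa [Finset.sum_const_zero, sub_zero] at h4

theorem coeff_gSer_mem_Xi (c : ZMod e → ℕ → F) (s : ℤˣ) (k : ZMod e) (d : ℕ) :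
    PowerSeries.coeff d (gSer m c s k) ∈ Xi m := by
  intro w
  have := congrArg (PowerSeries.coeff d) (rename_gSer (m := m) c s k w)
  rwa [PowerSeries.coeff_map] at this

/-- The ε-choice is determined: a symmetric limit exists, and q-adic limits of coefficients are
unique. -/
theorem coe_gOne {c : ZMod e → ℕ → F} (hc : IsSol q t c) (s : ℤˣ) (k : ZMod e) (d : ℕ) :
    ((gOne s k d : Xi m) : Poly m) = PowerSeries.coeff d (gSer m c s k) := by
  have hex : ∃ g : Xi m, IsGCoeff s k d g :=
    ⟨⟨_, coeff_gSer_mem_Xi c s k d⟩, fun μ => tendsto_coeff_gPartial hc s k d μ⟩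
  have hspec : IsGCoeff s k d (gOne (m := m) s k d) := Classical.epsilon_spec hex
  ext μ
  exact tendsto_nhds_unique (hspec μ) (tendsto_coeff_gPartial hc s k d μ)

end WMac

end

/-! ### Cauchy determinants and polynomials in two sets of variables -/

noncomputable section

namespace WMac

open Finset

set_option linter.unusedSectionVars false

variable {e : ℕ} [NeZero e] {m : ZMod e → ℕ}

/-! ### Cauchy determinants -/

section Cauchy

variable {S : Type*} [CommRing S]

theorem exists_prod_sub_eq {ι : Type*} [DecidableEq ι] (s : Finset ι) (y : ι → S) :
    ∃ C : ℕ → S, ∀ v w : S, ∏ l ∈ s, (w - v * y l) =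
      ∑ k ∈ range (s.card + 1), v ^ k * w ^ (s.card - k) * C k := by
  refine ⟨fun k => ∑ τ ∈ powersetCard k s, ∏ l ∈ τ, (- y l), fun v w => ?_⟩
  have : ∏ l ∈ s, (w - v * y l) = ∏ l ∈ s, (v * (- y l) + w) :=
    Finset.prod_congr rfl fun l _ => by ring
  rw [this, Finset.prod_add, Finset.sum_powerset]
  refine Finset.sum_congr rfl fun k _ => ?_
  rw [Finset.mul_sum]
  refine Finset.sum_congr rfl fun τ hτ => ?_
  rw [Finset.mem_powersetCard] at hτ
  rw [Finset.prod_mul_distrib, Finset.prod_const, Finset.prod_const, hτ.2,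
    Finset.card_sdiff_of_subset hτ.1, hτ.2]
  ring

/-- Each entry is homogeneous of degree n − 1 in (v_i, w_i), with coefficients depending only on y
and j. The factor C therefore serves all v and w. -/
theorem exists_projVandermonde_mul (n : ℕ) (y : Fin n → S) :
    ∃ C : Matrix (Fin n) (Fin n) S, ∀ v w : Fin n → S,
      Matrix.projVandermonde v w * C =
        Matrix.of fun i j => ∏ l ∈ univ.erase j, (w i - v i * y l) := by
  choose C hC using fun j : Fin n => exists_prod_sub_eq (univ.erase j) y
  refine ⟨Matrix.of fun k j => C j k, fun v w => ?_⟩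
  ext i j
  have hn : (univ.erase j : Finset (Fin n)).card + 1 = n := by
    rw [Finset.card_erase_add_one (mem_univ j), Finset.card_fin]
  rw [Matrix.of_apply, hC, Matrix.mul_apply, hn, Finset.sum_range]
  refine Finset.sum_congr rfl fun k _ => ?_
  rw [Matrix.projVandermonde_apply, Matrix.of_apply, Fin.val_rev]
  congr 3
  omega

theorem prod_prod_erase_sub {n : ℕ} (y : Fin n → S) :
    ∏ j, ∏ l ∈ univ.erase j, (y j - y l) =
      (∏ i, ∏ j ∈ Ioi i, (y i - y j)) * ∏ i, ∏ j ∈ Ioi i, (y j - y i) := by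
  have h1 : ∀ j : Fin n, (univ.erase j : Finset (Fin n)) = Ioi j ∪ Iio j := by
    intro j
    ext l
    simp only [mem_erase, mem_univ, and_true, mem_union, mem_Ioi, mem_Iio]
    rw [ne_comm, ne_iff_lt_or_gt]
  have h2 : ∀ j : Fin n, Disjoint (Ioi j) (Iio j) := by
    intro j
    rw [Finset.disjoint_left]
    intro l h h'
    exact lt_asymm (mem_Ioi.1 h) (mem_Iio.1 h')
  simp only [h1, Finset.prod_union (h2 _), Finset.prod_mul_distrib]
  congr 1
  exact Finset.prod_comm' (by simp)

/-- The determinant of C is found by specialising to v = 1, w = y, where the product is diagonal;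
injectivity of y permits cancelling the Vandermonde factor. The claim is then the case w = 1, v = x.
-/
theorem det_prod_one_sub [IsDomain S] {n : ℕ} (x y : Fin n → S) (hy : Function.Injective y) :
    (Matrix.of fun i j => ∏ l ∈ univ.erase j, (1 - x i * y l)).det =
      (∏ i, ∏ j ∈ Ioi i, (x i - x j)) * ∏ i, ∏ j ∈ Ioi i, (y i - y j) := by
  obtain ⟨C, hC⟩ := exists_projVandermonde_mul n y
  have hdet : C.det = ∏ i, ∏ j ∈ Ioi i, (y j - y i) := by
    have h1 := congrArg Matrix.det (hC (fun _ => 1) y)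
    have h2 : (Matrix.of fun i j => ∏ l ∈ univ.erase j, (y i - 1 * y l)) =
        Matrix.diagonal fun j => ∏ l ∈ univ.erase j, (y j - y l) := by
      ext i j
      rw [Matrix.of_apply]
      by_cases hij : i = j
      · subst hij
        rw [Matrix.diagonal_apply_eq]
        simp only [one_mul]
      · rw [Matrix.diagonal_apply_ne _ hij]
        exact Finset.prod_eq_zero (mem_erase.2 ⟨hij, mem_univ _⟩) (by ring)
    rw [Matrix.det_mul, h2, Matrix.det_diagonal, Matrix.det_projVandermonde,
      prod_prod_erase_sub] at h1
    simp only [one_mul] at h1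
    refine mul_left_cancel₀ ?_ h1
    refine Finset.prod_ne_zero_iff.2 fun i _ => Finset.prod_ne_zero_iff.2 fun j hj => ?_
    rw [sub_ne_zero]
    exact fun h => (mem_Ioi.1 hj).ne (hy h)
  have h1 := congrArg Matrix.det (hC x fun _ => 1)
  rw [Matrix.det_mul, Matrix.det_projVandermonde, hdet] at h1
  rw [← h1, ← Finset.prod_mul_distrib, ← Finset.prod_mul_distrib]
  refine Finset.prod_congr rfl fun i _ => ?_
  rw [← Finset.prod_mul_distrib, ← Finset.prod_mul_distrib]
  exact Finset.prod_congr rfl fun j _ => by ring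

/-- Cauchy's determinant with denominators cleared: row i is multiplied by the product of 1 − x_i
y_j over all j. -/
theorem det_geometric_mul [IsDomain S] {n : ℕ} (x y : Fin n → S) (hy : Function.Injective y)
    (G : Matrix (Fin n) (Fin n) S) (hG : ∀ i j, G i j * (1 - x i * y j) = 1) :
    G.det * ∏ i, ∏ j, (1 - x i * y j) =
      (∏ i, ∏ j ∈ Ioi i, (x i - x j)) * ∏ i, ∏ j ∈ Ioi i, (y i - y j) := by
  rw [← det_prod_one_sub x y hy, mul_comm, ← Matrix.det_mul_column]
  congr 1
  ext i j
  simp only [Matrix.of_apply]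
  rw [← Finset.mul_prod_erase univ _ (mem_univ j), mul_comm (1 - x i * y j), mul_assoc,
    mul_comm (1 - x i * y j), hG, mul_one]

end Cauchy

/-- The group is a product over the rows, so the antisymmetrisation factors into one Leibniz
expansion per row. -/
theorem sum_sgn_prod {A : Type*} [CommRing A] (f : Var m → Var m → A) :
    ∑ w : RowPerm m, ((sgn w : ℤˣ) : ℤ) • ∏ v, f (toPerm w v) v =
      ∏ k, (Matrix.of fun i j : Fin (m k) => f ⟨k, i⟩ ⟨k, j⟩).det := by
  simp only [Matrix.det_apply]
  rw [Finset.prod_univ_sum, Fintype.piFinset_univ]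
  refine Finset.sum_congr rfl fun w _ => ?_
  have : ∀ k, Equiv.Perm.sign (w k) •
      ∏ i, (Matrix.of fun i j : Fin (m k) => f ⟨k, i⟩ ⟨k, j⟩) (w k i) i =
      (((Equiv.Perm.sign (w k) : ℤˣ) : ℤ) : A) * ∏ i, f ⟨k, w k i⟩ ⟨k, i⟩ := by
    intro k
    rw [Units.smul_def, zsmul_eq_mul]
    rfl
  simp only [this, Finset.prod_mul_distrib]
  rw [zsmul_eq_mul, Fintype.prod_sigma]
  congr 1
  simp [sgn]

theorem alternant_delta_eq :
    alternant (delta m) = ∏ k, ∏ i : Fin (m k), ∏ j ∈ Ioi i,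
      (MvPolynomial.X ⟨k, i⟩ - MvPolynomial.X ⟨k, j⟩ : Poly m) := by
  have h := sum_sgn_prod (m := m) fun u v => (MvPolynomial.X u : Poly m) ^ delta m v
  rw [alternant_eq_sum]
  have h1 : ∀ w : RowPerm m, (xpow (actSeq w (delta m)) : Poly m) =
      ∏ v, (MvPolynomial.X (toPerm w v) : Poly m) ^ delta m v := by
    intro w
    rw [xpow_eq_prod, ← Equiv.prod_comp (toPerm w)]
    simp only [actSeq_toPerm]
  simp only [h1]
  rw [h]
  refine Finset.prod_congr rfl fun k _ => ?_
  have h2 := Matrix.det_projVandermonde (fun _ : Fin (m k) => (1 : Poly m))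
    fun i => MvPolynomial.X ⟨k, i⟩
  simp only [one_mul] at h2
  rw [← h2]
  congr 1
  ext1 i j
  rw [Matrix.projVandermonde_apply, Matrix.of_apply, one_pow, one_mul, Fin.val_rev]
  congr 1
  simp only [delta]
  omega

/-! ### Two sets of variables -/

/-- Polynomials in two sets of variables `x` and `y`. -/
abbrev Poly₂ (m : ZMod e → ℕ) : Type := MvPolynomial (Var m ⊕ Var m) F

/-- The embedding of the polynomials in `x`. -/
def inX : Poly m →ₐ[F] Poly₂ m := MvPolynomial.rename Sum.inl

/-- The embedding of the polynomials in `y`. -/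
def inY : Poly m →ₐ[F] Poly₂ m := MvPolynomial.rename Sum.inr

/-- The exchange of `x` and `y`. -/
def swapXY : Poly₂ m →ₐ[F] Poly₂ m := MvPolynomial.rename Sum.swap

/-- The action of the row permutations on the variables `x`. -/
def actX (w : RowPerm m) : Poly₂ m →ₐ[F] Poly₂ m := MvPolynomial.rename (Sum.map (toPerm w) id)

/-- The substitution `T_{u,J}` in the variables `x`. -/
def opTX (s : ℤˣ) (u : F) (J : Finset (∀ k : ZMod e, Fin (m k))) : Poly₂ m →ₐ[F] Poly₂ m :=
  MvPolynomial.aeval (Sum.elim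
    (fun v => MvPolynomial.C (occVal u J v) * MvPolynomial.X (Sum.inl (move s J v)))
    fun v => MvPolynomial.X (Sum.inr v))

/-- The substitution `T_{u,J}` in the variables `y`. -/
def opTY (s : ℤˣ) (u : F) (J : Finset (∀ k : ZMod e, Fin (m k))) : Poly₂ m →ₐ[F] Poly₂ m :=
  MvPolynomial.aeval (Sum.elim (fun v => MvPolynomial.X (Sum.inl v))
    fun v => MvPolynomial.C (occVal u J v) * MvPolynomial.X (Sum.inr (move s J v)))

/-- The product `x_u y_v`. -/
def xy (u v : Var m) : Poly₂ m := MvPolynomial.X (Sum.inl u) * MvPolynomial.X (Sum.inr v)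

theorem swapXY_xy (u v : Var m) : swapXY (xy u v) = xy v u := by
  simp [swapXY, xy, mul_comm]

theorem actX_xy (w : RowPerm m) (u v : Var m) : actX w (xy u v) = xy (toPerm w u) v := by
  simp [actX, xy]

theorem opTX_xy (s : ℤˣ) (a : F) (J : Finset (∀ k : ZMod e, Fin (m k))) (u v : Var m) :
    opTX s a J (xy u v) = MvPolynomial.C (occVal a J u) * xy (move s J u) v := by
  simp [opTX, xy, mul_assoc]

theorem opTY_xy (s : ℤˣ) (a : F) (J : Finset (∀ k : ZMod e, Fin (m k))) (u v : Var m) :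
    opTY s a J (xy u v) = MvPolynomial.C (occVal a J v) * xy u (move s J v) := by
  simp [opTY, xy, mul_left_comm]

theorem swapXY_inX (f : Poly m) : swapXY (inX f) = inY f := by
  rw [swapXY, inX, inY, MvPolynomial.rename_rename]
  rfl

theorem swapXY_inY (f : Poly m) : swapXY (inY f) = inX f := by
  rw [swapXY, inX, inY, MvPolynomial.rename_rename]
  rfl

theorem opTX_inX (s : ℤˣ) (a : F) (J : Finset (∀ k : ZMod e, Fin (m k))) (f : Poly m) :
    opTX s a J (inX f) = inX (opT s a J f) := by
  have : (opTX s a J).comp (inX (m := m)) = inX.comp (opT s a J) := by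
    apply MvPolynomial.algHom_ext
    intro v
    simp only [AlgHom.comp_apply, opT_X, map_mul]
    simp [inX, opTX]
  exact DFunLike.congr_fun this f

theorem opTX_inY (s : ℤˣ) (a : F) (J : Finset (∀ k : ZMod e, Fin (m k))) (f : Poly m) :
    opTX s a J (inY f) = inY f := by
  have : (opTX s a J).comp (inY (m := m)) = inY := by
    apply MvPolynomial.algHom_ext
    intro v
    simp [inY, opTX]
  exact DFunLike.congr_fun this f

theorem swapXY_opTX (s : ℤˣ) (a : F) (J : Finset (∀ k : ZMod e, Fin (m k))) (f : Poly₂ m) :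
    swapXY (opTX s a J f) = opTY s a J (swapXY f) := by
  have : swapXY.comp (opTX s a J) = (opTY s a J).comp (swapXY (m := m)) := by
    apply MvPolynomial.algHom_ext
    rintro (v | v) <;> simp [swapXY, opTX, opTY]
  exact DFunLike.congr_fun this f

theorem opTY_inY (s : ℤˣ) (a : F) (J : Finset (∀ k : ZMod e, Fin (m k))) (f : Poly m) :
    opTY s a J (inY f) = inY (opT s a J f) := by
  rw [← swapXY_inX, ← swapXY_opTX, opTX_inX, swapXY_inX]

theorem opTY_inX (s : ℤˣ) (a : F) (J : Finset (∀ k : ZMod e, Fin (m k))) (f : Poly m) :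
    opTY s a J (inX f) = inX f := by
  rw [← swapXY_inY, ← swapXY_opTX, opTX_inY, swapXY_inY]

theorem opTX_actX {J : Finset (∀ k : ZMod e, Fin (m k))} (hJ : Disj J) (s : ℤˣ) (a : F)
    (w : RowPerm m) (f : Poly₂ m) :
    opTX s a (actSet w J) (actX w f) = actX w (opTX s a J f) := by
  have : (opTX s a (actSet w J)).comp (actX w) = (actX w).comp (opTX s a J) := by
    apply MvPolynomial.algHom_ext
    rintro (v | v)
    · simp [actX, opTX, occVal_actSet, move_actSet hJ]
    · simp [actX, opTX]
  exact DFunLike.congr_fun this f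

theorem opTY_actX (J : Finset (∀ k : ZMod e, Fin (m k))) (s : ℤˣ) (a : F)
    (w : RowPerm m) (f : Poly₂ m) :
    opTY s a J (actX w f) = actX w (opTY s a J f) := by
  have : (opTY s a J).comp (actX w) = (actX w).comp (opTY s a J) := by
    apply MvPolynomial.algHom_ext
    rintro (v | v) <;> simp [actX, opTY]
  exact DFunLike.congr_fun this f

theorem sumElim_mapDomain {σ τ : Type*} (a : σ →₀ ℕ) (b : τ →₀ ℕ) :
    a.mapDomain Sum.inl + b.mapDomain Sum.inr = Finsupp.sumElim a b := by
  ext (i | i)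
  · rw [Finsupp.add_apply, Finsupp.mapDomain_apply Sum.inl_injective,
      Finsupp.mapDomain_of_notMem_range _ _ (by simp)]
    simp
  · rw [Finsupp.add_apply, Finsupp.mapDomain_apply Sum.inr_injective,
      Finsupp.mapDomain_of_notMem_range _ _ (by simp)]
    simp

theorem coeff_inX_mul_inY (a b : Var m →₀ ℕ) (f g : Poly m) :
    MvPolynomial.coeff (Finsupp.sumElim a b) (inX f * inY g) =
      MvPolynomial.coeff a f * MvPolynomial.coeff b g := by
  induction f using MvPolynomial.induction_on' with
  | add p p' hp hp' => simp only [map_add, add_mul, MvPolynomial.coeff_add, hp, hp']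
  | monomial a' r =>
    induction g using MvPolynomial.induction_on' with
    | add p p' hp hp' => simp only [map_add, mul_add, MvPolynomial.coeff_add, hp, hp']
    | monomial b' r' =>
      rw [inX, inY, MvPolynomial.rename_monomial, MvPolynomial.rename_monomial,
        MvPolynomial.monomial_mul, sumElim_mapDomain]
      simp only [MvPolynomial.coeff_monomial]
      have : Finsupp.sumElim a' b' = Finsupp.sumElim a b ↔ a' = a ∧ b' = b := by
        constructor
        · intro h
          constructor
          · ext i; simpa using DFunLike.congr_fun h (Sum.inl i)
          · ext i; simpa using DFunLike.congr_fun h (Sum.inr i)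
        · rintro ⟨rfl, rfl⟩; rfl
      simp only [this]
      by_cases h1 : a' = a <;> by_cases h2 : b' = b <;> simp [h1, h2]

end WMac

end

/-! ### The kernel and its invariance under the operators -/

noncomputable section

namespace WMac

open Finset

set_option linter.unusedSectionVars false

variable {e : ℕ} [NeZero e] {m : ZMod e → ℕ}

/-! ### The kernel functions -/

/-- The action of an endomorphism of the coefficients on power series. -/
abbrev pmap (T : Poly₂ m →ₐ[F] Poly₂ m) : PowerSeries (Poly₂ m) →+* PowerSeries (Poly₂ m) :=
  PowerSeries.map (T : Poly₂ m →+* Poly₂ m)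

/-- The Macdonald kernel. -/
def kernel (m : ZMod e → ℕ) (c : ZMod e → ℕ → F) (s : ℤˣ) : PowerSeries (Poly₂ m) :=
  ∏ u : Var m, ∏ v : Var m, ser (c (rowDist s v.1 u.1)) (xy u v)

/-- The inverse of the Cauchy kernel. -/
def cauchyInv (m : ZMod e → ℕ) : PowerSeries (Poly₂ m) :=
  ∏ u : Var m, ∏ v : Var m, if v.1 = u.1 then lin (xy u v) else 1

/-- The product of geometric series `∏ 1 / (1 - x_v y_v Z)`. -/
def diagKernel (m : ZMod e → ℕ) : PowerSeries (Poly₂ m) :=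
  ∏ v : Var m, ser (fun _ => (1 : F)) (xy v v)

/-- The antisymmetrised product of geometric series. -/
def altKernel (m : ZMod e → ℕ) : PowerSeries (Poly₂ m) :=
  ∑ w : RowPerm m, ((sgn w : ℤˣ) : ℤ) • pmap (actX w) (diagKernel m)

theorem rowDist_eq_zero_iff (s : ℤˣ) (k k' : ZMod e) : rowDist s k k' = 0 ↔ k = k' := by
  have := rowDist_eq_iff s k k' 0
  rw [Nat.cast_zero, shift_zero] at this
  rw [this, eq_comm]

theorem cauchyInv_eq (s : ℤˣ) : cauchyInv m =
    ∏ u : Var m, ∏ v : Var m, if rowDist s v.1 u.1 = 0 then lin (xy u v) else 1 := by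
  simp only [cauchyInv, rowDist_eq_zero_iff]

/-- Reindexing the right side by the move along J, the factor of an occupied u is exactly the
functional equation of c_a at the moved position, whose distance is one larger; the other factors do
not change. -/
theorem kernel_transform {c : ZMod e → ℕ → F} (hc : IsSol q t c) {J : Finset (∀ k, Fin (m k))}
    (hJ : Disj J) (s : ℤˣ) :
    pmap (opTX s q J) (kernel m c s) * pmap (opTX s t J) (cauchyInv m) =
      kernel m c s * cauchyInv m := by
  rw [cauchyInv_eq s, kernel, ← Finset.prod_mul_distrib]
  conv_rhs => rw [← Equiv.prod_comp (moveEquiv hJ s)]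
  rw [map_prod, map_prod, ← Finset.prod_mul_distrib]
  refine Finset.prod_congr rfl fun u _ => ?_
  rw [map_prod, map_prod, ← Finset.prod_mul_distrib, ← Finset.prod_mul_distrib]
  refine Finset.prod_congr rfl fun v _ => ?_
  rw [map_ser, opTX_xy, apply_ite (pmap (opTX s t J)), map_one, map_lin]
  rw [RingHom.coe_coe, opTX_xy, show moveEquiv hJ s u = move s J u from rfl]
  by_cases hu : Occ J u
  · have h1 : rowDist s v.1 (move s J u).1 = rowDist s v.1 u.1 + 1 := by
      rw [move_fst s hu, rowDist_shift_right]
    have h2 := hc.ser_mul (rowDist s v.1 (move s J u).1) (xy (move s J u) v)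
    have h3 : ∀ a : F, occVal a J u = a := fun a => if_pos hu
    rw [h2, h3, h3, h1, add_sub_cancel_right]
    simp only [add_eq_right]
    rfl
  · have h3 : ∀ a : F, occVal a J u = 1 := fun a => if_neg hu
    rw [move_of_not_occ s hu, h3, h3, map_one, one_mul]

/-- Each factor pairs x_v with y_v, so sending x_v to the moved x is, after relabelling, sending y_v
to the position it is moved from. -/
theorem pmap_diagKernel {J : Finset (∀ k, Fin (m k))} (hJ : Disj J) (s : ℤˣ) (a : F) :
    pmap (opTX s a J) (diagKernel m) = pmap (opTY (-s) a J) (diagKernel m) := by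
  rw [diagKernel, map_prod, map_prod]
  conv_rhs => rw [← Equiv.prod_comp (moveEquiv hJ s)]
  refine Finset.prod_congr rfl fun v _ => ?_
  rw [map_ser, map_ser]
  simp only [moveEquiv, Equiv.coe_fn_mk]
  rw [opTX_xy, opTY_xy, move_neg_move hJ, occVal_move hJ]

/-- A row permutation w of x carries J to wJ in the x-substitution and commutes with the
y-substitution. Only after summing over all J do the two sides agree. -/
theorem pmap_altKernel (r : ℕ) (s : ℤˣ) (a : F) :
    ∑ J ∈ IndexSets m r, pmap (opTX s a J) (altKernel m) =
      ∑ J ∈ IndexSets m r, pmap (opTY (-s) a J) (altKernel m) := by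
  simp only [altKernel, map_sum, map_zsmul]
  rw [Finset.sum_comm]
  conv_rhs => rw [Finset.sum_comm]
  refine Finset.sum_congr rfl fun w _ => ?_
  rw [← sum_actSet r w (fun J => ((sgn w : ℤˣ) : ℤ) •
    pmap (opTX s a J) (pmap (actX w) (diagKernel m)))]
  rw [← sum_actSet r 1 (fun J => ((sgn w : ℤˣ) : ℤ) •
    pmap (opTY (-s) a J) (pmap (actX w) (diagKernel m)))]
  refine Finset.sum_congr rfl fun J hJ => ?_
  have hJ' := disj_of_mem hJ
  congr 1
  rw [actSet_one]
  have h1 : pmap (opTX s a (actSet w J)) (pmap (actX w) (diagKernel m)) =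
      pmap (actX w) (pmap (opTX s a J) (diagKernel m)) := by
    ext1 d
    simp only [pmap, PowerSeries.coeff_map, RingHom.coe_coe, opTX_actX hJ']
  have h2 : pmap (opTY (-s) a J) (pmap (actX w) (diagKernel m)) =
      pmap (actX w) (pmap (opTY (-s) a J) (diagKernel m)) := by
    ext1 d
    simp only [pmap, PowerSeries.coeff_map, RingHom.coe_coe, opTY_actX]
  rw [h1, h2, pmap_diagKernel hJ']

theorem altKernel_eq_prod_det : altKernel m = ∏ k, (Matrix.of fun i j : Fin (m k) =>
    ser (fun _ => (1 : F)) (xy (⟨k, i⟩ : Var m) ⟨k, j⟩)).det := by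
  rw [← sum_sgn_prod (fun u v : Var m => ser (fun _ => (1 : F)) (xy u v)), altKernel]
  refine Finset.sum_congr rfl fun w _ => ?_
  rw [diagKernel, map_prod]
  congr 1
  refine Finset.prod_congr rfl fun v _ => ?_
  rw [map_ser, actX_xy]

theorem cauchyInv_eq_prod : cauchyInv m = ∏ k, ∏ i : Fin (m k), ∏ j : Fin (m k),
    lin (xy (⟨k, i⟩ : Var m) ⟨k, j⟩) := by
  rw [cauchyInv, Fintype.prod_sigma]
  refine Finset.prod_congr rfl fun k _ => Finset.prod_congr rfl fun i _ => ?_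
  rw [Fintype.prod_sigma, Fintype.prod_eq_single k]
  · simp
  · intro k' hk'
    simp [hk']

theorem sum_delta : ∑ v, delta m v = ∑ k, ∑ i : Fin (m k), (Ioi i).card := by
  rw [Fintype.sum_sigma]
  refine Finset.sum_congr rfl fun k _ => Finset.sum_congr rfl fun i _ => ?_
  rw [Fin.card_Ioi]
  rfl

/-- Cauchy's determinant in each row, with Z x_i in place of x_i; every pair i < j in a row
contributes one factor Z, which accounts for the exponent. -/
theorem altKernel_mul_cauchyInv : altKernel m * cauchyInv m =
    PowerSeries.X ^ (∑ v, delta m v) *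
      PowerSeries.C (inX (alternant (delta m)) * inY (alternant (delta m))) := by
  rw [altKernel_eq_prod_det, cauchyInv_eq_prod, ← Finset.prod_mul_distrib]
  have h : ∀ k, (Matrix.of fun i j : Fin (m k) =>
      ser (fun _ => (1 : F)) (xy (⟨k, i⟩ : Var m) ⟨k, j⟩)).det *
        ∏ i : Fin (m k), ∏ j : Fin (m k), lin (xy (⟨k, i⟩ : Var m) ⟨k, j⟩) =
      PowerSeries.X ^ (∑ i : Fin (m k), (Ioi i).card) *
        (PowerSeries.C (∏ i : Fin (m k), ∏ j ∈ Ioi i,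
          (MvPolynomial.X (Sum.inl ⟨k, i⟩) - MvPolynomial.X (Sum.inl ⟨k, j⟩))) *
        PowerSeries.C (∏ i : Fin (m k), ∏ j ∈ Ioi i,
          (MvPolynomial.X (Sum.inr ⟨k, i⟩) - MvPolynomial.X (Sum.inr ⟨k, j⟩)))) := by
    intro k
    have h1 : ∀ i j : Fin (m k), lin (xy (⟨k, i⟩ : Var m) ⟨k, j⟩) =
        1 - (PowerSeries.X * PowerSeries.C (MvPolynomial.X (Sum.inl ⟨k, i⟩))) *
          PowerSeries.C (MvPolynomial.X (Sum.inr ⟨k, j⟩) : Poly₂ m) := by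
      intro i j
      rw [lin, xy, map_mul]
      ring
    simp only [h1]
    rw [det_geometric_mul]
    · simp only [← mul_sub, Finset.prod_mul_distrib, Finset.prod_const, Finset.prod_pow_eq_pow_sum,
        ← map_sub, ← map_prod]
      rw [mul_assoc]
    · intro i j hij
      have := MvPolynomial.X_injective (PowerSeries.C_injective hij)
      simpa using this
    · intro i j
      rw [← h1]
      exact ser_one_mul_lin _
  simp only [h, Finset.prod_mul_distrib, Finset.prod_pow_eq_pow_sum]
  rw [← sum_delta, ← map_prod, ← map_prod, ← map_mul, alternant_delta_eq]
  simp [inX, inY]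

theorem cauchyInv_ne_zero : cauchyInv m ≠ 0 := by
  have : PowerSeries.constantCoeff (cauchyInv m) = 1 := by
    rw [cauchyInv, map_prod]
    refine Finset.prod_eq_one fun u _ => ?_
    rw [map_prod]
    refine Finset.prod_eq_one fun v _ => ?_
    split_ifs <;> simp [lin]
  intro h
  rw [h, map_zero] at this
  exact zero_ne_one this

theorem swap_kernel (c : ZMod e → ℕ → F) (s : ℤˣ) :
    pmap swapXY (kernel m c (-s)) = kernel m c s := by
  rw [kernel, kernel, map_prod]
  conv_rhs => rw [Finset.prod_comm]
  refine Finset.prod_congr rfl fun u _ => ?_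
  rw [map_prod]
  refine Finset.prod_congr rfl fun v _ => ?_
  rw [map_ser, swapXY_xy, rowDist_neg_comm]

theorem swap_cauchyInv : pmap swapXY (cauchyInv m) = cauchyInv m := by
  rw [cauchyInv, map_prod]
  conv_rhs => rw [Finset.prod_comm]
  refine Finset.prod_congr rfl fun u _ => ?_
  rw [map_prod]
  refine Finset.prod_congr rfl fun v _ => ?_
  rw [apply_ite (pmap swapXY), map_one, map_lin, RingHom.coe_coe, swapXY_xy]
  simp only [eq_comm]

/-- After multiplication by the inverse Cauchy kernel, both sides become the same expression
symmetric in x and y. -/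
theorem swap_altKernel : pmap swapXY (altKernel m) = altKernel m := by
  refine mul_right_cancel₀ (cauchyInv_ne_zero (m := m)) ?_
  conv_lhs => rw [← swap_cauchyInv, ← map_mul, altKernel_mul_cauchyInv]
  rw [altKernel_mul_cauchyInv, map_mul, map_pow, PowerSeries.map_X, PowerSeries.map_C,
    RingHom.coe_coe, map_mul, swapXY_inX, swapXY_inY, mul_comm (inY _)]

/-- Applying T_{t,J} to the Cauchy identity produces T_{t,J} a_δ; the transformation rule of K then
collects everything that depends on J into the alternating kernel. -/
theorem kernel_opTX {c : ZMod e → ℕ → F} (hc : IsSol q t c) (s : ℤˣ) (r : ℕ) :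
    PowerSeries.X ^ (∑ v, delta m v) * ∑ J ∈ IndexSets m r,
      PowerSeries.C (inX (opT s t J (alternant (delta m))) * inY (alternant (delta m))) *
        pmap (opTX s q J) (kernel m c s) =
      kernel m c s * cauchyInv m * ∑ J ∈ IndexSets m r, pmap (opTX s t J) (altKernel m) := by
  rw [Finset.mul_sum, Finset.mul_sum]
  refine Finset.sum_congr rfl fun J hJ => ?_
  have h1 := congrArg (pmap (opTX s t J)) (altKernel_mul_cauchyInv (m := m))
  rw [map_mul, map_mul, map_pow, PowerSeries.map_X, PowerSeries.map_C, RingHom.coe_coe, map_mul,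
    opTX_inX, opTX_inY] at h1
  rw [← mul_assoc, ← h1, ← kernel_transform hc (disj_of_mem hJ)]
  ring

theorem kernel_opTY {c : ZMod e → ℕ → F} (hc : IsSol q t c) (s : ℤˣ) (r : ℕ) :
    PowerSeries.X ^ (∑ v, delta m v) * ∑ J ∈ IndexSets m r,
      PowerSeries.C (inY (opT (-s) t J (alternant (delta m))) * inX (alternant (delta m))) *
        pmap (opTY (-s) q J) (kernel m c s) =
      kernel m c s * cauchyInv m * ∑ J ∈ IndexSets m r, pmap (opTY (-s) t J) (altKernel m) := by
  have hcomm : ∀ (a : F) (J : Finset (∀ k, Fin (m k))) (f : PowerSeries (Poly₂ m)),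
      pmap swapXY (pmap (opTX (-s) a J) f) = pmap (opTY (-s) a J) (pmap swapXY f) := by
    intro a J f
    ext1 d
    simp only [pmap, PowerSeries.coeff_map, RingHom.coe_coe, swapXY_opTX]
  have h := congrArg (pmap swapXY) (kernel_opTX (m := m) hc (-s) r)
  simpa only [map_mul, map_pow, PowerSeries.map_X, map_sum, PowerSeries.map_C, RingHom.coe_coe,
    hcomm, swap_kernel, swap_cauchyInv, swap_altKernel, swapXY_inX, swapXY_inY] using h

/-- This is a_δ(x) a_δ(y) times the equality of D_± in x and D_∓ in y on the degree n part of the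
kernel. -/
theorem kernel_selfadjoint {c : ZMod e → ℕ → F} (hc : IsSol q t c) (s : ℤˣ) (r : ℕ) (n : ℕ) :
    ∑ J ∈ IndexSets m r,
      inX (opT s t J (alternant (delta m))) * inY (alternant (delta m)) *
        opTX s q J (PowerSeries.coeff n (kernel m c s)) =
    ∑ J ∈ IndexSets m r,
      inY (opT (-s) t J (alternant (delta m))) * inX (alternant (delta m)) *
        opTY (-s) q J (PowerSeries.coeff n (kernel m c s)) := by
  have h := (kernel_opTX (m := m) hc s r).trans
    ((congrArg _ (pmap_altKernel r s t)).trans (kernel_opTY hc s r).symm)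
  have h2 := mul_left_cancel₀ (pow_ne_zero _ PowerSeries.X_ne_zero) h
  have h3 := congrArg (PowerSeries.coeff n) h2
  simpa only [map_sum, PowerSeries.coeff_C_mul, PowerSeries.coeff_map, RingHom.coe_coe] using h3

end WMac

end

/-! ### Monomial expansions and the Cauchy identity -/

noncomputable section

namespace WMac

open Finset

set_option linter.unusedSectionVars false

variable {e : ℕ} [NeZero e] {m : ZMod e → ℕ}

/-! ### Expansions of symmetric polynomials -/

theorem mapDomain_expo (w : RowPerm m) (β : Var m → ℕ) :
    (expo β).mapDomain (toPerm w) = expo (actSeq w β) := by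
  ext v
  obtain ⟨v, rfl⟩ := (toPerm w).surjective v
  rw [Finsupp.mapDomain_apply (toPerm w).injective]
  exact (actSeq_toPerm w β v).symm

theorem coeff_actSeq {f : Poly m} (hf : f ∈ Xi m) (w : RowPerm m) (β : Var m → ℕ) :
    MvPolynomial.coeff (expo (actSeq w β)) f = MvPolynomial.coeff (expo β) f := by
  conv_lhs => rw [← hf w]
  rw [← mapDomain_expo, actPoly, MvPolynomial.coeff_rename_mapDomain _ (toPerm w).injective]

theorem degree_expo (β : Var m → ℕ) : (expo β).degree = ∑ v, β v := by
  rw [Finsupp.degree_eq_sum]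
  rfl

theorem isHomogeneous_xpow (β : Var m → ℕ) : (xpow β).IsHomogeneous (∑ v, β v) := by
  rw [← degree_expo]
  exact MvPolynomial.isHomogeneous_monomial _ rfl

theorem isHomogeneous_monSym {n : ℕ} (α : Zn m n) :
    (monSym α.1 : Poly m).IsHomogeneous n := by
  rw [coe_monSym]
  refine MvPolynomial.IsHomogeneous.sum _ _ _ fun β hβ => ?_
  have := isHomogeneous_xpow β
  rwa [sum_of_mem_orbit hβ, α.2] at this

theorem eq_sum_monSym {n : ℕ} {f : Poly m} (hf : f ∈ Xi m) (hn : f.IsHomogeneous n) :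
    f = ∑ γ : Zn m n, MvPolynomial.coeff (expo γ.1.1) f • (monSym γ.1 : Poly m) := by
  ext μ
  obtain ⟨β, rfl⟩ : ∃ β, expo β = μ := Finsupp.equivFunOnFinite.symm.surjective μ
  by_cases hβ : ∑ v, β v = n
  · obtain ⟨w, hw⟩ := exists_actSeq_rowAntitone β
    let β₀ : Zn m n := ⟨⟨actSeq w β, hw⟩, (sum_actSeq w β).trans hβ⟩
    have hg : (∑ γ : Zn m n, MvPolynomial.coeff (expo γ.1.1) f • (monSym γ.1 : Poly m)) ∈ Xi m :=
      Subalgebra.sum_mem _ fun γ _ => Subalgebra.smul_mem _ (monSym γ.1).2 _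
    rw [← coeff_actSeq hf w, ← coeff_actSeq hg w, MvPolynomial.coeff_sum]
    simp only [MvPolynomial.coeff_smul]
    change MvPolynomial.coeff (expo β₀.1.1) f =
      ∑ γ : Zn m n, MvPolynomial.coeff (expo γ.1.1) f •
        MvPolynomial.coeff (expo β₀.1.1) (monSym γ.1 : Poly m)
    simp only [coeff_monSym]
    rw [Finset.sum_eq_single β₀]
    · simp
    · intro γ _ hne
      rw [if_neg (fun h => hne (Subtype.ext h)), smul_zero]
    · simp
  · rw [← degree_expo] at hβ
    rw [hn.coeff_eq_zero hβ, MvPolynomial.coeff_sum]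
    symm
    refine Finset.sum_eq_zero fun γ _ => ?_
    rw [MvPolynomial.coeff_smul, (isHomogeneous_monSym γ).coeff_eq_zero hβ, smul_zero]

/-! ### The functions `g` in terms of the monomial symmetric functions -/

section GPoly

variable {R : Type*} [CommRing R] {R' : Type*} [CommRing R']

/-- The products `g_β` of coefficients of the series `gSer`. -/
def gPoly (c : ZMod e → ℕ → R) (s : ℤˣ) (β : Var m → ℕ) : MvPolynomial (Var m) R :=
  ∏ v, PowerSeries.coeff (β v) (gSer m c s v.1)

/-- The matrix of the coefficients of the `g_α` with respect to the monomial basis. -/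
def gMat (m : ZMod e → ℕ) (n : ℕ) (c : ZMod e → ℕ → R) (s : ℤˣ) : Matrix (Zn m n) (Zn m n) R :=
  Matrix.of fun α γ => MvPolynomial.coeff (expo γ.1.1) (gPoly c s α.1.1)

theorem map_gMat (n : ℕ) (φ : R →+* R') (c : ZMod e → ℕ → R) (s : ℤˣ) :
    (gMat m n c s).map φ = gMat m n (fun a d => φ (c a d)) s := by
  ext α γ
  simp only [gMat, Matrix.map_apply, Matrix.of_apply, gPoly, ← map_gSer φ, PowerSeries.coeff_map]
  rw [← map_prod, MvPolynomial.coeff_map]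

end GPoly

theorem coe_gFun {c : ZMod e → ℕ → F} (hc : IsSol q t c) (s : ℤˣ) (α : EPart m) :
    ((gFun s α : Xi m) : Poly m) = gPoly c s α.1 := by
  have h := map_prod (Xi m).val (fun v : Var m => gOne s v.1 (α.1 v)) univ
  change ((gFun s α : Xi m) : Poly m) = _ at h
  rw [h]
  exact Finset.prod_congr rfl fun v _ => coe_gOne hc s v.1 (α.1 v)

theorem gPoly_mem_Xi (c : ZMod e → ℕ → F) (s : ℤˣ) (β : Var m → ℕ) : gPoly c s β ∈ Xi m :=
  Subalgebra.prod_mem _ fun v _ => coeff_gSer_mem_Xi c s v.1 (β v)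

theorem isHomogeneous_coeff_gSer (c : ZMod e → ℕ → F) (s : ℤˣ) (k : ZMod e) (d : ℕ) :
    (PowerSeries.coeff d (gSer m c s k)).IsHomogeneous d := by
  rw [gSer, PowerSeries.coeff_prod]
  refine MvPolynomial.IsHomogeneous.sum _ _ _ fun l hl => ?_
  rw [Finset.mem_finsuppAntidiag] at hl
  rw [← hl.1]
  refine MvPolynomial.IsHomogeneous.prod _ _ _ fun u _ => ?_
  rw [coeff_ser]
  have := (MvPolynomial.isHomogeneous_C (Var m) (c (rowDist s k u.1) (l u))).mul
    ((MvPolynomial.isHomogeneous_X F u).pow (l u))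
  simpa using this

theorem isHomogeneous_gPoly (c : ZMod e → ℕ → F) (s : ℤˣ) {n : ℕ} (α : Zn m n) :
    (gPoly c s α.1.1).IsHomogeneous n := by
  have h : (gPoly c s α.1.1).IsHomogeneous (∑ v, α.1.1 v) :=
    MvPolynomial.IsHomogeneous.prod _ _ _ fun v _ => isHomogeneous_coeff_gSer c s v.1 _
  rwa [α.2] at h

theorem gPoly_eq_sum (c : ZMod e → ℕ → F) (s : ℤˣ) {n : ℕ} (α : Zn m n) :
    gPoly c s α.1.1 = ∑ γ : Zn m n, gMat m n c s α γ • (monSym γ.1 : Poly m) :=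
  eq_sum_monSym (gPoly_mem_Xi c s _) (isHomogeneous_gPoly c s α)

theorem gPoly_of_mem_orbit (c : ZMod e → ℕ → F) (s : ℤˣ) {α β : Var m → ℕ} (h : β ∈ orbit α) :
    gPoly c s β = gPoly c s α := by
  obtain ⟨w, rfl⟩ := mem_orbit.1 h
  unfold gPoly
  rw [← Equiv.prod_comp (toPerm w)]
  refine Finset.prod_congr rfl fun v _ => ?_
  rw [actSeq_toPerm]
  rfl

/-- Exponents of total degree n are partitioned into orbits, each with a unique row-sorted member.
-/
theorem sum_finsuppAntidiag_eq {A : Type*} [AddCommMonoid A] (n : ℕ) (h : (Var m → ℕ) → A) :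
    ∑ l ∈ finsuppAntidiag univ n, h l = ∑ α : Zn m n, ∑ β ∈ orbit α.1.1, h β := by
  rw [Finset.sum_sigma']
  symm
  refine Finset.sum_bij (fun x _ => expo x.2) ?_ ?_ ?_ ?_
  · rintro ⟨α, β⟩ hx
    simp only [mem_sigma, mem_univ, true_and] at hx
    rw [Finset.mem_finsuppAntidiag]
    exact ⟨(sum_of_mem_orbit hx).trans α.2, Finset.subset_univ _⟩
  · rintro ⟨α, β⟩ hx ⟨α', β'⟩ hx' heq
    simp only [mem_sigma, mem_univ, true_and] at hx hx'
    obtain rfl : β = β' := expo_injective heq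
    obtain ⟨w, hw⟩ := mem_orbit.1 hx
    obtain ⟨w', hw'⟩ := mem_orbit.1 hx'
    have : α = α' := by
      apply Subtype.ext
      refine eq_of_mem_orbit (mem_orbit.2 ⟨w⁻¹ * w', ?_⟩)
      rw [← actSeq_mul, hw', ← hw, actSeq_inv_actSeq]
    subst this
    rfl
  · intro l hl
    rw [Finset.mem_finsuppAntidiag] at hl
    obtain ⟨w, hw⟩ := exists_actSeq_rowAntitone l
    refine ⟨⟨⟨⟨actSeq w l, hw⟩, (sum_actSeq w l).trans hl.1⟩, l⟩, ?_, ?_⟩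
    · simp only [mem_sigma, mem_univ, true_and]
      exact mem_orbit.2 ⟨w⁻¹, actSeq_inv_actSeq w l⟩
    · exact Finsupp.equivFunOnFinite.symm_apply_apply l
  · intros
    rfl

/-- For fixed v the product over u is the generating series of the g in the row of v, taken at Y =
y_v Z. The exponents of y are then grouped into orbits, on which the product of the g is constant.
-/
theorem coeff_kernel (c : ZMod e → ℕ → F) (s : ℤˣ) (n : ℕ) :
    PowerSeries.coeff n (kernel m c s) =
      ∑ α : Zn m n, inX (gPoly c s α.1.1) * inY (monSym α.1 : Poly m) := by
  have h1 : kernel m c s = ∏ v : Var m, PowerSeries.rescale (MvPolynomial.X (Sum.inr v))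
      (PowerSeries.map ((inX : Poly m →ₐ[F] Poly₂ m) : Poly m →+* Poly₂ m) (gSer m c s v.1)) := by
    rw [kernel, Finset.prod_comm]
    refine Finset.prod_congr rfl fun v _ => ?_
    rw [gSer, map_prod, map_prod]
    refine Finset.prod_congr rfl fun u _ => ?_
    rw [map_ser, rescale_ser, xy, mul_comm]
    simp [inX]
  rw [h1, PowerSeries.coeff_prod]
  have h2 : ∀ l : Var m →₀ ℕ, ∏ v, PowerSeries.coeff (l v)
      (PowerSeries.rescale (MvPolynomial.X (Sum.inr v)) (PowerSeries.map
        ((inX : Poly m →ₐ[F] Poly₂ m) : Poly m →+* Poly₂ m) (gSer m c s v.1))) =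
      inX (gPoly c s l) * inY (xpow l) := by
    intro l
    rw [gPoly, xpow_eq_prod, map_prod, map_prod, ← Finset.prod_mul_distrib]
    refine Finset.prod_congr rfl fun v _ => ?_
    rw [PowerSeries.coeff_rescale, PowerSeries.coeff_map, mul_comm]
    simp [inY]
  simp only [h2]
  rw [sum_finsuppAntidiag_eq n fun l => inX (gPoly c s l) * inY (xpow l)]
  refine Finset.sum_congr rfl fun α _ => ?_
  rw [coe_monSym, map_sum, Finset.mul_sum]
  refine Finset.sum_congr rfl fun β hβ => ?_
  rw [gPoly_of_mem_orbit c s hβ]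

theorem coeff_sum_inX_inY {n : ℕ} (M : Matrix (Zn m n) (Zn m n) F) (α β : Zn m n) :
    MvPolynomial.coeff (Finsupp.sumElim (expo β.1.1) (expo α.1.1))
      (∑ α' : Zn m n, ∑ β' : Zn m n,
        M α' β' • (inX (monSym β'.1 : Poly m) * inY (monSym α'.1 : Poly m))) = M α β := by
  rw [MvPolynomial.coeff_sum, Finset.sum_eq_single α, MvPolynomial.coeff_sum,
    Finset.sum_eq_single β]
  · rw [MvPolynomial.coeff_smul, coeff_inX_mul_inY, coeff_monSym, coeff_monSym]
    simp
  · intro β' _ hne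
    rw [MvPolynomial.coeff_smul, coeff_inX_mul_inY, coeff_monSym,
      if_neg (fun h => hne (Subtype.ext h)), zero_mul, smul_zero]
  · simp
  · intro α' _ hne
    rw [MvPolynomial.coeff_sum]
    refine Finset.sum_eq_zero fun β' _ => ?_
    rw [MvPolynomial.coeff_smul, coeff_inX_mul_inY, coeff_monSym α'.1,
      if_neg (fun h => hne (Subtype.ext h)), mul_zero, smul_zero]
  · simp

theorem matrix_eq_of_sum_eq {n : ℕ} {M M' : Matrix (Zn m n) (Zn m n) F}
    (h : ∑ α : Zn m n, ∑ β : Zn m n,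
        M α β • (inX (monSym β.1 : Poly m) * inY (monSym α.1 : Poly m)) =
      ∑ α : Zn m n, ∑ β : Zn m n,
        M' α β • (inX (monSym β.1 : Poly m) * inY (monSym α.1 : Poly m))) : M = M' := by
  ext α β
  rw [← coeff_sum_inX_inY M, h, coeff_sum_inX_inY]

theorem coeff_kernel_eq_sum (c : ZMod e → ℕ → F) (s : ℤˣ) (n : ℕ) :
    PowerSeries.coeff n (kernel m c s) = ∑ α : Zn m n, ∑ β : Zn m n,
      gMat m n c s α β • (inX (monSym β.1 : Poly m) * inY (monSym α.1 : Poly m)) := by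
  rw [coeff_kernel]
  refine Finset.sum_congr rfl fun α _ => ?_
  rw [gPoly_eq_sum, map_sum, Finset.sum_mul]
  simp only [map_smul, smul_mul_assoc]

/-- Exchanging x and y reverses the cyclic distance, hence the sign. This is why the two duality
conditions on the form are compatible. -/
theorem gMat_transpose (c : ZMod e → ℕ → F) (s : ℤˣ) (n : ℕ) :
    (gMat m n c (-s)).transpose = gMat m n c s := by
  apply matrix_eq_of_sum_eq
  rw [← coeff_kernel_eq_sum, ← swap_kernel, PowerSeries.coeff_map, RingHom.coe_coe,
    coeff_kernel_eq_sum, map_sum, Finset.sum_comm]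
  refine Finset.sum_congr rfl fun α _ => ?_
  rw [map_sum]
  refine Finset.sum_congr rfl fun β _ => ?_
  rw [map_smul, map_mul, swapXY_inX, swapXY_inY, Matrix.transpose_apply, mul_comm]

/-! ### Orthonormality of the Schur functions at `q = t = 0` -/

/-- The solution for `q = t = 0`. -/
def solZero : ZMod e → ℕ → F := fun a d => if a = 0 ∨ d = 0 then 1 else 0

/-- At q = t = 0 only pairs in the same row contribute, each with a geometric series, so K is the
Cauchy kernel. -/
theorem kernel_solZero_mul : kernel m solZero 1 * cauchyInv m = 1 := by
  rw [cauchyInv_eq 1, kernel, ← Finset.prod_mul_distrib]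
  refine Finset.prod_eq_one fun u _ => ?_
  rw [← Finset.prod_mul_distrib]
  refine Finset.prod_eq_one fun v _ => ?_
  split_ifs with h
  · rw [h]
    have h2 : (solZero (0 : ZMod e) : ℕ → F) = fun _ => 1 := by
      funext d; simp [solZero]
    rw [h2]
    exact ser_one_mul_lin _
  · rw [mul_one]
    ext1 d
    rw [coeff_ser, PowerSeries.coeff_one]
    by_cases hd : d = 0 <;> simp [solZero, h, hd]

/-- The matrix of `monToSchur` over a ring. -/
def schurMat (m : ZMod e → ℕ) (n : ℕ) (R : Type*) [CommRing R] : Matrix (Zn m n) (Zn m n) R :=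
  Matrix.of fun α β => (monToSchur α β : R)

theorem coeff_alternant_delta_mul {n : ℕ} (α κ : Zn m n) :
    MvPolynomial.coeff (expo (symbol κ.1)) (alternant (delta m) * (monSym α.1 : Poly m)) =
      schurMat m n F α κ := by
  rw [alternant_delta_mul_monSym, MvPolynomial.coeff_sum, Finset.sum_eq_single κ]
  · rw [MvPolynomial.coeff_smul, coeff_alternant, altCoeff_symbol]
    simp [schurMat]
  · intro β _ hne
    rw [MvPolynomial.coeff_smul, coeff_alternant, altCoeff_symbol,
      if_neg (fun h => hne (Subtype.ext h)), Int.cast_zero, smul_zero]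
  · simp

theorem coeff_altKernel (n : ℕ) : PowerSeries.coeff n (altKernel m) =
    ∑ l ∈ finsuppAntidiag univ n, inX (alternant l) * inY (xpow l) := by
  have h1 : PowerSeries.coeff n (diagKernel m) =
      ∑ l ∈ finsuppAntidiag univ n, inX (xpow l) * inY (xpow l) := by
    rw [diagKernel, PowerSeries.coeff_prod]
    refine Finset.sum_congr rfl fun l _ => ?_
    rw [xpow_eq_prod, map_prod, map_prod, ← Finset.prod_mul_distrib]
    refine Finset.prod_congr rfl fun v _ => ?_
    simp [coeff_ser, xy, inX, inY, mul_pow]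
  have h2 : ∀ (w : RowPerm m) (f : Poly m), actX w (inX f) = inX (actPoly w f) := by
    intro w f
    rw [actX, inX, actPoly, MvPolynomial.rename_rename, MvPolynomial.rename_rename]
    rfl
  have h3 : ∀ (w : RowPerm m) (f : Poly m), actX w (inY f) = inY f := by
    intro w f
    rw [actX, inY, MvPolynomial.rename_rename]
    rfl
  rw [altKernel, map_sum]
  simp only [map_zsmul, PowerSeries.coeff_map, RingHom.coe_coe, h1, map_sum, map_mul, h2, h3,
    Finset.smul_sum]
  rw [Finset.sum_comm]
  refine Finset.sum_congr rfl fun l _ => ?_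
  rw [alternant, map_sum, Finset.sum_mul]
  simp only [map_zsmul, smul_mul_assoc]

/-- The Cauchy identity now reads ∑ a_l(x) y^l = Z-coefficient of a_δ(x) a_δ(y) K. Comparing
coefficients of x^Λ(κ) y^Λ(κ') gives the identity matrix on the left and the conjugated matrix of K
on the right. -/
theorem gram_solZero (n : ℕ) :
    (schurMat m n F).transpose * gMat m n solZero 1 * schurMat m n F = 1 := by
  have h1 : altKernel m = PowerSeries.X ^ (∑ v, delta m v) *
      (PowerSeries.C (inX (alternant (delta m)) * inY (alternant (delta m))) *
        kernel m solZero 1) := by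
    have h2 := altKernel_mul_cauchyInv (m := m)
    have h3 := kernel_solZero_mul (m := m)
    linear_combination (kernel m solZero 1) * h2 - altKernel m * h3
  have h2 := congrArg (PowerSeries.coeff (n + ∑ v, delta m v)) h1
  rw [PowerSeries.coeff_X_pow_mul, PowerSeries.coeff_C_mul, coeff_altKernel,
    coeff_kernel_eq_sum] at h2
  ext κ' κ
  have h3 := congrArg (MvPolynomial.coeff (Finsupp.sumElim (expo (symbol κ.1))
    (expo (symbol κ'.1)))) h2
  have hmem : expo (symbol κ'.1) ∈ finsuppAntidiag univ (n + ∑ v, delta m v) := by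
    rw [Finset.mem_finsuppAntidiag]
    refine ⟨?_, Finset.subset_univ _⟩
    have := sum_symbol κ'.1
    rw [κ'.2] at this
    exact this
  -- Only the summand with y-exponent Λ(κ') can contribute to the extracted coefficient.
  rw [MvPolynomial.coeff_sum, Finset.sum_eq_single (expo (symbol κ'.1))] at h3
  · rw [coeff_inX_mul_inY] at h3
    change MvPolynomial.coeff _ (alternant (symbol κ'.1)) *
      MvPolynomial.coeff _ (xpow (symbol κ'.1)) = _ at h3
    rw [coeff_alternant, coeff_xpow, if_pos rfl, mul_one, altCoeff_symbol, Finset.mul_sum,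
      MvPolynomial.coeff_sum] at h3
    have h4 : ∀ α : Zn m n, MvPolynomial.coeff (Finsupp.sumElim (expo (symbol κ.1))
        (expo (symbol κ'.1))) (inX (alternant (delta m)) * inY (alternant (delta m)) *
          ∑ β : Zn m n, gMat m n solZero 1 α β •
            (inX (monSym β.1 : Poly m) * inY (monSym α.1 : Poly m))) =
        ∑ β : Zn m n, schurMat m n F α κ' * (gMat m n solZero 1 α β * schurMat m n F β κ) := by
      intro α
      rw [Finset.mul_sum, MvPolynomial.coeff_sum]
      refine Finset.sum_congr rfl fun β _ => ?_
      rw [mul_smul_comm, MvPolynomial.coeff_smul, mul_mul_mul_comm, ← map_mul, ← map_mul,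
        coeff_inX_mul_inY, coeff_alternant_delta_mul, coeff_alternant_delta_mul, smul_eq_mul]
      ring
    simp only [h4] at h3
    rw [Matrix.mul_assoc, Matrix.mul_apply]
    simp only [Matrix.mul_apply, Matrix.transpose_apply, Finset.mul_sum]
    rw [← h3, Matrix.one_apply]
    by_cases h : κ' = κ
    · simp [h]
    · rw [if_neg h, if_neg fun h' => h (Subtype.ext h'), Int.cast_zero]
  · intro l _ hne
    rw [coeff_inX_mul_inY, coeff_xpow, if_neg, mul_zero]
    intro h
    exact hne (by rw [← h]; exact (Finsupp.equivFunOnFinite.symm_apply_apply l).symm)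
  · exact fun h => absurd hmem h

end WMac

end

/-! ### Conjugation, specialisation at the origin, and matrices of the operators -/

noncomputable section

namespace WMac

open Finset

set_option linter.unusedSectionVars false

variable {e : ℕ} [NeZero e] {m : ZMod e → ℕ}

/-! ### Complex conjugation -/

theorem ratMap_algebraMap {K L : Type} [Field K] [Field L] (φ : K →+* L) (p : Polynomial K) :
    ratMap φ (algebraMap _ _ p) = algebraMap _ _ (p.map φ) := by
  have h := RatFunc.map_apply_div (φ := Polynomial.mapRingHom φ) (hφ := by
    intro p hp
    rw [Submonoid.mem_comap, mem_nonZeroDivisors_iff_ne_zero]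
    rw [mem_nonZeroDivisors_iff_ne_zero] at hp
    simpa [Polynomial.map_eq_zero] using hp) p 1
  simp only [map_one, div_one] at h
  exact h

theorem ratMap_X {K L : Type} [Field K] [Field L] (φ : K →+* L) :
    ratMap φ RatFunc.X = RatFunc.X := by
  rw [← RatFunc.algebraMap_X, ratMap_algebraMap, Polynomial.map_X, RatFunc.algebraMap_X]

theorem ratMap_C {K L : Type} [Field K] [Field L] (φ : K →+* L) (a : K) :
    ratMap φ (RatFunc.C a) = RatFunc.C (φ a) := by
  rw [← RatFunc.algebraMap_C, ratMap_algebraMap, Polynomial.map_C, RatFunc.algebraMap_C]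

theorem ratMap_ratMap {K : Type} [Field K] (φ : K →+* K) (hφ : ∀ a, φ (φ a) = a) (f : RatFunc K) :
    ratMap φ (ratMap φ f) = f := by
  have hp : ∀ p : Polynomial K, (p.map φ).map φ = p := by
    intro p
    ext i
    simp [hφ]
  induction f using RatFunc.induction_on with
  | f p q hq =>
    rw [map_div₀, map_div₀, ratMap_algebraMap, ratMap_algebraMap, ratMap_algebraMap,
      ratMap_algebraMap, hp, hp]

theorem conjF_conjF (f : F) : conjF (conjF f) = f :=
  ratMap_ratMap _ (ratMap_ratMap _ Complex.conj_conj) f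

theorem conjF_q : conjF q = q := ratMap_X _

theorem conjF_t : conjF t = t := by
  rw [conjF, t, ratMap_C, ratMap_X]

/-! ### The solution over the ground field -/

theorem isUnit_of_ne_zero {x : F} (h : x ≠ 0) : IsUnit x := by
  have := IsUnit.mk0 x h
  exact this

theorem isUnit_one_sub_q_pow (d : ℕ) : IsUnit (1 - q ^ ((d + 1) * e)) := by
  refine isUnit_of_ne_zero fun h' => ?_
  have h := sub_eq_zero.1 h'
  have hne : (d + 1) * e ≠ 0 := mul_ne_zero (Nat.succ_ne_zero d) (NeZero.ne e)
  rw [q, ← RatFunc.algebraMap_X, ← map_pow,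
    ← map_one (algebraMap (Polynomial (RatFunc ℂ)) (RatFunc (RatFunc ℂ)))] at h
  have h2 := congrArg Polynomial.natDegree (RatFunc.algebraMap_injective _ h)
  rw [Polynomial.natDegree_X_pow, Polynomial.natDegree_one] at h2
  exact hne h2.symm

/-- Conjugation fixes q and t, so it carries solutions to solutions and uniqueness applies. All
matrices built from c are therefore unaffected by the conjugate-linearity of the form. -/
theorem conjF_sol {c : ZMod e → ℕ → F} (hc : IsSol q t c) : (fun a d => conjF (c a d)) = c := by
  have h := hc.map conjF
  rw [conjF_q, conjF_t] at h
  exact h.unique isUnit_one_sub_q_pow hc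

theorem gMat_map_conjF {c : ZMod e → ℕ → F} (hc : IsSol q t c) (n : ℕ) (s : ℤˣ) :
    (gMat m n c s).map conjF = gMat m n c s := by
  rw [map_gMat, conjF_sol hc]

/-! ### Specialization at `q = t = 0` -/

theorem isUnit_mk_of_mem {R : Type*} [CommRing R] {M : Submonoid R} (S : Type*) [CommRing S]
    [Algebra R S] [IsLocalization M S] {a : R} (ha : a ∈ M) (s : M) :
    IsUnit (IsLocalization.mk' S a s) := by
  have h := IsLocalization.map_units S (⟨a, ha⟩ : M)
  rw [← IsLocalization.mk'_spec S a s] at h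
  exact isUnit_of_mul_isUnit_left h

/-- The ring is the localisation of ℂ[t][q] at the polynomials with nonzero value at the origin; ι
is its inclusion in F and ε the evaluation at q = t = 0. -/
theorem exists_specialization : ∃ (R : Type) (_ : CommRing R) (ι ε : R →+* F) (q' t' : R),
    Function.Injective ι ∧ (∀ x, ε x ≠ 0 → IsUnit x) ∧
      ι q' = q ∧ ι t' = t ∧ ε q' = 0 ∧ ε t' = 0 := by
  let R₀ := Polynomial (Polynomial ℂ)
  let ι₀ : R₀ →+* F := (algebraMap (Polynomial (RatFunc ℂ)) F).comp
    (Polynomial.mapRingHom (algebraMap (Polynomial ℂ) (RatFunc ℂ)))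
  have hι₀ : Function.Injective ι₀ := (RatFunc.algebraMap_injective (RatFunc ℂ)).comp
    (Polynomial.map_injective _ (RatFunc.algebraMap_injective ℂ))
  let ε₀ : R₀ →+* F := ((RatFunc.C : RatFunc ℂ →+* F).comp (RatFunc.C : ℂ →+* RatFunc ℂ)).comp
    ((Polynomial.evalRingHom (0 : ℂ)).comp (Polynomial.evalRingHom (0 : Polynomial ℂ)))
  let M : Submonoid R₀ := (IsUnit.submonoid F).comap ε₀
  have hM : ∀ y : R₀, y ∈ M ↔ ε₀ y ≠ 0 := fun y =>
    ⟨fun h => IsUnit.ne_zero (M₀ := F) h, fun h => isUnit_of_ne_zero h⟩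
  have h1 : ∀ y : M, IsUnit (ι₀ y) := by
    intro y
    refine isUnit_of_ne_zero fun h => ?_
    have hy : (y : R₀) = 0 := hι₀ (by rw [h, map_zero])
    exact (hM y).1 y.2 (by rw [hy, map_zero])
  have h2 : ∀ y : M, IsUnit (ε₀ y) := fun y => y.2
  refine ⟨Localization M, inferInstance, IsLocalization.lift h1, IsLocalization.lift h2,
    algebraMap R₀ _ Polynomial.X, algebraMap R₀ _ (Polynomial.C Polynomial.X), ?_, ?_, ?_, ?_, ?_,
    ?_⟩
  · rw [IsLocalization.lift_injective_iff]
    intro x y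
    constructor
    · intro h
      have := congrArg (IsLocalization.lift h1) h
      rwa [IsLocalization.lift_eq, IsLocalization.lift_eq] at this
    · intro h
      rw [hι₀ h]
  · intro x hx
    obtain ⟨a, s, rfl⟩ := IsLocalization.exists_mk'_eq M x
    have ha : ε₀ a ≠ 0 := by
      intro h
      apply hx
      rw [IsLocalization.lift_mk', h, zero_mul]
    exact isUnit_mk_of_mem (Localization M) ((hM a).2 ha) s
  · rw [IsLocalization.lift_eq]
    change algebraMap (Polynomial (RatFunc ℂ)) F (Polynomial.map _ Polynomial.X) = _
    rw [Polynomial.map_X]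
    exact RatFunc.algebraMap_X
  · rw [IsLocalization.lift_eq]
    change algebraMap (Polynomial (RatFunc ℂ)) F (Polynomial.map _ (Polynomial.C _)) = _
    rw [Polynomial.map_C, RatFunc.algebraMap_X]
    exact RatFunc.algebraMap_C _
  · rw [IsLocalization.lift_eq]
    change (RatFunc.C (RatFunc.C (Polynomial.eval (0 : ℂ) (Polynomial.eval (0 : Polynomial ℂ)
      Polynomial.X))) : F) = _
    rw [Polynomial.eval_X, Polynomial.eval_zero, map_zero, map_zero]
  · rw [IsLocalization.lift_eq]
    change (RatFunc.C (RatFunc.C (Polynomial.eval (0 : ℂ) (Polynomial.eval (0 : Polynomial ℂ)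
      (Polynomial.C Polynomial.X)))) : F) = _
    rw [Polynomial.eval_C, Polynomial.eval_X, map_zero, map_zero]

/-- The inverse of the Gram matrix of the Schur functions. -/
def schurGramInv {R : Type*} [CommRing R] (m : ZMod e → ℕ) (n : ℕ) (c : ZMod e → ℕ → R) :
    Matrix (Zn m n) (Zn m n) R :=
  (schurMat m n R).transpose * gMat m n c 1 * schurMat m n R

theorem map_schurMat {R R' : Type*} [CommRing R] [CommRing R'] (n : ℕ) (φ : R →+* R') :
    (schurMat m n R).map φ = schurMat m n R' := by
  ext α β
  simp [schurMat]

theorem map_schurGramInv {R R' : Type*} [CommRing R] [CommRing R'] (n : ℕ) (φ : R →+* R')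
    (c : ZMod e → ℕ → R) :
    (schurGramInv m n c).map φ = schurGramInv m n fun a d => φ (c a d) := by
  rw [schurGramInv, Matrix.map_mul, Matrix.map_mul, Matrix.transpose_map, map_schurMat, map_gMat]
  rfl

theorem schurGramInv_solZero (n : ℕ) : schurGramInv m n (solZero : ZMod e → ℕ → F) = 1 :=
  gram_solZero n

-- Over the local ring the matrix reduces to 1 at the origin, so it is invertible there and its
-- inverse also reduces to 1. Every principal minor of the inverse then has value 1 at the origin,
-- and stays nonzero in F because ι is injective.
open Classical in
theorem exists_schurGram {c : ZMod e → ℕ → F} (hc : IsSol q t c) (n : ℕ) :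
    ∃ G : Matrix (Zn m n) (Zn m n) F, schurGramInv m n c * G = 1 ∧
      ∀ p : Zn m n → Prop, (G.submatrix (Subtype.val : {α // p α} → _) Subtype.val).det ≠ 0 := by
  obtain ⟨R, _, ι, ε, q', t', hι, hε, hq, ht, hq0, ht0⟩ := exists_specialization
  obtain ⟨c', hc'⟩ := exists_isSol (e := e) (q := q') t' fun d => hε _ (by
    rw [map_sub, map_one, map_pow, hq0, zero_pow
      (mul_ne_zero (Nat.succ_ne_zero d) (NeZero.ne e)), sub_zero]
    exact one_ne_zero)
  have h1 : (fun a d => ι (c' a d)) = c := by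
    have h := hc'.map ι
    rw [hq, ht] at h
    exact h.unique isUnit_one_sub_q_pow hc
  have h2 : (fun a d => ε (c' a d)) = solZero := by
    have h := hc'.map ε
    rw [hq0, ht0] at h
    refine h.unique (fun d => ?_) isSol_zero
    rw [zero_pow (mul_ne_zero (Nat.succ_ne_zero d) (NeZero.ne e)), sub_zero]
    exact isUnit_one
  have hεH : (schurGramInv m n c').map ε = 1 := by
    rw [map_schurGramInv, h2, schurGramInv_solZero]
  have hdet : IsUnit (schurGramInv m n c').det := by
    apply hε
    rw [RingHom.map_det, RingHom.mapMatrix_apply, hεH, Matrix.det_one]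
    exact one_ne_zero
  have hinv := Matrix.mul_nonsing_inv _ hdet
  have hεG : ((schurGramInv m n c')⁻¹).map ε = 1 := by
    have := congrArg (fun M : Matrix _ _ R => M.map ε) hinv
    simp only [Matrix.map_mul] at this
    rwa [hεH, one_mul, Matrix.map_one _ (map_zero ε) (map_one ε)] at this
  refine ⟨((schurGramInv m n c')⁻¹).map ι, ?_, fun p => ?_⟩
  · rw [← h1, ← map_schurGramInv, ← Matrix.map_mul, hinv,
      Matrix.map_one _ (map_zero ι) (map_one ι)]
  · rw [Matrix.submatrix_map, ← RingHom.mapMatrix_apply, ← RingHom.map_det]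
    intro h
    have h3 := hι (h.trans (map_zero ι).symm)
    have h4 := congrArg ε h3
    rw [RingHom.map_det, RingHom.mapMatrix_apply, ← Matrix.submatrix_map, hεG, map_zero,
      Matrix.submatrix_one _ Subtype.val_injective, Matrix.det_one] at h4
    exact one_ne_zero h4

/-! ### Schur functions as symmetric polynomials -/

/-- The matrix expressing the Schur functions in terms of the monomial symmetric polynomials. -/
def schurToMon (m : ZMod e → ℕ) (n : ℕ) : Matrix (Zn m n) (Zn m n) F :=
  (schurMat m n F).transpose * gMat m n solZero 1

theorem schurToMon_mul (n : ℕ) : schurToMon m n * schurMat m n F = 1 := gram_solZero n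

theorem mul_schurToMon (n : ℕ) : schurMat m n F * schurToMon m n = 1 :=
  mul_eq_one_comm.1 (schurToMon_mul n)

theorem schurToMon_map_conjF (n : ℕ) : (schurToMon m n).map conjF = schurToMon m n := by
  rw [schurToMon, Matrix.map_mul, Matrix.transpose_map, map_schurMat, map_gMat]
  congr 3
  funext a d
  simp [solZero, apply_ite conjF]

theorem schurMat_eq {n : ℕ} {prec : Zn m n → Zn m n → Prop} (h : IsAdmissible prec)
    {α β : Zn m n} (hl : ¬ Low prec β α) : schurMat m n F α β = if α = β then 1 else 0 := by
  rw [schurMat, Matrix.of_apply, monToSchur_eq h α β hl]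
  split_ifs <;> simp

/-- The inverse of a matrix unitriangular for `Low` is unitriangular; the induction runs over
families from below. -/
theorem schurToMon_eq {n : ℕ} {prec : Zn m n → Zn m n → Prop} (h : IsAdmissible prec)
    {α β : Zn m n} (hl : ¬ Low prec β α) : schurToMon m n α β = if α = β then 1 else 0 := by
  classical
  induction α using h.wf_low.induction with
  | _ α ih =>
    have h1 : ∑ γ, schurMat m n F α γ * schurToMon m n γ β = (1 : Matrix _ _ F) α β := by
      rw [← mul_schurToMon, Matrix.mul_apply]
    rw [Matrix.one_apply] at h1
    rw [← h1, Finset.sum_eq_single α]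
    · rw [schurMat_eq h (fun hl => h.irrefl _ hl.1), if_pos rfl, one_mul]
    · intro γ _ hne
      by_cases hγ : Low prec γ α
      · rw [ih γ hγ (fun hl' => hl (h.low_trans hl' hγ)), if_neg, mul_zero]
        rintro rfl
        exact hl hγ
      · rw [schurMat_eq h hγ, if_neg hne.symm, zero_mul]
    · simp

/-- The Schur function as a symmetric polynomial. -/
def schurXi {n : ℕ} (α : Zn m n) : Xi m := ∑ β, schurToMon m n α β • monSym β.1

theorem coe_sum_smul {n : ℕ} (c : Zn m n → F) (f : Zn m n → Xi m) :
    ((∑ β, c β • f β : Xi m) : Poly m) = ∑ β, c β • (f β : Poly m) := by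
  have h := map_sum (Xi m).val (fun β => c β • f β) univ
  simp only [map_smul] at h
  exact h

theorem alternant_delta_mul_schurXi {n : ℕ} (α : Zn m n) :
    alternant (delta m) * (schurXi α : Poly m) = alternant (symbol α.1) := by
  rw [schurXi, coe_sum_smul, Finset.mul_sum]
  simp only [mul_smul_comm, alternant_delta_mul_monSym, Finset.smul_sum]
  rw [Finset.sum_comm]
  have h : ∀ κ : Zn m n, ∑ β : Zn m n, schurToMon m n α β •
      (monToSchur β κ : F) • alternant (symbol κ.1) =
      (1 : Matrix (Zn m n) (Zn m n) F) α κ • alternant (symbol κ.1) := by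
    intro κ
    rw [← schurToMon_mul, Matrix.mul_apply, Finset.sum_smul]
    simp only [smul_smul]
    rfl
  simp only [h, Matrix.one_apply, ite_smul, one_smul, zero_smul, Finset.sum_ite_eq, mem_univ,
    if_true]

theorem toRat_injective : Function.Injective (toRat : Xi m → RatFn m) :=
  (IsFractionRing.injective (Poly m) (RatFn m)).comp Subtype.val_injective

theorem toRat_schurXi {n : ℕ} (α : Zn m n) : toRat (schurXi α) = schur α.1 := by
  have h0 : algebraMap (Poly m) (RatFn m) (alternant (delta m)) ≠ 0 := by
    rw [Ne, IsFractionRing.to_map_eq_zero_iff]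
    exact alternant_delta_ne_zero
  rw [schur, eq_div_iff h0, toRat, ← map_mul, mul_comm, alternant_delta_mul_schurXi]
  rfl

/-- The inclusion of symmetric polynomials into rational functions as a linear map. -/
def toRatLin (m : ZMod e → ℕ) : Xi m →ₗ[F] RatFn m :=
  (IsScalarTower.toAlgHom F (Poly m) (RatFn m)).toLinearMap.comp (Xi m).val.toLinearMap

theorem toRatLin_apply (f : Xi m) : toRatLin m f = toRat f := rfl

theorem monSym_eq_sum_schurXi {n : ℕ} (α : Zn m n) :
    monSym α.1 = ∑ β, schurMat m n F α β • schurXi β := by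
  simp only [schurXi, Finset.smul_sum, smul_smul]
  rw [Finset.sum_comm]
  have h : ∀ κ : Zn m n, ∑ β : Zn m n, (schurMat m n F α β * schurToMon m n β κ) •
      monSym κ.1 = (1 : Matrix (Zn m n) (Zn m n) F) α κ • monSym κ.1 := by
    intro κ
    rw [← mul_schurToMon, Matrix.mul_apply, Finset.sum_smul]
  simp only [h, Matrix.one_apply, ite_smul, one_smul, zero_smul, Finset.sum_ite_eq, mem_univ,
    if_true]

/-! ### The matrices of the Macdonald operators -/

/-- The matrix of `D^r_±` on the monomial basis. -/
def opMat (m : ZMod e → ℕ) (n : ℕ) (s : ℤˣ) (r : ℕ) : Matrix (Zn m n) (Zn m n) F :=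
  Matrix.of (opSchurMatrix s r) * schurToMon m n

theorem opE_monSym_eq (s : ℤˣ) (r : ℕ) {n : ℕ} (α : Zn m n) :
    opE s r (monSym α.1 : Poly m) =
      alternant (delta m) * ∑ β, opMat m n s r α β • (monSym β.1 : Poly m) := by
  rw [opE_monSym_expand]
  simp only [← alternant_delta_mul_schurXi, ← mul_smul_comm, ← Finset.mul_sum]
  congr 1
  simp only [schurXi, coe_sum_smul, Finset.smul_sum, smul_smul]
  rw [Finset.sum_comm]
  refine Finset.sum_congr rfl fun β _ => ?_
  rw [opMat, Matrix.mul_apply, Finset.sum_smul]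
  rfl

theorem opMat_map_conjF (s : ℤˣ) (r : ℕ) (n : ℕ) :
    (opMat m n s r).map conjF = opMat m n s r := by
  rw [opMat, Matrix.map_mul, schurToMon_map_conjF]
  congr 1
  ext α β
  simp [opSchurMatrix, conjF_q, conjF_t]

theorem opMat_eq_zero (s : ℤˣ) (r : ℕ) {n : ℕ} {prec : Zn m n → Zn m n → Prop}
    (h : IsAdmissible prec) {α β : Zn m n} (h1 : ¬ Low prec β α) (h2 : ¬ Similar β α) :
    opMat m n s r α β = 0 := by
  rw [opMat, Matrix.mul_apply]
  refine Finset.sum_eq_zero fun γ _ => ?_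
  rw [Matrix.of_apply]
  by_cases hγ : Low prec γ α ∨ Similar γ α
  · rw [schurToMon_eq h (α := γ) (β := β), if_neg, mul_zero]
    · rintro rfl
      exact hγ.elim h1 h2
    · intro hl
      exact h1 (hγ.elim (fun h' => h.low_trans hl h') fun h' => h.low_congr_right h' hl)
  · rw [not_or] at hγ
    rw [opSchurMatrix_eq_zero s r h α γ hγ.1 hγ.2, zero_mul]

theorem sum_smul_mul_left {K S ι : Type*} [CommRing K] [CommRing S] [Algebra K S] [Fintype ι]
    (A b : Matrix ι ι K) (a a' : S) (X Y : ι → S) :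
    ∑ α, ∑ β, A α β • ((a * ∑ γ, b β γ • X γ) * (a' * Y α)) =
      a * a' * ∑ α, ∑ β, (A * b) α β • (X β * Y α) := by
  rw [Finset.mul_sum]
  refine Finset.sum_congr rfl fun α _ => ?_
  simp only [Finset.mul_sum, Finset.sum_mul, mul_smul_comm, smul_mul_assoc, Finset.smul_sum,
    smul_smul, Matrix.mul_apply, Finset.sum_smul]
  rw [Finset.sum_comm]
  refine Finset.sum_congr rfl fun β _ => Finset.sum_congr rfl fun γ _ => ?_
  congr 1
  ring

theorem sum_smul_mul_right {K S ι : Type*} [CommRing K] [CommRing S] [Algebra K S] [Fintype ι]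
    (A b : Matrix ι ι K) (a a' : S) (X Y : ι → S) :
    ∑ α, ∑ β, A α β • ((a * X β) * (a' * ∑ γ, b α γ • Y γ)) =
      a * a' * ∑ α, ∑ β, (b.transpose * A) α β • (X β * Y α) := by
  rw [Finset.sum_comm]
  conv_rhs => rw [Finset.sum_comm, Finset.mul_sum]
  refine Finset.sum_congr rfl fun β _ => ?_
  simp only [Finset.mul_sum, mul_smul_comm, Finset.smul_sum, smul_smul, Matrix.mul_apply,
    Finset.sum_smul, Matrix.transpose_apply]
  rw [Finset.sum_comm]
  refine Finset.sum_congr rfl fun α _ => Finset.sum_congr rfl fun γ _ => ?_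
  rw [mul_comm (A γ β)]
  congr 1
  ring

/-- Adjointness in matrix form: both sides of the kernel identity are expanded in the independent
products m_β(x) m_α(y) and the common factor a_δ(x) a_δ(y) is cancelled. -/
theorem gMat_mul_opMat {c : ZMod e → ℕ → F} (hc : IsSol q t c) (r n : ℕ) :
    gMat m n c 1 * opMat m n 1 r = (opMat m n (-1) r).transpose * gMat m n c 1 := by
  have h := kernel_selfadjoint (m := m) hc 1 r n
  have hx : ∀ f g : Poly m, ∑ J ∈ IndexSets m r,
      inX (opT 1 t J (alternant (delta m))) * inY (alternant (delta m)) *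
        opTX 1 q J (inX f * inY g) = inX (opE 1 r f) * inY (alternant (delta m) * g) := by
    intro f g
    rw [opE, map_sum, Finset.sum_mul]
    refine Finset.sum_congr rfl fun J _ => ?_
    rw [map_mul, opTX_inX, opTX_inY, map_mul, map_mul]
    ring
  have hy : ∀ f g : Poly m, ∑ J ∈ IndexSets m r,
      inY (opT (-1) t J (alternant (delta m))) * inX (alternant (delta m)) *
        opTY (-1) q J (inX f * inY g) = inX (alternant (delta m) * f) * inY (opE (-1) r g) := by
    intro f g
    rw [opE, map_sum, Finset.mul_sum]
    refine Finset.sum_congr rfl fun J _ => ?_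
    rw [map_mul, opTY_inX, opTY_inY, map_mul, map_mul]
    ring
  -- Both sides of the kernel identity are packaged as linear maps, so that it is enough to evaluate
  -- them on products f(x) g(y).
  obtain ⟨Φ, hΦ⟩ : ∃ Φ : Poly₂ m →ₗ[F] Poly₂ m, ∀ f, Φ f = ∑ J ∈ IndexSets m r,
      inX (opT 1 t J (alternant (delta m))) * inY (alternant (delta m)) * opTX 1 q J f :=
    ⟨∑ J ∈ IndexSets m r, (LinearMap.mulLeft F (inX (opT 1 t J (alternant (delta m))) *
      inY (alternant (delta m)))).comp (opTX 1 q J).toLinearMap, fun f => by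
        simp [LinearMap.sum_apply, mul_assoc]⟩
  obtain ⟨Ψ, hΨ⟩ : ∃ Ψ : Poly₂ m →ₗ[F] Poly₂ m, ∀ f, Ψ f = ∑ J ∈ IndexSets m r,
      inY (opT (-1) t J (alternant (delta m))) * inX (alternant (delta m)) * opTY (-1) q J f :=
    ⟨∑ J ∈ IndexSets m r, (LinearMap.mulLeft F (inY (opT (-1) t J (alternant (delta m))) *
      inX (alternant (delta m)))).comp (opTY (-1) q J).toLinearMap, fun f => by
        simp [LinearMap.sum_apply, mul_assoc]⟩
  rw [← hΦ, ← hΨ] at h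
  have hx' : ∀ f g : Poly m, Φ (inX f * inY g) =
      inX (opE 1 r f) * inY (alternant (delta m) * g) := fun f g => (hΦ _).trans (hx f g)
  have hy' : ∀ f g : Poly m, Ψ (inX f * inY g) =
      inX (alternant (delta m) * f) * inY (opE (-1) r g) := fun f g => (hΨ _).trans (hy f g)
  have hl : Φ (PowerSeries.coeff n (kernel m c 1)) =
      inX (alternant (delta m)) * inY (alternant (delta m)) *
        ∑ α : Zn m n, ∑ β : Zn m n, (gMat m n c 1 * opMat m n 1 r) α β •
          (inX (monSym β.1 : Poly m) * inY (monSym α.1 : Poly m)) := by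
    rw [coeff_kernel_eq_sum, ← sum_smul_mul_left]
    simp only [map_sum, map_smul, hx', opE_monSym_eq, map_mul]
  have hr : Ψ (PowerSeries.coeff n (kernel m c 1)) =
      inX (alternant (delta m)) * inY (alternant (delta m)) *
        ∑ α : Zn m n, ∑ β : Zn m n, ((opMat m n (-1) r).transpose * gMat m n c 1) α β •
          (inX (monSym β.1 : Poly m) * inY (monSym α.1 : Poly m)) := by
    rw [coeff_kernel_eq_sum, ← sum_smul_mul_right]
    simp only [map_sum, map_smul, hy', opE_monSym_eq, map_mul]
  have h0 : inX (alternant (delta m)) * inY (alternant (delta m)) ≠ (0 : Poly₂ m) := by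
    refine mul_ne_zero ?_ ?_
    · exact fun h => alternant_delta_ne_zero
        (MvPolynomial.rename_injective _ Sum.inl_injective (h.trans (map_zero inX).symm))
    · exact fun h => alternant_delta_ne_zero
        (MvPolynomial.rename_injective _ Sum.inr_injective (h.trans (map_zero inY).symm))
  exact matrix_eq_of_sum_eq (mul_left_cancel₀ h0 (hl.symm.trans (h.trans hr)))

end WMac

end

/-! ### The monomial basis and the scalar product -/

noncomputable section

namespace WMac

open Finset

set_option linter.unusedSectionVars false

variable {e : ℕ} [NeZero e] {m : ZMod e → ℕ}

/-! ### The monomial basis -/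

theorem linearIndependent_monSym : LinearIndependent F (monSym : EPart m → Xi m) := by
  rw [linearIndependent_iff']
  intro s g h α hα
  have h1 := congrArg (fun f : Xi m => MvPolynomial.coeff (expo α.1) (f : Poly m)) h
  have h2 : ((∑ i ∈ s, g i • monSym i : Xi m) : Poly m) = ∑ i ∈ s, g i • (monSym i : Poly m) := by
    have := map_sum (Xi m).val (fun i => g i • monSym i) s
    simp only [map_smul] at this
    exact this
  simp only [h2, MvPolynomial.coeff_sum, MvPolynomial.coeff_smul, coeff_monSym] at h1
  rw [Finset.sum_eq_single α] at h1
  · simpa using h1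
  · intro γ _ hne
    rw [if_neg hne, smul_zero]
  · exact fun h => (h hα).elim

theorem homogeneousComponent_mem {f : Poly m} (hf : f ∈ Xi m) (n : ℕ) :
    MvPolynomial.homogeneousComponent n f ∈ Xi m := by
  intro w
  ext μ
  obtain ⟨β, rfl⟩ : ∃ β, expo β = μ := Finsupp.equivFunOnFinite.symm.surjective μ
  have hβ : expo β = (expo (actSeq w⁻¹ β)).mapDomain (toPerm w) := by
    rw [mapDomain_expo, actSeq_mul, mul_inv_cancel]
    rfl
  conv_lhs => rw [hβ]
  rw [actPoly, MvPolynomial.coeff_rename_mapDomain _ (toPerm w).injective,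
    MvPolynomial.coeff_homogeneousComponent, MvPolynomial.coeff_homogeneousComponent,
    coeff_actSeq hf, degree_expo, degree_expo, sum_actSeq]

theorem span_monSym : (⊤ : Submodule F (Xi m)) ≤ Submodule.span F (Set.range monSym) := by
  rintro ⟨f, hf⟩ -
  have h : (⟨f, hf⟩ : Xi m) = ∑ n ∈ range (f.totalDegree + 1),
      ⟨MvPolynomial.homogeneousComponent n f, homogeneousComponent_mem hf n⟩ := by
    apply Subtype.ext
    have := map_sum (Xi m).val (fun n =>
      (⟨MvPolynomial.homogeneousComponent n f, homogeneousComponent_mem hf n⟩ : Xi m))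
      (range (f.totalDegree + 1))
    refine Eq.trans ?_ this.symm
    exact (MvPolynomial.sum_homogeneousComponent f).symm
  rw [h]
  refine Submodule.sum_mem _ fun n _ => ?_
  have h2 : (⟨MvPolynomial.homogeneousComponent n f, homogeneousComponent_mem hf n⟩ : Xi m) =
      ∑ γ : Zn m n, MvPolynomial.coeff (expo γ.1.1) (MvPolynomial.homogeneousComponent n f) •
        monSym γ.1 := by
    apply Subtype.ext
    rw [coe_sum_smul]
    exact eq_sum_monSym (homogeneousComponent_mem hf n)
      (MvPolynomial.homogeneousComponent_isHomogeneous n f)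
  rw [h2]
  exact Submodule.sum_mem _ fun γ _ =>
    Submodule.smul_mem _ _ (Submodule.subset_span (Set.mem_range_self _))

/-- The basis of monomial symmetric polynomials. -/
def monBasis (m : ZMod e → ℕ) : Module.Basis (EPart m) F (Xi m) :=
  Module.Basis.mk linearIndependent_monSym span_monSym

theorem monBasis_apply (α : EPart m) : monBasis m α = monSym α := Module.Basis.mk_apply _ _ _

/-! ### The scalar product -/

/-- The form with given values on the monomial basis. -/
def monForm (N : EPart m → EPart m → F) : Xi m →ₗ[F] Xi m →ₛₗ[conjF] F :=
  (monBasis m).constr F fun α =>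
    -- The values are conjugated inside and the whole functional is conjugated outside: it becomes
    -- conjugate-linear while its values on the basis are as prescribed.
    conjF.toSemilinearMap.comp ((monBasis m).constr F fun β => conjF (N α β))

theorem monForm_monSym (N : EPart m → EPart m → F) (α β : EPart m) :
    monForm N (monSym α) (monSym β) = N α β := by
  rw [← monBasis_apply α, monForm, Module.Basis.constr_basis, LinearMap.comp_apply,
    ← monBasis_apply β, Module.Basis.constr_basis]
  exact conjF_conjF _

theorem gFun_eq_sum {c : ZMod e → ℕ → F} (hc : IsSol q t c) (s : ℤˣ) {n : ℕ} (α : Zn m n) :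
    gFun s α.1 = ∑ γ, gMat m n c s α γ • monSym γ.1 := by
  apply Subtype.ext
  rw [coe_sum_smul, coe_gFun hc, gPoly_eq_sum]

theorem gMat_isUnit_det {c : ZMod e → ℕ → F} (hc : IsSol q t c) (n : ℕ) :
    IsUnit (gMat m n c 1).det := by
  classical
  obtain ⟨G, hG, -⟩ := exists_schurGram (m := m) hc n
  have h := congrArg Matrix.det hG
  rw [schurGramInv, Matrix.det_mul, Matrix.det_mul, Matrix.det_mul, Matrix.det_one] at h
  refine IsUnit.of_mul_eq_one ((schurMat m n F).transpose.det * ((schurMat m n F).det * G.det)) ?_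
  rw [← h]
  ring

theorem map_gFun_left {c : ZMod e → ℕ → F} (hc : IsSol q t c)
    (B : Xi m →ₗ[F] Xi m →ₛₗ[conjF] F) {n : ℕ} (α : Zn m n) (g : Xi m) :
    B (gFun 1 α.1) g = ∑ γ, gMat m n c 1 α γ * B (monSym γ.1) g := by
  rw [gFun_eq_sum hc, map_sum, LinearMap.sum_apply]
  simp only [map_smul, LinearMap.smul_apply, smul_eq_mul]

/-- The coefficients of g_β,− are fixed by conjugation, and transposition rewrites them with the
matrix of g_+; both duality conditions thus involve a single matrix. -/
theorem map_gFun_right {c : ZMod e → ℕ → F} (hc : IsSol q t c)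
    (B : Xi m →ₗ[F] Xi m →ₛₗ[conjF] F) {n : ℕ} (β : Zn m n) (f : Xi m) :
    B f (gFun (-1) β.1) = ∑ γ, B f (monSym γ.1) * gMat m n c 1 γ β := by
  rw [gFun_eq_sum hc, map_sum]
  refine Finset.sum_congr rfl fun γ _ => ?_
  have h : conjF (gMat m n c (-1) β γ) = gMat m n c (-1) β γ := by
    conv_rhs => rw [← gMat_map_conjF hc n (-1), Matrix.map_apply]
  rw [LinearMap.map_smulₛₗ, h, smul_eq_mul, mul_comm, ← gMat_transpose c 1,
    Matrix.transpose_apply]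

-- The first duality condition alone fixes the values on monomials, because the matrix of the g in
-- each degree is invertible.
open Classical in
theorem isScalarProduct_unique {B B' : Xi m →ₗ[F] Xi m →ₛₗ[conjF] F} (h : IsScalarProduct B)
    (h' : IsScalarProduct B') : B = B' := by
  obtain ⟨c, hc⟩ := exists_isSol (e := e) (q := q) t isUnit_one_sub_q_pow
  refine (monBasis m).ext fun α => (monBasis m).ext fun β => ?_
  rw [monBasis_apply, monBasis_apply]
  have h1 : (gMat m (∑ v, α.1 v) c 1).mulVec
      (fun γ => B (monSym γ.1) (monSym β) - B' (monSym γ.1) (monSym β)) = 0 := by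
    funext κ
    have h2 := (h κ.1 β).1.trans (h' κ.1 β).1.symm
    rw [map_gFun_left hc, map_gFun_left hc] at h2
    simp only [Matrix.mulVec, dotProduct, mul_sub, Finset.sum_sub_distrib, Pi.zero_apply]
    rw [h2]
    exact sub_self _
  have h3 := congrArg (gMat m (∑ v, α.1 v) c 1)⁻¹.mulVec h1
  rw [Matrix.mulVec_mulVec, Matrix.nonsing_inv_mul _ (gMat_isUnit_det hc _), Matrix.one_mulVec,
    Matrix.mulVec_zero] at h3
  exact sub_eq_zero.1 (congrFun h3 ⟨α, rfl⟩)

open Classical in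
theorem exists_isScalarProduct (m : ZMod e → ℕ) :
    ∃ B : Xi m →ₗ[F] Xi m →ₛₗ[conjF] F, IsScalarProduct B := by
  obtain ⟨c, hc⟩ := exists_isSol (e := e) (q := q) t isUnit_one_sub_q_pow
  -- In each degree the Gram matrix has to be the inverse of the matrix of the g; distinct degrees
  -- are made orthogonal. A two-sided inverse gives both duality conditions.
  let N : EPart m → EPart m → F := fun α β =>
    if h : ∑ v, β.1 v = ∑ v, α.1 v then (gMat m (∑ v, α.1 v) c 1)⁻¹ ⟨α, rfl⟩ ⟨β, h⟩ else 0
  have hN : ∀ (n : ℕ) (α β : Zn m n), N α.1 β.1 = (gMat m n c 1)⁻¹ α β := by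
    rintro n ⟨α, rfl⟩ ⟨β, hβ⟩
    exact dif_pos hβ
  have hN0 : ∀ α β : EPart m, ∑ v, β.1 v ≠ ∑ v, α.1 v → N α β = 0 := fun α β h => dif_neg h
  refine ⟨monForm N, fun α β => ⟨?_, ?_⟩⟩
  · have h1 := map_gFun_left hc (monForm N) (⟨α, rfl⟩ : Zn m _) (monSym β)
    simp only [monForm_monSym] at h1
    rw [h1]
    by_cases hβ : ∑ v, β.1 v = ∑ v, α.1 v
    · have h2 := congrFun (congrFun (Matrix.mul_nonsing_inv _
        (gMat_isUnit_det (m := m) hc (∑ v, α.1 v))) ⟨α, rfl⟩) ⟨β, hβ⟩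
      rw [Matrix.mul_apply, Matrix.one_apply] at h2
      simp only [← hN] at h2
      rw [h2]
      simp only [Subtype.mk.injEq]
    · rw [if_neg (fun h => hβ (by rw [h]))]
      refine Finset.sum_eq_zero fun γ _ => ?_
      rw [hN0 _ _ (by rwa [γ.2]), mul_zero]
  · have h1 := map_gFun_right hc (monForm N) (⟨β, rfl⟩ : Zn m _) (monSym α)
    simp only [monForm_monSym] at h1
    rw [h1]
    by_cases hα : ∑ v, α.1 v = ∑ v, β.1 v
    · have h2 := congrFun (congrFun (Matrix.nonsing_inv_mul _
        (gMat_isUnit_det (m := m) hc (∑ v, β.1 v))) ⟨α, hα⟩) ⟨β, rfl⟩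
      rw [Matrix.mul_apply, Matrix.one_apply] at h2
      simp only [← hN] at h2
      rw [h2]
      simp only [Subtype.mk.injEq]
    · rw [if_neg (fun h => hα (by rw [h]))]
      refine Finset.sum_eq_zero fun γ _ => ?_
      rw [hN0 _ _ (by rw [γ.2]; exact fun h => hα h.symm), zero_mul]

/-- The Gram matrix of the monomial basis. -/
def monGram (n : ℕ) (B : Xi m →ₗ[F] Xi m →ₛₗ[conjF] F) : Matrix (Zn m n) (Zn m n) F :=
  Matrix.of fun α β => B (monSym α.1) (monSym β.1)

theorem gMat_mul_monGram {c : ZMod e → ℕ → F} (hc : IsSol q t c)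
    {B : Xi m →ₗ[F] Xi m →ₛₗ[conjF] F} (hB : IsScalarProduct B) (n : ℕ) :
    gMat m n c 1 * monGram n B = 1 := by
  ext α β
  rw [Matrix.mul_apply]
  simp only [monGram, Matrix.of_apply]
  rw [← map_gFun_left hc, (hB α.1 β.1).1, Matrix.one_apply]
  simp only [Subtype.ext_iff]

theorem map_sum_smul_sum_smul (B : Xi m →ₗ[F] Xi m →ₛₗ[conjF] F) {n : ℕ}
    (a b : Zn m n → F) (f g : Zn m n → Xi m) :
    B (∑ γ, a γ • f γ) (∑ κ, b κ • g κ) = ∑ κ, (∑ γ, a γ * B (f γ) (g κ)) * conjF (b κ) := by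
  rw [map_sum]
  refine Finset.sum_congr rfl fun κ _ => ?_
  rw [LinearMap.map_smulₛₗ, smul_eq_mul, mul_comm, map_sum, LinearMap.sum_apply]
  simp only [map_smul, LinearMap.smul_apply, smul_eq_mul]

-- The Gram matrix of the Schur functions is the inverse of `schurGramInv`, so it is the matrix G
-- whose principal minors were shown to be nonzero.
open Classical in
theorem schurXi_gram_det_ne_zero {B : Xi m →ₗ[F] Xi m →ₛₗ[conjF] F} (hB : IsScalarProduct B)
    {n : ℕ} (p : Zn m n → Prop) :
    (Matrix.of fun α β : {α // p α} => B (schurXi α.1) (schurXi β.1)).det ≠ 0 := by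
  obtain ⟨c, hc⟩ := exists_isSol (e := e) (q := q) t isUnit_one_sub_q_pow
  obtain ⟨G, hG, hp⟩ := exists_schurGram (m := m) hc n
  have h1 : (Matrix.of fun α β : Zn m n => B (schurXi α) (schurXi β)) =
      schurToMon m n * monGram n B * (schurToMon m n).transpose := by
    ext α β
    rw [Matrix.of_apply, schurXi, schurXi, map_sum_smul_sum_smul, Matrix.mul_apply]
    refine Finset.sum_congr rfl fun κ _ => ?_
    rw [Matrix.mul_apply, Matrix.transpose_apply]
    congr 1
    exact congrFun (congrFun (schurToMon_map_conjF n) β) κ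
  have h2 : (schurToMon m n * monGram n B * (schurToMon m n).transpose) * schurGramInv m n c =
      1 := by
    have h3 : (schurToMon m n).transpose * (schurMat m n F).transpose = 1 := by
      rw [← Matrix.transpose_mul, mul_schurToMon, Matrix.transpose_one]
    have h4 : monGram n B * gMat m n c 1 = 1 := mul_eq_one_comm.1 (gMat_mul_monGram hc hB n)
    calc _ = schurToMon m n * (monGram n B * ((schurToMon m n).transpose *
          (schurMat m n F).transpose) * gMat m n c 1) * schurMat m n F := by
            simp only [schurGramInv, Matrix.mul_assoc]
      _ = 1 := by rw [h3, Matrix.mul_one, h4, Matrix.mul_one, schurToMon_mul]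
  have h5 : (Matrix.of fun α β : Zn m n => B (schurXi α) (schurXi β)) = G := by
    rw [h1]
    exact left_inv_eq_right_inv h2 hG
  have h6 := hp p
  rw [← h5] at h6
  exact h6

end WMac

end

/-! ### Orthogonalisation, Macdonald functions and the action of the operators -/

noncomputable section

namespace WMac

open Finset

set_option linter.unusedSectionVars false

/-! ### Orthogonalization with respect to a preorder -/

section Orthogonalization

variable {K V ι : Type*} [Field K] [AddCommGroup V] [Module K V] [Fintype ι] [DecidableEq ι]
  {σ τ : K →+* K}

/-- The span of the members of a family with index in a given set. -/
def famSpan (K : Type*) {V ι : Type*} [Field K] [AddCommGroup V] [Module K V] (S : ι → V)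
    (p : ι → Prop) : Submodule K V :=
  Submodule.span K (Set.range fun i : {i // p i} => S i.1)

theorem mem_famSpan_of {S : ι → V} {p : ι → Prop} {i : ι} (h : p i) : S i ∈ famSpan K S p :=
  Submodule.subset_span ⟨⟨i, h⟩, rfl⟩

theorem famSpan_le {S : ι → V} {p : ι → Prop} {W : Submodule K V} (h : ∀ i, p i → S i ∈ W) :
    famSpan K S p ≤ W := by
  refine Submodule.span_le.2 ?_
  rintro _ ⟨⟨i, hi⟩, rfl⟩
  exact h i hi

theorem map_famSpan_eq_zero (f : V →ₛₗ[τ] K) {S : ι → V} {p : ι → Prop}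
    (h : ∀ i, p i → f (S i) = 0) {x : V} (hx : x ∈ famSpan K S p) : f x = 0 := by
  have : famSpan K S p ≤ LinearMap.ker f := famSpan_le h
  exact this hx

open Classical in
theorem eq_zero_of_mem_famSpan (B : V →ₛₗ[σ] V →ₛₗ[τ] K) {S : ι → V} {p : ι → Prop}
    (hdet : (Matrix.of fun i j : {i // p i} => B (S i.1) (S j.1)).det ≠ 0) {x : V}
    (hx : x ∈ famSpan K S p) (h : ∀ j, p j → B x (S j) = 0) : x = 0 := by
  obtain ⟨u, rfl⟩ := (Submodule.mem_span_range_iff_exists_fun K).1 hx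
  have h1 : Matrix.vecMul (fun i => σ (u i))
      (Matrix.of fun i j : {i // p i} => B (S i.1) (S j.1)) = 0 := by
    funext j
    have h2 := h j.1 j.2
    rw [map_sum, LinearMap.sum_apply] at h2
    simp only [LinearMap.map_smulₛₗ, LinearMap.smul_apply, smul_eq_mul] at h2
    exact h2
  have h3 := Matrix.eq_zero_of_vecMul_eq_zero hdet h1
  refine Finset.sum_eq_zero fun i _ => ?_
  have h4 : u i = 0 := σ.injective ((congrFun h3 i).trans (map_zero σ).symm)
  rw [h4, zero_smul]

-- The correction of z solves a linear system with the given Gram matrix. Its coefficients are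
-- passed through σ, an involution, so that the same statement serves B and its flip, which is
-- conjugate-linear in the first argument.
open Classical in
theorem exists_orthogonal (hσ : ∀ a, σ (σ a) = a) (B : V →ₛₗ[σ] V →ₛₗ[τ] K) {S : ι → V}
    {p : ι → Prop} (hdet : (Matrix.of fun i j : {i // p i} => B (S i.1) (S j.1)).det ≠ 0) (z : V) :
    ∃ x, x - z ∈ famSpan K S p ∧ ∀ y ∈ famSpan K S p, B x y = 0 := by
  set M := Matrix.of fun i j : {i // p i} => B (S i.1) (S j.1) with hM
  let w : {i // p i} → K := Matrix.vecMul (fun j => -B z (S j.1)) M⁻¹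
  have hw : Matrix.vecMul w M = fun j => -B z (S j.1) := by
    rw [Matrix.vecMul_vecMul, Matrix.nonsing_inv_mul _ (isUnit_iff_ne_zero.2 hdet),
      Matrix.vecMul_one]
  refine ⟨z + ∑ i, σ (w i) • S i.1, ?_, ?_⟩
  · rw [add_sub_cancel_left]
    exact Submodule.sum_mem _ fun i _ => Submodule.smul_mem _ _ (mem_famSpan_of i.2)
  · intro y hy
    refine map_famSpan_eq_zero _ (fun j hj => ?_) hy
    have h1 := congrFun hw ⟨j, hj⟩
    simp only [Matrix.vecMul, dotProduct, hM, Matrix.of_apply] at h1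
    rw [map_add, map_sum, LinearMap.add_apply, LinearMap.sum_apply]
    simp only [LinearMap.map_smulₛₗ, LinearMap.smul_apply, smul_eq_mul, hσ]
    rw [h1, add_neg_cancel]

/-- The Q_j are unitriangular in the S_j, so orthogonality to all lower Q_j gives orthogonality to
all lower S_j by well-founded induction. -/
theorem orthogonal_famSpan (B : V →ₛₗ[σ] V →ₛₗ[τ] K) {S P Q : ι → V} {L : ι → ι → Prop}
    (hwf : WellFounded L) (htrans : ∀ {i j k}, L i j → L j k → L i k)
    (hQ : ∀ i, Q i - S i ∈ famSpan K S fun j => L j i) (i : ι)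
    (hPQ : ∀ j, L j i → B (P i) (Q j) = 0) {y : V} (hy : y ∈ famSpan K S fun j => L j i) :
    B (P i) y = 0 := by
  refine map_famSpan_eq_zero _ (fun j hj => ?_) hy
  induction j using hwf.induction with
  | _ j ih =>
    have h1 : B (P i) (Q j - S j) = 0 :=
      map_famSpan_eq_zero _ (fun k hk => ih k hk (htrans hk hj)) (hQ j)
    rw [map_sub, hPQ j hj, zero_sub, neg_eq_zero] at h1
    exact h1

end Orthogonalization

variable {e : ℕ} [NeZero e] {m : ZMod e → ℕ} {n : ℕ} {prec : Zn m n → Zn m n → Prop}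

/-! ### Existence and uniqueness of the Macdonald functions -/

/-- The span of the Schur functions of lower families. -/
def lowSpan (prec : Zn m n → Zn m n → Prop) (α : Zn m n) : Submodule F (Xi m) :=
  famSpan F schurXi fun β => Low prec β α

theorem lowSpan_mono (h : IsAdmissible prec) {α β : Zn m n}
    (hl : Low prec β α ∨ Similar β α) : lowSpan prec β ≤ lowSpan prec α :=
  famSpan_le fun _ hγ => mem_famSpan_of
    (hl.elim (fun h' => h.low_trans hγ h') fun h' => h.low_congr_right h' hγ)

theorem expansion_iff (x : Xi m) (α : Zn m n) :
    (∃ u : Zn m n → F, (∀ β, ¬ (prec β α ∧ ¬ Similar β α) → u β = 0) ∧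
      toRat x = schur α.1 + ∑ β, u β • schur β.1) ↔ x - schurXi α ∈ lowSpan prec α := by
  classical
  constructor
  · rintro ⟨u, hu, hx⟩
    have h1 : x - schurXi α = ∑ β, u β • schurXi β := by
      rw [sub_eq_iff_eq_add']
      refine toRat_injective (hx.trans ?_)
      rw [← toRatLin_apply (_ + _), map_add, map_sum]
      simp only [map_smul, toRatLin_apply, toRat_schurXi]
    rw [h1]
    refine Submodule.sum_mem _ fun β _ => ?_
    by_cases hβ : Low prec β α
    · exact Submodule.smul_mem _ _ (mem_famSpan_of hβ)
    · rw [hu β hβ, zero_smul]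
      exact Submodule.zero_mem _
  · intro h
    obtain ⟨u, hu⟩ := (Submodule.mem_span_range_iff_exists_fun F).1 h
    refine ⟨fun β => if hβ : Low prec β α then u ⟨β, hβ⟩ else 0, fun β hβ => dif_neg hβ, ?_⟩
    rw [eq_sub_iff_add_eq'] at hu
    rw [← hu, ← toRatLin_apply, map_add, map_sum]
    simp only [map_smul, toRatLin_apply, toRat_schurXi]
    congr 1
    rw [← Finset.sum_subset (Finset.subset_univ (univ.filter fun β => Low prec β α)),
      Finset.sum_subtype (univ.filter fun β => Low prec β α) (p := fun β => Low prec β α) (by simp)]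
    · exact Finset.sum_congr rfl fun β _ => by rw [dif_pos β.2]
    · intro β _ hβ
      rw [dif_neg (by simpa using hβ), zero_smul]

open Classical in
theorem flip_gram_det_ne_zero {B : Xi m →ₗ[F] Xi m →ₛₗ[conjF] F} (hB : IsScalarProduct B)
    (p : Zn m n → Prop) :
    (Matrix.of fun α β : {α // p α} => B.flip (schurXi α.1) (schurXi β.1)).det ≠ 0 := by
  have h := schurXi_gram_det_ne_zero hB p
  rw [← Matrix.det_transpose] at h
  exact h

/-- Each P_α^± is the Schur function corrected to be orthogonal to all lower Schur functions, on the
left for + and on the right for −. For two different families one is lower, and the corresponding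
orthogonality gives condition (ii). -/
theorem exists_isMacdonald (h : IsAdmissible prec) {B : Xi m →ₗ[F] Xi m →ₛₗ[conjF] F}
    (hB : IsScalarProduct B) : ∃ P, IsMacdonald prec B P := by
  choose P₁ hP₁ hP₁' using fun α : Zn m n => exists_orthogonal (fun _ => rfl) B
    (schurXi_gram_det_ne_zero hB fun β => Low prec β α) (schurXi α)
  choose P₂ hP₂ hP₂' using fun α : Zn m n => exists_orthogonal conjF_conjF B.flip
    (flip_gram_det_ne_zero hB fun β => Low prec β α) (schurXi α)
  have hlow : ∀ {P : Zn m n → Xi m}, (∀ α, P α - schurXi α ∈ lowSpan prec α) →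
      ∀ {α β}, Low prec β α → P β ∈ lowSpan prec α := by
    intro P hP α β hβ
    rw [← sub_add_cancel (P β) (schurXi β)]
    exact Submodule.add_mem _ (lowSpan_mono h (Or.inl hβ) (hP β)) (mem_famSpan_of hβ)
  refine ⟨fun s => if s = 1 then P₁ else P₂, ⟨fun s α => ?_, fun α β hαβ => ?_⟩⟩
  · rw [expansion_iff]
    split_ifs
    · exact hP₁ α
    · exact hP₂ α
  · rw [if_pos rfl, if_neg (by decide)]
    rcases h.low_or_similar_or_low α β with hl | hl | hl
    · exact hP₂' β _ (hlow hP₁ hl)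
    · exact (hαβ hl).elim
    · exact hP₁' α _ (hlow hP₂ hl)

theorem IsMacdonald.sub_mem {B : Xi m →ₗ[F] Xi m →ₛₗ[conjF] F} {P : ℤˣ → Zn m n → Xi m}
    (hP : IsMacdonald prec B P) (s : ℤˣ) (α : Zn m n) :
    P s α - schurXi α ∈ lowSpan prec α :=
  (expansion_iff _ _).1 (hP.expansion s α)

theorem IsMacdonald.orthogonal_left (h : IsAdmissible prec)
    {B : Xi m →ₗ[F] Xi m →ₛₗ[conjF] F} {P : ℤˣ → Zn m n → Xi m}
    (hP : IsMacdonald prec B P) (α : Zn m n) {y : Xi m} (hy : y ∈ lowSpan prec α) :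
    B (P 1 α) y = 0 :=
  orthogonal_famSpan B h.wf_low h.low_trans (hP.sub_mem (-1)) α
    (fun β hβ => hP.orthogonal α β fun hs => hβ.2 hs.symm) hy

theorem IsMacdonald.orthogonal_right (h : IsAdmissible prec)
    {B : Xi m →ₗ[F] Xi m →ₛₗ[conjF] F} {P : ℤˣ → Zn m n → Xi m}
    (hP : IsMacdonald prec B P) (α : Zn m n) {y : Xi m} (hy : y ∈ lowSpan prec α) :
    B.flip (P (-1) α) y = 0 :=
  orthogonal_famSpan B.flip h.wf_low h.low_trans (hP.sub_mem 1) α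
    (fun β hβ => hP.orthogonal β α fun hs => hβ.2 hs) hy

/-- The difference of two candidates lies in the lower span and is orthogonal to it, and the form is
nondegenerate there. -/
theorem IsMacdonald.unique (h : IsAdmissible prec) {B : Xi m →ₗ[F] Xi m →ₛₗ[conjF] F}
    (hB : IsScalarProduct B) {P P' : ℤˣ → Zn m n → Xi m} (hP : IsMacdonald prec B P)
    (hP' : IsMacdonald prec B P') : P = P' := by
  have hsub : ∀ s α, P s α - P' s α ∈ lowSpan prec α := fun s α => by
    have := Submodule.sub_mem _ (hP.sub_mem s α) (hP'.sub_mem s α)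
    rwa [sub_sub_sub_cancel_right] at this
  funext s α
  rw [← sub_eq_zero]
  rcases Int.units_eq_one_or s with rfl | rfl
  · refine eq_zero_of_mem_famSpan B (schurXi_gram_det_ne_zero hB _) (hsub 1 α) fun β hβ => ?_
    rw [map_sub, LinearMap.sub_apply, hP.orthogonal_left h α (mem_famSpan_of hβ),
      hP'.orthogonal_left h α (mem_famSpan_of hβ), sub_zero]
  · refine eq_zero_of_mem_famSpan B.flip (flip_gram_det_ne_zero hB _) (hsub (-1) α) fun β hβ => ?_
    rw [map_sub, LinearMap.sub_apply, hP.orthogonal_right h α (mem_famSpan_of hβ),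
      hP'.orthogonal_right h α (mem_famSpan_of hβ), sub_zero]

/-! ### The Macdonald operators on symmetric polynomials -/

theorem opD_sum (s : ℤˣ) (r : ℕ) (a : Zn m n → F) :
    opD s r ((∑ α, a α • monSym α.1 : Xi m) : Poly m) =
      toRat (∑ α, a α • ∑ β, opMat m n s r α β • monSym β.1) := by
  have h0 : algebraMap (Poly m) (RatFn m) (alternant (delta m)) ≠ 0 := by
    rw [Ne, IsFractionRing.to_map_eq_zero_iff]
    exact alternant_delta_ne_zero
  rw [opD_eq, inv_mul_eq_iff_eq_mul₀ h0, coe_sum_smul, opE_sum, toRat, ← map_mul, coe_sum_smul]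
  simp only [opE_monSym_eq, coe_sum_smul, ← mul_smul_comm, ← Finset.mul_sum]

theorem opD_monSym (s : ℤˣ) (r : ℕ) (α : Zn m n) :
    opD s r (monSym α.1 : Poly m) = toRat (∑ β, opMat m n s r α β • monSym β.1) := by
  classical
  have h := opD_sum (m := m) s r (Pi.single α 1 : Zn m n → F)
  simpa [Pi.single_apply, ite_smul] using h

theorem isMonomialMatrix_iff (s : ℤˣ) (r : ℕ) (b : Zn m n → Zn m n → F) :
    IsMonomialMatrix s r b ↔ b = opMat m n s r := by
  have h1 : ∀ a : Zn m n → F, ∑ β, a β • toRat (monSym β.1) = toRat (∑ β, a β • monSym β.1) := by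
    intro a
    rw [← toRatLin_apply (∑ β, a β • monSym β.1), map_sum]
    simp only [map_smul, toRatLin_apply]
  constructor
  · intro h
    funext α β
    have h2 := h α
    rw [opD_monSym, h1] at h2
    have h3 := congrArg (fun f : Xi m => (monBasis m).repr f β.1) (toRat_injective h2)
    simp only [map_sum, map_smul, ← monBasis_apply, Module.Basis.repr_self,
      Finsupp.coe_finsetSum, Finset.sum_apply, Finsupp.smul_apply, Finsupp.single_apply,
      ← Subtype.ext_iff] at h3
    simpa using h3.symm
  · rintro rfl α
    rw [opD_monSym, h1]

open Classical in
/-- The operator on symmetric polynomials that extends a Macdonald operator in degree `n`. -/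
def opXi (m : ZMod e → ℕ) (n : ℕ) (s : ℤˣ) (r : ℕ) : Xi m →ₗ[F] Xi m :=
  (monBasis m).constr F fun α =>
    if h : ∑ v, α.1 v = n then ∑ β, opMat m n s r ⟨α, h⟩ β • monSym β.1 else 0

theorem opXi_monSym (s : ℤˣ) (r : ℕ) (α : Zn m n) :
    opXi m n s r (monSym α.1) = ∑ β, opMat m n s r α β • monSym β.1 := by
  rw [← monBasis_apply, opXi, Module.Basis.constr_basis, dif_pos α.2]

/-- The span of the monomial symmetric polynomials of degree `n`. -/
def degSpan (m : ZMod e → ℕ) (n : ℕ) : Submodule F (Xi m) :=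
  Submodule.span F (Set.range fun α : Zn m n => monSym α.1)

theorem schurXi_mem_degSpan (α : Zn m n) : schurXi α ∈ degSpan m n :=
  Submodule.sum_mem _ fun β _ => Submodule.smul_mem _ _ (Submodule.subset_span ⟨β, rfl⟩)

theorem lowSpan_le_degSpan (α : Zn m n) : lowSpan prec α ≤ degSpan m n :=
  famSpan_le fun β _ => schurXi_mem_degSpan β

theorem opD_eq_opXi (s : ℤˣ) (r : ℕ) {f : Xi m} (hf : f ∈ degSpan m n) :
    opD s r (f : Poly m) = toRat (opXi m n s r f) := by
  obtain ⟨a, rfl⟩ := (Submodule.mem_span_range_iff_exists_fun F).1 hf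
  rw [opD_sum, map_sum]
  simp only [map_smul, opXi_monSym]

theorem opXi_monSym_eq_schurXi (s : ℤˣ) (r : ℕ) (α : Zn m n) :
    opXi m n s r (monSym α.1) = ∑ κ, opSchurMatrix s r α κ • schurXi κ := by
  rw [opXi_monSym]
  simp only [schurXi, Finset.smul_sum, smul_smul]
  rw [Finset.sum_comm]
  refine Finset.sum_congr rfl fun β _ => ?_
  rw [opMat, Matrix.mul_apply, Finset.sum_smul]
  rfl

theorem opXi_schurXi (s : ℤˣ) (r : ℕ) (α : Zn m n) :
    opXi m n s r (schurXi α) =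
      ∑ κ, (∑ β, schurToMon m n α β * opSchurMatrix s r β κ) • schurXi κ := by
  rw [schurXi, map_sum]
  simp only [map_smul, opXi_monSym_eq_schurXi, Finset.smul_sum, smul_smul, Finset.sum_smul]
  rw [Finset.sum_comm]

theorem schurXi_sub_monSym_mem (h : IsAdmissible prec) (α : Zn m n) :
    monSym α.1 - schurXi α ∈ lowSpan prec α := by
  classical
  rw [monSym_eq_sum_schurXi, ← Finset.sum_erase_add _ _ (Finset.mem_univ α),
    schurMat_eq h (fun hl => h.irrefl _ hl.1), if_pos rfl, one_smul, add_sub_cancel_right]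
  refine Submodule.sum_mem _ fun β hβ => ?_
  by_cases hl : Low prec β α
  · exact Submodule.smul_mem _ _ (mem_famSpan_of hl)
  · rw [schurMat_eq h hl, if_neg (Finset.ne_of_mem_erase hβ).symm, zero_smul]
    exact Submodule.zero_mem _

theorem opXi_mem_lowSpan (h : IsAdmissible prec) (s : ℤˣ) (r : ℕ) (α : Zn m n) {f : Xi m}
    (hf : f ∈ lowSpan prec α) : opXi m n s r f ∈ lowSpan prec α := by
  have : lowSpan prec α ≤ (lowSpan prec α).comap (opXi m n s r) := famSpan_le fun β hβ => by
    rw [Submodule.mem_comap, opXi_schurXi]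
    refine Submodule.sum_mem _ fun κ _ => ?_
    by_cases hκ : Low prec κ α
    · exact Submodule.smul_mem _ _ (mem_famSpan_of hκ)
    · rw [Finset.sum_eq_zero, zero_smul]
      · exact Submodule.zero_mem _
      intro γ _
      by_cases hγ : Low prec γ β ∨ γ = β
      · have hγα : Low prec γ α := hγ.elim (fun h' => h.low_trans h' hβ) fun h' => h' ▸ hβ
        rw [opSchurMatrix_eq_zero s r h, mul_zero]
        · exact fun h' => hκ (h.low_trans h' hγα)
        · exact fun h' => hκ (h.low_congr_left h' hγα)
      · rw [not_or] at hγ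
        rw [schurToMon_eq h hγ.1, if_neg (fun h' => hγ.2 h'.symm), zero_mul]
  exact this hf

/-- The Gram matrix inverts the matrix of the kernel, so the kernel identity becomes an identity
between D_+ and the transpose of D_−; no conjugate appears since the operator matrices are fixed by
conjugation. -/
theorem opXi_adjoint {B : Xi m →ₗ[F] Xi m →ₛₗ[conjF] F} (hB : IsScalarProduct B) (r : ℕ)
    {f g : Xi m} (hf : f ∈ degSpan m n) (hg : g ∈ degSpan m n) :
    B (opXi m n 1 r f) g = B f (opXi m n (-1) r g) := by
  classical
  obtain ⟨c, hc⟩ := exists_isSol (e := e) (q := q) t isUnit_one_sub_q_pow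
  have h1 := gMat_mul_monGram hc hB n
  have h2 : monGram n B * gMat m n c 1 = 1 := mul_eq_one_comm.1 h1
  have h3 : opMat m n 1 r * monGram n B = monGram n B * (opMat m n (-1) r).transpose := by
    calc _ = monGram n B * (gMat m n c 1 * opMat m n 1 r) * monGram n B := by
          rw [← Matrix.mul_assoc, h2, Matrix.one_mul]
      _ = _ := by rw [gMat_mul_opMat hc, Matrix.mul_assoc, Matrix.mul_assoc, h1, Matrix.mul_one]
  have h4 : ∀ α β : Zn m n, B (opXi m n 1 r (monSym α.1)) (monSym β.1) =
      B (monSym α.1) (opXi m n (-1) r (monSym β.1)) := by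
    intro α β
    rw [opXi_monSym, opXi_monSym, map_sum, map_sum, LinearMap.sum_apply]
    have h5 := congrFun (congrFun h3 α) β
    rw [Matrix.mul_apply, Matrix.mul_apply] at h5
    simp only [map_smul, LinearMap.smul_apply, LinearMap.map_smulₛₗ, smul_eq_mul]
    refine Eq.trans h5 (Finset.sum_congr rfl fun γ _ => ?_)
    rw [mul_comm]
    congr 1
    exact (congrFun (congrFun (opMat_map_conjF (-1) r n) β) γ).symm
  have h6 : ∀ α : Zn m n, ∀ g ∈ degSpan m n, B (opXi m n 1 r (monSym α.1)) g =
      B (monSym α.1) (opXi m n (-1) r g) := by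
    intro α g hg
    induction hg using Submodule.span_induction with
    | mem x hx =>
      obtain ⟨β, rfl⟩ := hx
      exact h4 α β
    | zero => simp only [map_zero]
    | add x y _ _ hx hy => simp only [map_add, hx, hy]
    | smul a x _ hx =>
      rw [LinearMap.map_smulₛₗ, map_smul (opXi m n (-1) r), LinearMap.map_smulₛₗ, hx]
  induction hf using Submodule.span_induction with
  | mem x hx =>
    obtain ⟨α, rfl⟩ := hx
    exact h6 α g hg
  | zero => simp only [map_zero, LinearMap.zero_apply]
  | add x y _ _ hx hy => simp only [map_add, LinearMap.add_apply, hx, hy]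
  | smul a x _ hx => simp only [map_smul, LinearMap.smul_apply, hx]

open Classical in
theorem opXi_eq_sum {σ τ : F →+* F} (B : Xi m →ₛₗ[σ] Xi m →ₛₗ[τ] F) (h : IsAdmissible prec)
    (hdet : ∀ p : Zn m n → Prop,
      (Matrix.of fun α β : {α // p α} => B (schurXi α.1) (schurXi β.1)).det ≠ 0)
    {P : Zn m n → Xi m} (hP : ∀ α, P α - schurXi α ∈ lowSpan prec α)
    (hP0 : ∀ α, ∀ y ∈ lowSpan prec α, B (P α) y = 0) {s : ℤˣ} {r : ℕ}
    (hadj : ∀ f ∈ degSpan m n, ∀ g ∈ degSpan m n,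
      B (opXi m n s r f) g = B f (opXi m n (-s) r g)) (α : Zn m n) :
    opXi m n s r (P α) = ∑ β with Similar β α, opMat m n s r α β • P β := by
  have hsim : ∀ {β}, Similar β α → lowSpan prec β = lowSpan prec α := fun hs =>
    le_antisymm (lowSpan_mono h (Or.inr hs)) (lowSpan_mono h (Or.inr hs.symm))
  have hPM : ∀ β, P β - monSym β.1 ∈ lowSpan prec β := fun β => by
    have := Submodule.sub_mem _ (hP β) (schurXi_sub_monSym_mem h β)
    rwa [sub_sub_sub_cancel_right] at this
  have hMlow : ∀ {β}, Low prec β α → monSym β.1 ∈ lowSpan prec α := fun {β} hβ => by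
    rw [← sub_add_cancel (monSym β.1) (schurXi β)]
    exact Submodule.add_mem _ (lowSpan_mono h (Or.inl hβ) (schurXi_sub_monSym_mem h β))
      (mem_famSpan_of hβ)
  have hPdeg : P α ∈ degSpan m n := by
    rw [← sub_add_cancel (P α) (schurXi α)]
    exact Submodule.add_mem _ (lowSpan_le_degSpan α (hP α)) (schurXi_mem_degSpan α)
  rw [← sub_eq_zero]
  refine eq_zero_of_mem_famSpan B (hdet fun β => Low prec β α) ?_ fun β hβ => ?_
  -- Modulo the lower span, P_β may be replaced by m_β and only the indices in the family of α
  -- survive in D m_α, so the difference lies in the lower span.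
  · have h1 := opXi_mem_lowSpan h s r α (hPM α)
    rw [map_sub, opXi_monSym,
      ← Finset.sum_filter_add_sum_filter_not univ fun β => Similar β α] at h1
    have h2 : ∑ β with ¬ Similar β α, opMat m n s r α β • monSym β.1 ∈ lowSpan prec α := by
      refine Submodule.sum_mem _ fun β hβ => ?_
      by_cases hl : Low prec β α
      · exact Submodule.smul_mem _ _ (hMlow hl)
      · rw [opMat_eq_zero s r h hl (Finset.mem_filter.1 hβ).2, zero_smul]
        exact Submodule.zero_mem _
    have h3 : ∑ β with Similar β α, opMat m n s r α β • (P β - monSym β.1) ∈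
        lowSpan prec α := by
      refine Submodule.sum_mem _ fun β hβ => Submodule.smul_mem _ _ ?_
      rw [← hsim (Finset.mem_filter.1 hβ).2]
      exact hPM β
    have h4 := Submodule.sub_mem _ (Submodule.add_mem _ h1 h2) h3
    simp only [smul_sub, Finset.sum_sub_distrib] at h4
    rwa [sub_add_eq_sub_sub, sub_add_cancel, sub_sub_sub_cancel_right] at h4
  -- The adjoint operator keeps the Schur function of β in the lower span, to which P_α and all P_κ
  -- with κ ∼ α are orthogonal.
  · rw [map_sub, LinearMap.sub_apply, map_sum, LinearMap.sum_apply,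
      hadj _ hPdeg _ (schurXi_mem_degSpan β),
      hP0 α _ (opXi_mem_lowSpan h (-s) r α (mem_famSpan_of hβ)), zero_sub, neg_eq_zero]
    refine Finset.sum_eq_zero fun κ hκ => ?_
    rw [LinearMap.map_smulₛₗ, LinearMap.smul_apply,
      hP0 κ _ (by rw [hsim (Finset.mem_filter.1 hκ).2]; exact mem_famSpan_of hβ), smul_zero]

open Classical in
theorem IsMacdonald.opD_eq_sum (h : IsAdmissible prec) {B : Xi m →ₗ[F] Xi m →ₛₗ[conjF] F}
    (hB : IsScalarProduct B) {P : ℤˣ → Zn m n → Xi m} (hP : IsMacdonald prec B P) (s : ℤˣ)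
    (r : ℕ) (α : Zn m n) :
    opD s r (P s α : Poly m) =
      ∑ β : Zn m n with Similar β α, opMat m n s r α β • toRat (P s β) := by
  have h1 : opXi m n s r (P s α) = ∑ β with Similar β α, opMat m n s r α β • P s β := by
    rcases Int.units_eq_one_or s with rfl | rfl
    · exact opXi_eq_sum B h (schurXi_gram_det_ne_zero hB) (hP.sub_mem 1)
        (fun α y hy => hP.orthogonal_left h α hy) (fun f hf g hg => opXi_adjoint hB r hf hg) α
    · refine opXi_eq_sum B.flip h (flip_gram_det_ne_zero hB) (hP.sub_mem (-1))
        (fun α y hy => hP.orthogonal_right h α hy) (fun f hf g hg => ?_) α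
      rw [neg_neg]
      exact (opXi_adjoint hB r hg hf).symm
  have hdeg : P s α ∈ degSpan m n := by
    rw [← sub_add_cancel (P s α) (schurXi α)]
    exact Submodule.add_mem _ (lowSpan_le_degSpan α (hP.sub_mem s α)) (schurXi_mem_degSpan α)
  rw [opD_eq_opXi s r hdeg, h1, ← toRatLin_apply, map_sum]
  simp only [map_smul, toRatLin_apply]

end WMac

end

open Classical in
theorem proposition2p7 {e : ℕ} [NeZero e] (m : ZMod e → ℕ) (hm : ∀ k, 0 < m k) (n : ℕ)
    (prec : WMac.Zn m n → WMac.Zn m n → Prop) (hprec : WMac.IsAdmissible prec) :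
    (∃! B : WMac.Xi m →ₗ[WMac.F] WMac.Xi m →ₛₗ[WMac.conjF] WMac.F, WMac.IsScalarProduct B) ∧
    ∀ B : WMac.Xi m →ₗ[WMac.F] WMac.Xi m →ₛₗ[WMac.conjF] WMac.F, WMac.IsScalarProduct B →
      (∃! P : ℤˣ → WMac.Zn m n → WMac.Xi m, WMac.IsMacdonald prec B P) ∧
      ∀ P : ℤˣ → WMac.Zn m n → WMac.Xi m, WMac.IsMacdonald prec B P →
        ∀ (s : ℤˣ) (r : ℕ), 1 ≤ r → (∀ k, r ≤ m k) →
          (∃! b : WMac.Zn m n → WMac.Zn m n → WMac.F, WMac.IsMonomialMatrix s r b) ∧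
          ∀ b : WMac.Zn m n → WMac.Zn m n → WMac.F, WMac.IsMonomialMatrix s r b →
            ∀ α : WMac.Zn m n,
              WMac.opD s r (P s α : WMac.Poly m) =
                ∑ β : WMac.Zn m n with WMac.Similar β α, b α β • WMac.toRat (P s β) := by
  refine ⟨?_, fun B hB => ⟨?_, fun P hP s r _ _ => ⟨?_, fun b hb α => ?_⟩⟩⟩
  · obtain ⟨B, hB⟩ := WMac.exists_isScalarProduct m
    exact ⟨B, hB, fun B' hB' => WMac.isScalarProduct_unique hB' hB⟩
  · obtain ⟨P, hP⟩ := WMac.exists_isMacdonald hprec hB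
    exact ⟨P, hP, fun P' hP' => hP'.unique hprec hB hP⟩
  · exact ⟨WMac.opMat m n s r, (WMac.isMonomialMatrix_iff s r _).2 rfl,
      fun b hb => (WMac.isMonomialMatrix_iff s r b).1 hb⟩
  · rw [(WMac.isMonomialMatrix_iff s r b).1 hb]
    exact hP.opD_eq_sum hprec hB s r α
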